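/- **Conventions.** A computable metric space is a complete metric space $X$ with a dense sequence of basic points $(x_i)_{i\in\mathbb N}$ such that $(i,j)\mapsto d(x_i,x_j)$ is computable. A Cauchy name of $z\in X$ is an $h\in\mathbb N^{\mathbb N}$ with $d(x_{h(j)},x_{h(i)})\le 2^{-i}$ for all $j\ge i$ and $x_{h(i)}\to z$. A map $f\colon X\to Y$ is computable if some partial computable $F\colon{\subseteq}\,\mathbb N^{\mathbb N}\to\mathbb N^{\mathbb N}$ sends every Cauchy name of every $z\in X$ to a Cauchy name of $f(z)$. A function $t\colon X\to[0,\infty]$ is lower semicomputable if $t=\sup_n g_n$ for a computable sequence of computable functions $g_n\colon X\to\mathbb R$. Products carry the maximum metric and pairs of basic points. Let $\mathcal M(X)$ and $\mathcal M_1(X)$ be the sets of finite Borel measures and of Borel probability measures on $X$. Let $(f_i)_{i\in\mathbb N}$ be a natural enumeration of the closure, under $\max$, $\min$ and rational linear combinations, of the constant function $1$ and the functions that equal $1$ within distance $r$ of a basic point, equal $0$ beyond distance $s$ of it, and are linear in the distance in between ($0<r<s$ rational). Names of measures are the Cauchy names for the metric $$d(\mu,\nu)=\sum_i 2^{-i}\Bigl(1-\exp\bigl(-\bigl|\textstyle\int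 f_i\,d\mu-\int f_i\,d\nu\bigr|\bigr)\Bigr)$$ and the basic points $q_1\delta_{x_{i_1}}+\dots+q_n\delta_{x_{i_n}}$ with $n\ge 1$ and positive rational $q_j$ (with $\sum_j q_j=1$ in the case of $\mathcal M_1(X)$). Computability of maps on and into $\mathcal M(X)$, $\mathcal M_1(X)$ and products with them is understood through these names. Let $A$ be a space of oracles (a computable metric space, a space $\mathcal M_1(X)$, or a product of such). A uniform Schnorr integral test is a lower semicomputable function $t\colon A\times\mathcal M(X)\times X\to[0,\infty]$ such that $\int t(a,\mu,x)\,d\mu(x)<\infty$ for all $a\in A$ and $\mu\in\mathcal M(X)$, and such that $(a,\mu)\mapsto\int t(a,\mu,x)\,d\mu(x)$ is a computable map $A\times\mathcal M(X)\to\mathbb R$. For $a\in A$ and $\mu\in\mathcal M(X)$, let $\mathsf{SR}_\mu^a$ be the set of all $x\in X$ such that $t(a,\mu,x)<\infty$ for every uniform Schnorr integral test $t$. We write $\mathsf{SR}_\mu$ when there is no oracle ($A$ is the one-point space), and $\mathsf{SR}_\mu^{a,b}$ for the oracle $(a,b)$ in a product space. **Theorem.** Let $\mathbb X$ and $\mathbb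 Y$ be computable metric spaces, let $\mu\in\mathcal M_1(\mathbb X)$ and $\nu\in\mathcal M_1(\mathbb Y)$ be arbitrary (possibly noncomputable) Borel probability measures, and let $x\in\mathbb X$, $y\in\mathbb Y$. Then $$(x,y)\in\mathsf{SR}_{\mu\otimes\nu}\iff x\in\mathsf{SR}_\mu^{\nu}\ \text{and}\ y\in\mathsf{SR}_\nu^{\mu,x},$$ and moreover $$\bigl(x\in\mathsf{SR}_\mu^{\nu}\ \text{and}\ y\in\mathsf{SR}_\nu^{\mu,x}\bigr)\iff\bigl(y\in\mathsf{SR}_\nu^{\mu}\ \text{and}\ x\in\mathsf{SR}_\mu^{\nu,y}\bigr).$$ -/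

import Mathlib

open MeasureTheory Filter Topology
open scoped NNReal ENNReal

noncomputable section

/-! ### Rational numbers, and computable families of real numbers -/

/-- The standard effective enumeration of `ℚ`: the index codes `(a, b, c)`, the value is
`(a - b) / (c + 1)`. -/
def ratOf (n : ℕ) : ℚ :=
  ((n.unpair.1.unpair.1 : ℚ) - (n.unpair.1.unpair.2 : ℚ)) / ((n.unpair.2 : ℚ) + 1)

/-- The standard effective enumeration of the positive rationals: the index codes `(a, b)`,
the value is `(a + 1) / (b + 1)`. -/
def posRatOf (n : ℕ) : ℚ≥0 :=
  ((n.unpair.1 : ℚ≥0) + 1) / ((n.unpair.2 : ℚ≥0) + 1)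

/-- A family `f : α → ℝ` indexed by a countable coded type is computable if there is a computable
`α × ℕ → ℚ` (given through indices of rationals) such that, for every `n`, the sequence
`i ↦ g (n, i)` satisfies `|g (n, j) - g (n, i)| ≤ 2⁻ⁱ` for `j ≥ i` and converges to `f n`. -/
def IsComputableFamily {α : Type*} [Primcodable α] (f : α → ℝ) : Prop :=
  ∃ g : α × ℕ → ℕ, Computable g ∧
    (∀ n i j, i ≤ j → |(ratOf (g (n, j)) : ℝ) - (ratOf (g (n, i)) : ℝ)| ≤ (2 : ℝ)⁻¹ ^ i) ∧
    ∀ n, Tendsto (fun i => (ratOf (g (n, i)) : ℝ)) atTop (𝓝 (f n))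

/-! ### Computable metric spaces -/

/-- A computable metric space: a complete metric space with a dense sequence of basic points
whose mutual distances are uniformly computable. -/
class ComputableMetricSpace (X : Type*) extends MetricSpace X, CompleteSpace X where
  /-- The sequence of basic points. -/
  basicPoint : ℕ → X
  dense_basicPoint : DenseRange basicPoint
  computable_dist : IsComputableFamily fun p : ℕ × ℕ => dist (basicPoint p.1) (basicPoint p.2)

/-- The data on which the notion of a Cauchy name depends: a distance and a sequence of basic
points. It carries no laws; it is only ever used for computable metric spaces, for the concrete
spaces `ℕ`, `ℝ`, one point, spaces of measures, and their products. -/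
class BasicMetric (X : Type*) where
  /-- The distance. -/
  d : X → X → ℝ
  /-- The sequence of basic points. -/
  pt : ℕ → X

instance (X : Type*) [ComputableMetricSpace X] : BasicMetric X where
  d := dist
  pt := ComputableMetricSpace.basicPoint

instance : BasicMetric ℕ where
  d m n := |(m : ℝ) - (n : ℝ)|
  pt n := n

instance : BasicMetric ℝ where
  d x y := |x - y|
  pt n := (ratOf n : ℝ)

instance : BasicMetric Unit where
  d _ _ := 0
  pt _ := ()

/-- Products carry the maximum metric; the basic points are the pairs of basic points. -/
instance (X Y : Type*) [BasicMetric X] [BasicMetric Y] : BasicMetric (X × Y) where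
  d p q := max (BasicMetric.d p.1 q.1) (BasicMetric.d p.2 q.2)
  pt n := (BasicMetric.pt n.unpair.1, BasicMetric.pt n.unpair.2)

/-- `h` is a Cauchy name for `y`: `d (x_{h j}, x_{h i}) ≤ 2⁻ⁱ` for `j ≥ i`, and `x_{h i} → y`. -/
def IsCauchyName {X : Type*} [BasicMetric X] (h : ℕ → ℕ) (y : X) : Prop :=
  (∀ i j, i ≤ j →
    BasicMetric.d (BasicMetric.pt (h j) : X) (BasicMetric.pt (h i)) ≤ (2 : ℝ)⁻¹ ^ i) ∧
  Tendsto (fun i => BasicMetric.d (BasicMetric.pt (h i)) y) atTop (𝓝 0)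

/-! ### Computable maps -/

/-- The value `m` is output on input `n` with oracle `h`, by the machine `ψ`: the machine is shown
longer and longer finite initial segments of `h` until, for the first time, it answers, and that
answer is `m`. -/
def OracleOutputs (ψ : List ℕ × ℕ → Option ℕ) (h : ℕ → ℕ) (n m : ℕ) : Prop :=
  ∃ k, ψ ((List.range k).map h, n) = some m ∧ ∀ j < k, ψ ((List.range j).map h, n) = none

/-- A partial map of Baire space into itself is (partial) computable if its values are computed,
digit by digit, by one machine with oracle access to the argument; the map is defined at
exactly those arguments for which the machine answers on every input. -/
def IsPartialComputable (F : (ℕ → ℕ) →. (ℕ → ℕ)) : Prop :=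
  ∃ ψ : List ℕ × ℕ → Option ℕ, Computable ψ ∧
    ∀ h g, g ∈ F h ↔ ∀ n, OracleOutputs ψ h n (g n)

/-- A map is computable if some partial computable map of Baire space sends each Cauchy name of
a point to a Cauchy name of its image. -/
def IsComputableMap {X Y : Type*} [BasicMetric X] [BasicMetric Y] (f : X → Y) : Prop :=
  ∃ F : (ℕ → ℕ) →. (ℕ → ℕ), IsPartialComputable F ∧
    ∀ (x : X) (h : ℕ → ℕ), IsCauchyName h x → ∃ g ∈ F h, IsCauchyName g (f x)

/-- `t : Z → [0, ∞]` is lower semicomputable if it is the pointwise supremum of a computable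
sequence of computable real-valued functions. -/
def IsLowerSemicomputable {Z : Type*} [BasicMetric Z] (t : Z → ℝ≥0∞) : Prop :=
  ∃ g : ℕ × Z → ℝ, IsComputableMap g ∧
    ∀ z, (t z : EReal) = ⨆ n : ℕ, ((g (n, z) : ℝ) : EReal)

/-! ### Spaces of measures -/

/-- The bump function with centre `c`: equal to `1` within distance `r`, to `0` beyond distance
`s`, and linear in the distance in between. -/
def bump {X : Type*} [BasicMetric X] (c : X) (r s : ℝ) (y : X) : ℝ :=
  if BasicMetric.d c y ≤ r then 1
  else if BasicMetric.d c y ≤ s then (s - BasicMetric.d c y) / (s - r)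
  else 0

/-- A natural enumeration (with repetitions) of the basic functions, that is, of the closure of
the constant `1` and the basic bump functions (basic centre, rational radii `0 < r < s`) under
`max`, `min`, and rational linear combinations. -/
def basicFunction (X : Type*) [BasicMetric X] : ℕ → X → ℝ
  | 0 => fun _ => 1
  | n + 1 =>
    if n % 5 = 0 then
      bump (BasicMetric.pt (n / 5).unpair.1) (posRatOf (n / 5).unpair.2.unpair.1 : ℝ)
        ((posRatOf (n / 5).unpair.2.unpair.1 : ℝ) + (posRatOf (n / 5).unpair.2.unpair.2 : ℝ))
    else if n % 5 = 1 then fun y =>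
      max (basicFunction X (n / 5).unpair.1 y) (basicFunction X (n / 5).unpair.2 y)
    else if n % 5 = 2 then fun y =>
      min (basicFunction X (n / 5).unpair.1 y) (basicFunction X (n / 5).unpair.2 y)
    else if n % 5 = 3 then fun y =>
      basicFunction X (n / 5).unpair.1 y + basicFunction X (n / 5).unpair.2 y
    else fun y =>
      (ratOf (n / 5).unpair.1 : ℝ) * basicFunction X (n / 5).unpair.2 y
  termination_by n => n
  decreasing_by
    all_goals first
      | exact Nat.lt_succ_of_le ((Nat.unpair_left_le _).trans (Nat.div_le_self n 5))
      | exact Nat.lt_succ_of_le ((Nat.unpair_right_le _).trans (Nat.div_le_self n 5))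

/-- The distance `∑ᵢ 2⁻ⁱ (1 - exp (-|∫ fᵢ dμ - ∫ fᵢ dν|))` of two measures, where `(fᵢ)` is the
enumeration of the basic functions. -/
def measureDist {X : Type*} [BasicMetric X] [MeasurableSpace X] (μ ν : Measure X) : ℝ :=
  ∑' i : ℕ, (2 : ℝ)⁻¹ ^ i *
    (1 - Real.exp (-|∫ x, basicFunction X i x ∂μ - ∫ x, basicFunction X i x ∂ν|))

/-- The basic measures: an enumeration of all `q₁ δ_{x₁} + … + qₙ δ_{xₙ}` with `n ≥ 1`, positive
rational `qⱼ` and basic points `xⱼ`. -/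
def basicMeasure (X : Type*) [BasicMetric X] [MeasurableSpace X] (n : ℕ) : FiniteMeasure X :=
  ((n.unpair.1 :: Denumerable.ofNat (List ℕ) n.unpair.2).map fun c =>
    (posRatOf c.unpair.1 : ℝ≥0) • (diracProba (BasicMetric.pt c.unpair.2 : X)).toFiniteMeasure).sum

/-- The space of finite Borel measures. -/
instance (X : Type*) [BasicMetric X] [MeasurableSpace X] : BasicMetric (FiniteMeasure X) where
  d μ ν := measureDist (μ : Measure X) (ν : Measure X)
  pt := basicMeasure X

/-- The space of Borel probability measures. The normalizations of the basic measures are exactly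
the basic measures with `q₁ + … + qₙ = 1`. -/
instance (X : Type*) [BasicMetric X] [MeasurableSpace X] :
    BasicMetric (ProbabilityMeasure X) where
  d μ ν := measureDist (μ : Measure X) (ν : Measure X)
  pt n :=
    haveI : Nonempty X := ⟨BasicMetric.pt 0⟩
    (basicMeasure X n).normalize

/-! ### Uniform Schnorr randomness -/

/-- A uniform Schnorr integral test: a lower semicomputable `t : A × M(X) × X → [0, ∞]` such that
`∫ t(a, μ, x) dμ(x)` is finite for all `a` and `μ`, and computable as a map `A × M(X) → ℝ`. -/
structure IsUniformSchnorrTest {A X : Type*} [BasicMetric A] [BasicMetric X] [MeasurableSpace X]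
    (t : A × FiniteMeasure X × X → ℝ≥0∞) : Prop where
  lowerSemicomputable : IsLowerSemicomputable t
  lintegral_lt_top : ∀ (a : A) (μ : FiniteMeasure X), ∫⁻ x, t (a, μ, x) ∂(μ : Measure X) < ∞
  computable_integral : IsComputableMap fun p : A × FiniteMeasure X =>
    (∫⁻ x, t (p.1, p.2, x) ∂(p.2 : Measure X)).toReal

/-- The set of points that are uniformly Schnorr `μ`-random relative to the oracle `a`. -/
def schnorrRandomRel {A X : Type*} [BasicMetric A] [BasicMetric X] [MeasurableSpace X]
    (a : A) (μ : FiniteMeasure X) : Set X :=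
  {x | ∀ t : A × FiniteMeasure X × X → ℝ≥0∞, IsUniformSchnorrTest t → t (a, μ, x) < ∞}

/-- The set of points that are uniformly Schnorr `μ`-random (without oracle, that is, relative to
the only point of the one-point space). -/
def schnorrRandom {X : Type*} [BasicMetric X] [MeasurableSpace X]
    (μ : FiniteMeasure X) : Set X :=
  schnorrRandomRel () μ

end

/-! Names are eliminated first. A map between effective metric spaces is computable iff the
preimages of basic balls are, uniformly, recursively enumerable unions of basic balls
(`isComputableMap_iff`); this is `CMap`, and it is closed under composition, arithmetic, primitive
recursion and suitable limits. In these terms a measure carries the same information as the sequence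
of its integrals of basic functions (`IsMeasureModel.cmap_of`, `IsMeasureModel.cmap_integral`), and
computable integrands with computable bounds have computable integrals (`CMap.integral`). Hence
products and marginals of measures are computable. A test becomes a series `t = ∑ τ i` of computable
functions with `0 ≤ τ i ≤ i + 1` whose integrals sum to the computable number `∫ t`
(`IsUniformSchnorrTest.exists_sum`).

From the components to the pair (`mem_schnorrRandom_prod`). Let `t = ∑ τ i` be a test for the
product, `S i x` the integral of `τ i (x, ·)` against `ν`, and `m i` the integral of `S i` against
`μ`. The section of `t` at `x` need not be a test with oracle `x`: its integral `∑ S i x` is not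
computable from `x`, and it may be infinite for other points. Let `R n > 0` be computable bounds of
the tails of `∑ m i` that decrease to `0`. The series `∑ m i / √(R i)` telescopes to at most `2 √(R
0)`, with equally explicit tails, so `∑ S i / √(R i)` is a test and its partial sums at the random
point `x` stay below some natural number `C`. Now multiply `τ i` by a continuous factor that
vanishes once the weighted partial sum exceeds `C + 1`. Since the weights `1 / √(R i)` increase to
infinity, the cut-off series of integrals has tails at most `√(R n) (C + 1)` for all values of the
parameters, so it is a genuine test. At the actual parameters nothing is cut off, and randomness of
`y` gives `t (x, y) < ∞`.

From the pair to the components. A test for `x` is pulled back along the projection, the other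
marginal serving as the oracle (`fst_mem_schnorrRandomRel`). A test for `y` with oracle `x` has an
integral `I` that may be unbounded in `x`, so it is divided by `1 + I`. For a measure on the product
space that is not a product measure, the integral of the result is not controlled by the marginals;
the same cutoff repairs this, because at product measures Fubini's theorem bounds the weighted sums
(`snd_mem_schnorrRandomRel`). Both uses of the cutoff are instances of
`tsum_lt_top_of_mem_schnorrRandomRel`. The exchange of the roles of `x` and `y` is the invariance of
product randomness under swapping coordinates. -/

noncomputable section

set_option linter.unusedSectionVars false

/-! ### Recursively enumerable predicates -/

attribute [fun_prop] Computable

namespace Computable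

variable {α β γ : Type*} [Primcodable α] [Primcodable β] [Primcodable γ]

@[fun_prop] theorem fun_id : Computable (fun a : α => a) := Computable.id

@[fun_prop] theorem fun_const (c : β) : Computable (fun _ : α => c) := Computable.const c

@[fun_prop] theorem fun_comp {f : β → γ} {g : α → β} (hf : Computable f) (hg : Computable g) :
    Computable fun a => f (g a) := hf.comp hg

@[fun_prop] theorem fun_pair {f : α → β} {g : α → γ} (hf : Computable f) (hg : Computable g) :
    Computable fun a => (f a, g a) := hf.pair hg

@[fun_prop] theorem fun_fst {f : α → β × γ} (hf : Computable f) : Computable fun a => (f a).1 :=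
  Computable.fst.comp hf

@[fun_prop] theorem fun_snd {f : α → β × γ} (hf : Computable f) : Computable fun a => (f a).2 :=
  Computable.snd.comp hf

@[fun_prop] theorem fun_add {f g : α → ℕ} (hf : Computable f) (hg : Computable g) :
    Computable fun a => f a + g a := Primrec.nat_add.to_comp.comp hf hg

@[fun_prop] theorem fun_sub {f g : α → ℕ} (hf : Computable f) (hg : Computable g) :
    Computable fun a => f a - g a := Primrec.nat_sub.to_comp.comp hf hg

@[fun_prop] theorem fun_mul {f g : α → ℕ} (hf : Computable f) (hg : Computable g) :
    Computable fun a => f a * g a := Primrec.nat_mul.to_comp.comp hf hg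

@[fun_prop] theorem fun_div {f g : α → ℕ} (hf : Computable f) (hg : Computable g) :
    Computable fun a => f a / g a := Primrec.nat_div.to_comp.comp hf hg

@[fun_prop] theorem fun_mod {f g : α → ℕ} (hf : Computable f) (hg : Computable g) :
    Computable fun a => f a % g a := Primrec.nat_mod.to_comp.comp hf hg

@[fun_prop] theorem fun_unpair {f : α → ℕ} (hf : Computable f) :
    Computable fun a => (f a).unpair := Computable.unpair.comp hf

@[fun_prop] theorem fun_natPair {f g : α → ℕ} (hf : Computable f) (hg : Computable g) :
    Computable fun a => Nat.pair (f a) (g a) := Primrec₂.natPair.to_comp.comp hf hg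

@[fun_prop] theorem fun_and {f g : α → Bool} (hf : Computable f) (hg : Computable g) :
    Computable fun a => (f a && g a) := Primrec.and.to_comp.comp hf hg

@[fun_prop] theorem fun_or {f g : α → Bool} (hf : Computable f) (hg : Computable g) :
    Computable fun a => (f a || g a) := Primrec.or.to_comp.comp hf hg

@[fun_prop] theorem fun_lt {f g : α → ℕ} (hf : Computable f) (hg : Computable g) :
    Computable fun a => decide (f a < g a) := Primrec.nat_lt.decide.to_comp.comp hf hg

@[fun_prop] theorem fun_le {f g : α → ℕ} (hf : Computable f) (hg : Computable g) :
    Computable fun a => decide (f a ≤ g a) := Primrec.nat_le.decide.to_comp.comp hf hg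

theorem fun_decide_eq [DecidableEq β] {f g : α → β} (hf : Computable f)
    (hg : Computable g) : Computable fun a => decide (f a = g a) :=
  Primrec.eq.decide.to_comp.comp hf hg

@[fun_prop] theorem fun_natRec {f : α → ℕ} {g : α → β} {h : α → ℕ → β → β} (hf : Computable f)
    (hg : Computable g) (hh : Computable fun p : α × ℕ × β => h p.1 p.2.1 p.2.2) :
    Computable fun a => (Nat.rec (g a) (fun n b => h a n b) (f a) : β) :=
  Computable.nat_rec hf hg (h := fun a p => h a p.1 p.2) hh

@[fun_prop] theorem fun_natPow {f g : α → ℕ} (hf : Computable f) (hg : Computable g) :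
    Computable fun a => f a ^ g a := by
  have h : Computable fun a => (Nat.rec 1 (fun _ b => b * f a) (g a) : ℕ) :=
    fun_natRec hg (by fun_prop) (h := fun a _ b => b * f a) (by fun_prop)
  refine h.of_eq fun a => ?_
  induction g a with
  | zero => simp
  | succ n ih => rw [pow_succ, ← ih]

@[fun_prop] theorem fun_getD {f : α → List β} {g : α → ℕ} (d : β) (hf : Computable f)
    (hg : Computable g) : Computable fun a => (f a).getD (g a) d :=
  (Primrec.list_getD d).to_comp.comp hf hg

@[fun_prop] theorem fun_length {f : α → List β} (hf : Computable f) :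
    Computable fun a => (f a).length := Computable.list_length.comp hf

@[fun_prop] theorem fun_take {f : α → List β} {g : α → ℕ} (hf : Computable f)
    (hg : Computable g) : Computable fun a => (f a).take (g a) :=
  Primrec.list_take.to_comp.comp hg hf

@[fun_prop] theorem fun_ofNat_list {f : α → ℕ} (hf : Computable f) :
    Computable fun a => Denumerable.ofNat (List ℕ) (f a) := (Computable.ofNat (List ℕ)).comp hf

@[fun_prop] theorem fun_some {f : α → β} (hf : Computable f) :
    Computable fun a => some (f a) := Computable.option_some.comp hf

end Computable

/-- The entry number `i` of the finite sequence of naturals coded by `n`, with default value `0`. -/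
def seqEntry (n i : ℕ) : ℕ := (Denumerable.ofNat (List ℕ) n).getD i 0

@[fun_prop] theorem computable_seqEntry {α : Type*} [Primcodable α] {f g : α → ℕ}
    (hf : Computable f) (hg : Computable g) : Computable fun a => seqEntry (f a) (g a) := by
  unfold seqEntry; fun_prop

/-- Packs finitely many witnesses into one number, so that a single search over `ℕ` can find them
together. -/
theorem exists_seqEntry (s : ℕ → ℕ) (n : ℕ) : ∃ c, ∀ i < n, seqEntry c i = s i := by
  refine ⟨Encodable.encode ((List.range n).map s), fun i hi => ?_⟩
  simp [seqEntry, hi]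

/-- Recursively enumerable predicates: projections of computable ones. -/
def RE {α : Type*} [Primcodable α] (p : α → Prop) : Prop :=
  ∃ f : α × ℕ → Bool, Computable f ∧ ∀ a, p a ↔ ∃ n, f (a, n) = true

namespace RE

variable {α β : Type*} [Primcodable α] [Primcodable β] {p q : α → Prop}

theorem congr (hp : RE p) (h : ∀ a, q a ↔ p a) : RE q := by
  obtain ⟨f, hf, hfp⟩ := hp
  exact ⟨f, hf, fun a => (h a).trans (hfp a)⟩

theorem of_decide [DecidablePred p] (h : Computable fun a => decide (p a)) : RE p :=
  ⟨fun a => decide (p a.1), h.comp Computable.fst, fun a => by simp⟩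

theorem of_bool {f : α → Bool} (h : Computable f) : RE fun a => f a = true :=
  ⟨fun a => f a.1, by fun_prop, fun a => by simp⟩

theorem comp (hp : RE p) {g : β → α} (hg : Computable g) : RE fun b => p (g b) := by
  obtain ⟨f, hf, hfp⟩ := hp
  exact ⟨fun a => f (g a.1, a.2), by fun_prop, fun a => hfp _⟩

theorem and (hp : RE p) (hq : RE q) : RE fun a => p a ∧ q a := by
  obtain ⟨f, hf, hfp⟩ := hp
  obtain ⟨g, hg, hgq⟩ := hq
  refine ⟨fun a => f (a.1, a.2.unpair.1) && g (a.1, a.2.unpair.2), by fun_prop, fun a => ?_⟩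
  simp only [hfp, hgq]
  constructor
  · rintro ⟨⟨m, hm⟩, n, hn⟩
    exact ⟨Nat.pair m n, by simp [hm, hn]⟩
  · rintro ⟨n, hn⟩
    simp only [Bool.and_eq_true] at hn
    exact ⟨⟨_, hn.1⟩, _, hn.2⟩

theorem or (hp : RE p) (hq : RE q) : RE fun a => p a ∨ q a := by
  obtain ⟨f, hf, hfp⟩ := hp
  obtain ⟨g, hg, hgq⟩ := hq
  refine ⟨fun a => f a || g a, by fun_prop, fun a => ?_⟩
  simp only [hfp, hgq, ← exists_or, Bool.or_eq_true]

theorem exists_nat {p : α × ℕ → Prop} (hp : RE p) : RE fun a => ∃ n, p (a, n) := by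
  obtain ⟨f, hf, hfp⟩ := hp
  refine ⟨fun a => f ((a.1, a.2.unpair.1), a.2.unpair.2), by fun_prop, fun a => ?_⟩
  simp only [hfp]
  constructor
  · rintro ⟨m, n, hn⟩
    exact ⟨Nat.pair m n, by simp [hn]⟩
  · rintro ⟨n, hn⟩
    exact ⟨_, _, hn⟩

/-- The witnesses for all `i < b a` are entries of one coded sequence, and a primitive recursion
checks them one after the other. -/
theorem forall_lt {p : α × ℕ → Prop} (hp : RE p) {b : α → ℕ} (hb : Computable b) :
    RE fun a => ∀ i < b a, p (a, i) := by
  obtain ⟨f, hf, hfp⟩ := hp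
  have key : ∀ (g : ℕ → Bool) (n : ℕ),
      (Nat.rec true (fun i b => b && g i) n : Bool) = true ↔ ∀ i < n, g i = true := by
    intro g n
    induction n with
    | zero => simp
    | succ n ih =>
      rw [Nat.forall_lt_succ_right, ← ih]
      simp
  refine ⟨fun a => Nat.rec true (fun i b => b && f ((a.1, i), seqEntry a.2 i)) (b a.1), ?_,
    fun a => ?_⟩
  · exact Computable.fun_natRec (by fun_prop) (by fun_prop)
      (h := fun (a : α × ℕ) i b => b && f ((a.1, i), seqEntry a.2 i)) (by fun_prop)
  · constructor
    · intro h
      choose! s hs using fun i hi => (hfp (a, i)).1 (h i hi)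
      obtain ⟨c, hc⟩ := exists_seqEntry s (b a)
      refine ⟨c, (key _ _).2 fun i hi => ?_⟩
      dsimp only
      rw [hc i hi, hs i hi]
    · rintro ⟨n, hn⟩ i hi
      exact (hfp _).2 ⟨_, (key _ _).1 hn i hi⟩

end RE

theorem re_iff {α : Type*} [Primcodable α] {p : α → Prop} :
    RE p ↔ ∃ f : α × ℕ → Bool, Computable f ∧ ∀ a, p a ↔ ∃ n, f (a, n) = true := Iff.rfl

attribute [irreducible] RE

/-! ### Indices of rational numbers -/

/-- The index of `(a - b) / (c + 1)`. -/
def ratMk (a b c : ℕ) : ℕ := Nat.pair (Nat.pair a b) c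

theorem ratOf_ratMk (a b c : ℕ) : ratOf (ratMk a b c) = ((a : ℚ) - b) / (c + 1) := by
  simp [ratOf, ratMk]

theorem ratOf_surjective : Function.Surjective ratOf := fun q => by
  refine ⟨ratMk q.num.toNat (-q.num).toNat (q.den - 1), ?_⟩
  rw [ratOf_ratMk]
  have h1 : ((q.num.toNat : ℚ) - ((-q.num).toNat : ℚ)) = q.num := by
    have := Int.toNat_sub_toNat_neg q.num
    exact_mod_cast this
  have h2 : ((q.den - 1 : ℕ) : ℚ) + 1 = q.den := by
    have := q.den_pos
    exact_mod_cast Nat.sub_add_cancel this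
  rw [h1, h2, Rat.num_div_den]

theorem exists_ratOf_between {x y : ℝ} (h : x < y) : ∃ n, x < (ratOf n : ℝ) ∧ (ratOf n : ℝ) < y := by
  obtain ⟨q, hq⟩ := exists_rat_btwn h
  obtain ⟨n, rfl⟩ := ratOf_surjective q
  exact ⟨n, hq⟩

/-- Addition on indices of rationals. -/
def ratAdd (m n : ℕ) : ℕ :=
  ratMk (m.unpair.1.unpair.1 * (n.unpair.2 + 1) + n.unpair.1.unpair.1 * (m.unpair.2 + 1))
    (m.unpair.1.unpair.2 * (n.unpair.2 + 1) + n.unpair.1.unpair.2 * (m.unpair.2 + 1))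
    -- An index stores the denominator minus one.
    ((m.unpair.2 + 1) * (n.unpair.2 + 1) - 1)

/-- Negation on indices of rationals. -/
def ratNeg (m : ℕ) : ℕ := ratMk m.unpair.1.unpair.2 m.unpair.1.unpair.1 m.unpair.2

/-- Multiplication on indices of rationals. -/
def ratMul (m n : ℕ) : ℕ :=
  ratMk (m.unpair.1.unpair.1 * n.unpair.1.unpair.1 + m.unpair.1.unpair.2 * n.unpair.1.unpair.2)
    (m.unpair.1.unpair.1 * n.unpair.1.unpair.2 + m.unpair.1.unpair.2 * n.unpair.1.unpair.1)
    ((m.unpair.2 + 1) * (n.unpair.2 + 1) - 1)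

theorem cast_mul_succ_sub_one (a b : ℕ) :
    (((a + 1) * (b + 1) - 1 : ℕ) : ℚ) + 1 = ((a : ℚ) + 1) * (b + 1) := by
  have : (a + 1) * (b + 1) - 1 + 1 = (a + 1) * (b + 1) := Nat.sub_add_cancel (by nlinarith)
  exact_mod_cast this

theorem ratOf_ratAdd (m n : ℕ) : ratOf (ratAdd m n) = ratOf m + ratOf n := by
  rw [ratAdd, ratOf_ratMk, cast_mul_succ_sub_one, ratOf, ratOf, div_add_div _ _ (by positivity)
    (by positivity)]
  push_cast
  ring_nf

theorem ratOf_ratNeg (m : ℕ) : ratOf (ratNeg m) = - ratOf m := by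
  rw [ratNeg, ratOf_ratMk, ratOf, ← neg_div]
  ring_nf

theorem ratOf_ratMul (m n : ℕ) : ratOf (ratMul m n) = ratOf m * ratOf n := by
  rw [ratMul, ratOf_ratMk, cast_mul_succ_sub_one, ratOf, ratOf, div_mul_div_comm]
  push_cast
  ring_nf

section
variable {α : Type*} [Primcodable α] {f g h : α → ℕ}

@[fun_prop] theorem computable_ratMk (hf : Computable f) (hg : Computable g) (hh : Computable h) :
    Computable fun a => ratMk (f a) (g a) (h a) := by
  unfold ratMk; fun_prop

@[fun_prop] theorem computable_ratAdd (hf : Computable f) (hg : Computable g) :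
    Computable fun a => ratAdd (f a) (g a) := by
  unfold ratAdd; fun_prop

@[fun_prop] theorem computable_ratMul (hf : Computable f) (hg : Computable g) :
    Computable fun a => ratMul (f a) (g a) := by
  unfold ratMul; fun_prop

@[fun_prop] theorem computable_ratNeg (hf : Computable f) : Computable fun a => ratNeg (f a) := by
  unfold ratNeg; fun_prop

/-- Cross multiplication, with negative terms moved to the other side so that the comparison takes
place in `ℕ`. -/
theorem ratOf_lt_iff (m n : ℕ) : ratOf m < ratOf n ↔
    m.unpair.1.unpair.1 * (n.unpair.2 + 1) + n.unpair.1.unpair.2 * (m.unpair.2 + 1) <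
    n.unpair.1.unpair.1 * (m.unpair.2 + 1) + m.unpair.1.unpair.2 * (n.unpair.2 + 1) := by
  rw [ratOf, ratOf, div_lt_div_iff₀ (by positivity) (by positivity), ← @Nat.cast_lt ℚ]
  push_cast
  constructor <;> intro h <;> linarith

theorem RE.ratOf_lt (hf : Computable f) (hg : Computable g) :
    RE fun a => ratOf (f a) < ratOf (g a) := by
  simp only [ratOf_lt_iff]
  exact RE.of_decide (Computable.fun_lt (by fun_prop) (by fun_prop))

theorem RE.ratOf_le (hf : Computable f) (hg : Computable g) :
    RE fun a => ratOf (f a) ≤ ratOf (g a) := by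
  simp only [← not_lt, ratOf_lt_iff]
  simp only [not_lt]
  exact RE.of_decide (Computable.fun_le (by fun_prop) (by fun_prop))

end

/-- The basic radii. -/
def rad (k : ℕ) : ℝ := 1 / ((k : ℝ) + 1)

theorem rad_pos (k : ℕ) : 0 < rad k := by unfold rad; positivity

theorem rad_le_one (k : ℕ) : rad k ≤ 1 := by
  unfold rad
  rw [div_le_one (by positivity)]
  simp

theorem exists_rad_lt {ε : ℝ} (h : 0 < ε) : ∃ k, rad k < ε := exists_nat_one_div_lt h

/-- The index of the rational number `rad k`. -/
def radIndex (k : ℕ) : ℕ := ratMk 1 0 k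

@[simp] theorem ratOf_radIndex (k : ℕ) : (ratOf (radIndex k) : ℝ) = rad k := by
  simp [radIndex, ratOf_ratMk, rad]

@[fun_prop] theorem computable_radIndex {α : Type*} [Primcodable α] {f : α → ℕ}
    (hf : Computable f) : Computable fun a => radIndex (f a) := by
  unfold radIndex; fun_prop

/-! ### Effective metric spaces, semidecidable sets and computable maps -/

open BasicMetric (d pt)

/-- The laws of a (pseudo-)metric with a dense sequence of basic points whose distances are
upper semicomputable. -/
class EffectiveMetric (Z : Type*) [BasicMetric Z] : Prop where
  d_self : ∀ z : Z, d z z = 0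
  d_comm : ∀ z w : Z, d z w = d w z
  d_triangle : ∀ x y z : Z, d x z ≤ d x y + d y z
  dense : ∀ (z : Z) (ε : ℝ), 0 < ε → ∃ i, d (pt i) z < ε
  re_dist : RE fun p : ℕ × ℕ × ℕ => d (pt p.1 : Z) (pt p.2.1) < (ratOf p.2.2 : ℝ)

namespace EffectiveMetric

variable {Z : Type*} [BasicMetric Z] [EffectiveMetric Z]

theorem d_nonneg (x y : Z) : 0 ≤ d x y := by
  have h := d_triangle x y x
  rw [d_self, d_comm y x] at h
  linarith

theorem exists_ball (z : Z) {ε : ℝ} (hε : 0 < ε) : ∃ c t, d (pt c) z < rad t ∧ rad t < ε := by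
  obtain ⟨t, ht⟩ := exists_rad_lt hε
  obtain ⟨c, hc⟩ := dense z (rad t) (rad_pos t)
  exact ⟨c, t, hc, ht⟩

/-- `InnerBall i r c t` expresses formally that the ball `B(c, rad t)` is inside `B(i, rad r)`. -/
def _root_.InnerBall (Z : Type*) [BasicMetric Z] (i r c t : ℕ) : Prop :=
  d (pt i : Z) (pt c) + rad t < rad r

theorem _root_.InnerBall.mem {i r c t : ℕ} (h : InnerBall Z i r c t) {z : Z}
    (hz : d (pt c) z < rad t) : d (pt i) z < rad r :=
  (d_triangle _ (pt c) _).trans_lt (by unfold InnerBall at h; linarith)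

variable (Z) in
theorem re_innerBall : RE fun p : ℕ × ℕ × ℕ × ℕ => InnerBall Z p.1 p.2.1 p.2.2.1 p.2.2.2 := by
  have h := (re_dist (Z := Z)).comp (β := ℕ × ℕ × ℕ × ℕ) (g := fun p =>
    (p.1, p.2.2.1, ratAdd (radIndex p.2.1) (ratNeg (radIndex p.2.2.2)))) (by fun_prop)
  refine h.congr fun p => ?_
  simp only [ratOf_ratAdd, ratOf_ratNeg, Rat.cast_add, Rat.cast_neg, ratOf_radIndex, InnerBall]
  constructor <;> intro h <;> linarith

/-- Moving the centre from `z` to `pt c` costs at most `rad t`, and the radius costs `rad t` again;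
the room `δ` pays for both. -/
theorem innerBall_of_lt {i r : ℕ} {z : Z} {δ : ℝ} (h : d (pt i) z + δ < rad r) {c t : ℕ}
    (hz : d (pt c) z < rad t) (ht : rad t < δ / 2) : InnerBall Z i r c t := by
  have := d_triangle (pt i) z (pt c)
  rw [d_comm z] at this
  unfold InnerBall
  linarith

end EffectiveMetric

open EffectiveMetric

/-- Semidecidable sets: recursively enumerable unions of basic balls. -/
def SD {Z : Type*} [BasicMetric Z] (P : Z → Prop) : Prop :=
  ∃ W : ℕ × ℕ → Prop, RE W ∧ ∀ z, P z ↔ ∃ i r, W (i, r) ∧ d (pt i) z < rad r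

/-- Computable maps, in terms of preimages of basic balls. -/
@[fun_prop] def CMap {Z Y : Type*} [BasicMetric Z] [BasicMetric Y] (f : Z → Y) : Prop :=
  SD fun p : ℕ × ℕ × Z => d (pt p.1) (f p.2.2) < rad p.2.1

/-- Computable points. -/
class CPt {Y : Type*} [BasicMetric Y] (y : Y) : Prop where
  re : RE fun p : ℕ × ℕ => d (pt p.1) y < rad p.2

theorem d_nat (m n : ℕ) : d m n = |(m : ℝ) - n| := rfl

theorem d_prod {X Y : Type*} [BasicMetric X] [BasicMetric Y] (p q : X × Y) :
    d p q = max (d p.1 q.1) (d p.2 q.2) := rfl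

theorem pt_nat (n : ℕ) : (pt n : ℕ) = n := rfl

theorem pt_prod {X Y : Type*} [BasicMetric X] [BasicMetric Y] (n : ℕ) :
    (pt n : X × Y) = (pt n.unpair.1, pt n.unpair.2) := rfl

/-- Radii never exceed `1`, so basic balls of `ℕ` are singletons. A factor `ℕ` in a product
therefore acts as a uniformity parameter, as the next lemmas make explicit. -/
theorem d_nat_lt_rad {m n k : ℕ} : d m n < rad k ↔ m = n := by
  rw [d_nat]
  constructor
  · intro h
    have h1 := h.trans_le (rad_le_one k)
    have h2 : |(m : ℤ) - n| < 1 := by exact_mod_cast h1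
    have := Int.abs_lt_one_iff.1 h2
    omega
  · rintro rfl
    simpa using rad_pos k

section
variable {Z Y X : Type*} [BasicMetric Z] [BasicMetric Y] [BasicMetric X]

theorem sd_nat_prod {P : ℕ × Z → Prop} : SD P ↔ ∃ W : ℕ × ℕ × ℕ → Prop, RE W ∧
    ∀ n z, P (n, z) ↔ ∃ i r, W (n, i, r) ∧ d (pt i) z < rad r := by
  constructor
  · rintro ⟨W, hW, h⟩
    refine ⟨fun p => W (Nat.pair p.1 p.2.1, p.2.2), hW.comp (by fun_prop), fun n z => ?_⟩
    rw [h]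
    constructor
    · rintro ⟨i, r, hi, hd⟩
      rw [d_prod, max_lt_iff, pt_prod, pt_nat, d_nat_lt_rad] at hd
      refine ⟨i.unpair.2, r, ?_, hd.2⟩
      have := hd.1
      dsimp only at this
      simpa [← this] using hi
    · rintro ⟨i, r, hi, hd⟩
      refine ⟨_, r, hi, ?_⟩
      rw [d_prod, max_lt_iff, pt_prod, pt_nat, d_nat_lt_rad]
      simpa using hd
  · rintro ⟨W, hW, h⟩
    refine ⟨fun p => W (p.1.unpair.1, p.1.unpair.2, p.2), hW.comp (by fun_prop), ?_⟩
    rintro ⟨n, z⟩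
    rw [h]
    constructor
    · rintro ⟨i, r, hi, hd⟩
      refine ⟨Nat.pair n i, r, by simpa using hi, ?_⟩
      rw [d_prod, max_lt_iff, pt_prod, pt_nat, d_nat_lt_rad]
      simpa using hd
    · rintro ⟨i, r, hi, hd⟩
      rw [d_prod, max_lt_iff, pt_prod, pt_nat, d_nat_lt_rad] at hd
      refine ⟨_, r, ?_, hd.2⟩
      have := hd.1
      dsimp only at this
      simpa [← this] using hi

theorem sd_nat_nat_prod {P : ℕ × ℕ × Z → Prop} : SD P ↔ ∃ W : ℕ × ℕ × ℕ × ℕ → Prop, RE W ∧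
    ∀ m n z, P (m, n, z) ↔ ∃ i r, W (m, n, i, r) ∧ d (pt i) z < rad r := by
  rw [sd_nat_prod]
  constructor
  · rintro ⟨W, hW, h⟩
    refine ⟨fun p => W (p.1, Nat.pair p.2.1 p.2.2.1, p.2.2.2), hW.comp (by fun_prop),
      fun m n z => ?_⟩
    rw [h]
    constructor
    · rintro ⟨i, r, hi, hd⟩
      rw [d_prod, max_lt_iff, pt_prod, pt_nat, d_nat_lt_rad] at hd
      refine ⟨i.unpair.2, r, ?_, hd.2⟩
      have := hd.1
      dsimp only at this
      simpa [← this] using hi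
    · rintro ⟨i, r, hi, hd⟩
      refine ⟨_, r, hi, ?_⟩
      rw [d_prod, max_lt_iff, pt_prod, pt_nat, d_nat_lt_rad]
      simpa using hd
  · rintro ⟨W, hW, h⟩
    refine ⟨fun p => W (p.1, p.2.1.unpair.1, p.2.1.unpair.2, p.2.2), hW.comp (by fun_prop), ?_⟩
    rintro m ⟨n, z⟩
    rw [h]
    constructor
    · rintro ⟨i, r, hi, hd⟩
      refine ⟨Nat.pair n i, r, by simpa using hi, ?_⟩
      rw [d_prod, max_lt_iff, pt_prod, pt_nat, d_nat_lt_rad]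
      simpa using hd
    · rintro ⟨i, r, hi, hd⟩
      rw [d_prod, max_lt_iff, pt_prod, pt_nat, d_nat_lt_rad] at hd
      refine ⟨_, r, ?_, hd.2⟩
      have := hd.1
      dsimp only at this
      simpa [← this] using hi

theorem cmap_iff {f : Z → Y} : CMap f ↔ ∃ W : ℕ × ℕ × ℕ × ℕ → Prop, RE W ∧
    ∀ n k z, d (pt n) (f z) < rad k ↔ ∃ i r, W (n, k, i, r) ∧ d (pt i) z < rad r :=
  sd_nat_nat_prod

namespace SD

variable {P Q : Z → Prop}

theorem congr (hP : SD P) (h : ∀ z, Q z ↔ P z) : SD Q := by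
  obtain ⟨W, hW, hP⟩ := hP
  exact ⟨W, hW, fun z => (h z).trans (hP z)⟩

theorem comp {f : Z → Y} {P : Y → Prop} (hP : SD P) (hf : CMap f) : SD fun z => P (f z) := by
  obtain ⟨W, hW, h⟩ := hP
  obtain ⟨V, hV, hf⟩ := cmap_iff.1 hf
  refine ⟨fun p => ∃ i r, W (i, r) ∧ V (i, r, p), ?_, fun z => ?_⟩
  · refine RE.exists_nat (p := fun q : (ℕ × ℕ) × ℕ => ∃ r, W (q.2, r) ∧ V (q.2, r, q.1)) ?_
    refine RE.exists_nat (p := fun q : ((ℕ × ℕ) × ℕ) × ℕ =>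
      W (q.1.2, q.2) ∧ V (q.1.2, q.2, q.1.1)) ?_
    exact (hW.comp (by fun_prop)).and (hV.comp (by fun_prop))
  · simp only [h, hf]
    constructor
    · rintro ⟨i, r, hi, j, s, hj, hd⟩
      exact ⟨j, s, ⟨i, r, hi, hj⟩, hd⟩
    · rintro ⟨j, s, ⟨i, r, hi, hj⟩, hd⟩
      exact ⟨i, r, hi, j, s, hj, hd⟩

theorem exists_nat {P : ℕ × Z → Prop} (hP : SD P) : SD fun z => ∃ n, P (n, z) := by
  obtain ⟨W, hW, h⟩ := sd_nat_prod.1 hP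
  refine ⟨fun p => ∃ n, W (n, p), ?_, fun z => ?_⟩
  · exact RE.exists_nat (p := fun q : (ℕ × ℕ) × ℕ => W (q.2, q.1)) (hW.comp (by fun_prop))
  · simp only [h]
    constructor
    · rintro ⟨n, i, r, hi, hd⟩
      exact ⟨i, r, ⟨n, hi⟩, hd⟩
    · rintro ⟨i, r, ⟨n, hi⟩, hd⟩
      exact ⟨n, i, r, hi, hd⟩

theorem or (hP : SD P) (hQ : SD Q) : SD fun z => P z ∨ Q z := by
  obtain ⟨W, hW, h⟩ := hP
  obtain ⟨V, hV, h'⟩ := hQ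
  refine ⟨fun p => W p ∨ V p, hW.or hV, fun z => ?_⟩
  simp only [h, h', or_and_right, exists_or]

variable [EffectiveMetric Z]

/-- The intersection is the union of the balls that lie formally inside a ball of each of the two
families; formal inclusion is recursively enumerable, unlike actual inclusion in general. -/
theorem and (hP : SD P) (hQ : SD Q) : SD fun z => P z ∧ Q z := by
  obtain ⟨W, hW, h⟩ := hP
  obtain ⟨V, hV, h'⟩ := hQ
  refine ⟨fun p => (∃ i r, W (i, r) ∧ InnerBall Z i r p.1 p.2) ∧
    (∃ i r, V (i, r) ∧ InnerBall Z i r p.1 p.2), ?_, fun z => ?_⟩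
  · have key : ∀ W : ℕ × ℕ → Prop, RE W → RE fun p : ℕ × ℕ =>
        ∃ i r, W (i, r) ∧ InnerBall Z i r p.1 p.2 := by
      intro W hW
      refine RE.exists_nat (p := fun q : (ℕ × ℕ) × ℕ =>
        ∃ r, W (q.2, r) ∧ InnerBall Z q.2 r q.1.1 q.1.2) ?_
      refine RE.exists_nat (p := fun q : ((ℕ × ℕ) × ℕ) × ℕ =>
        W (q.1.2, q.2) ∧ InnerBall Z q.1.2 q.2 q.1.1.1 q.1.1.2) ?_
      exact (hW.comp (by fun_prop)).and ((re_innerBall Z).comp (g := fun q : ((ℕ × ℕ) × ℕ) × ℕ =>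
        (q.1.2, q.2, q.1.1.1, q.1.1.2)) (by fun_prop))
    exact (key W hW).and (key V hV)
  · change P z ∧ Q z ↔ _
    rw [h, h']
    constructor
    · rintro ⟨⟨i, r, hi, hd⟩, j, s, hj, hd'⟩
      -- Radii below a third of the room suffice: `innerBall_of_lt` is applied with `5/2 * rad t`,
      -- which is below `3 * rad t` and above `2 * rad t`.
      obtain ⟨c, t, hc, ht⟩ := exists_ball z (ε := min (rad r - d (pt i) z) (rad s - d (pt j) z) / 3)
        (by have := lt_min (sub_pos.2 hd) (sub_pos.2 hd'); linarith)
      have h1 := min_le_left (rad r - d (pt i) z) (rad s - d (pt j) z)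
      have h2 := min_le_right (rad r - d (pt i) z) (rad s - d (pt j) z)
      have h3 := rad_pos t
      exact ⟨c, t, ⟨⟨i, r, hi, innerBall_of_lt (δ := 2 * rad t + rad t / 2) (by linarith) hc (by linarith)⟩,
        j, s, hj, innerBall_of_lt (δ := 2 * rad t + rad t / 2) (by linarith) hc (by linarith)⟩, hc⟩
    · rintro ⟨c, t, ⟨⟨i, r, hi, hd⟩, j, s, hj, hd'⟩, hc⟩
      exact ⟨⟨i, r, hi, hd.mem hc⟩, j, s, hj, hd'.mem hc⟩

theorem forall_lt {P : ℕ × Z → Prop} (hP : SD P) : SD fun p : ℕ × Z => ∀ i < p.1, P (i, p.2) := by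
  obtain ⟨W, hW, h⟩ := sd_nat_prod.1 hP
  refine sd_nat_prod.2 ⟨fun p => ∀ j < p.1, ∃ i r, W (j, i, r) ∧ InnerBall Z i r p.2.1 p.2.2, ?_,
    fun n z => ?_⟩
  · refine RE.forall_lt (p := fun q : (ℕ × ℕ × ℕ) × ℕ =>
      ∃ i r, W (q.2, i, r) ∧ InnerBall Z i r q.1.2.1 q.1.2.2) ?_ (by fun_prop)
    refine RE.exists_nat (p := fun q : ((ℕ × ℕ × ℕ) × ℕ) × ℕ =>
        ∃ r, W (q.1.2, q.2, r) ∧ InnerBall Z q.2 r q.1.1.2.1 q.1.1.2.2) ?_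
    refine RE.exists_nat (p := fun q : (((ℕ × ℕ × ℕ) × ℕ) × ℕ) × ℕ =>
        W (q.1.1.2, q.1.2, q.2) ∧ InnerBall Z q.1.2 q.2 q.1.1.1.2.1 q.1.1.1.2.2) ?_
    exact (hW.comp (by fun_prop)).and ((re_innerBall Z).comp
      (g := fun q : (((ℕ × ℕ × ℕ) × ℕ) × ℕ) × ℕ =>
        (q.1.2, q.2, q.1.1.1.2.1, q.1.1.1.2.2)) (by fun_prop))
  · simp only [h]
    constructor
    · intro hn
      -- Finitely many open balls around `z` leave a common room `δ`.
      have : ∃ δ : ℝ, 0 < δ ∧ ∀ j < n, ∃ i r, W (j, i, r) ∧ d (pt i) z + δ < rad r := by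
        clear h hP
        induction n with
        | zero => exact ⟨1, one_pos, by simp⟩
        | succ n ih =>
          obtain ⟨δ, hδ, h⟩ := ih fun j hj => hn j (by omega)
          obtain ⟨i, r, hi, hd⟩ := hn n (by omega)
          refine ⟨min δ ((rad r - d (pt i) z) / 2), by rw [lt_min_iff]; constructor <;> linarith, ?_⟩
          rw [Nat.forall_lt_succ_right]
          refine ⟨fun j hj => ?_, i, r, hi, ?_⟩
          · obtain ⟨i, r, hi, hd⟩ := h j hj
            exact ⟨i, r, hi, lt_of_le_of_lt (by gcongr; exact min_le_left _ _) hd⟩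
          · have := min_le_right δ ((rad r - d (pt i) z) / 2)
            linarith
      obtain ⟨δ, hδ, h⟩ := this
      obtain ⟨c, t, hc, ht⟩ := exists_ball z (half_pos hδ)
      refine ⟨c, t, fun j hj => ?_, hc⟩
      obtain ⟨i, r, hi, hd⟩ := h j hj
      exact ⟨i, r, hi, innerBall_of_lt hd hc ht⟩
    · rintro ⟨c, t, hj, hc⟩ j hjn
      obtain ⟨i, r, hi, hd⟩ := hj j hjn
      exact ⟨i, r, hi, hd.mem hc⟩

end SD

/-! ### Basic computable maps -/

namespace CMap

@[fun_prop] theorem comp {f : Y → X} {g : Z → Y} (hf : CMap f) (hg : CMap g) :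
    CMap fun z => f (g z) := by
  obtain ⟨W, hW, h⟩ := cmap_iff.1 hf
  obtain ⟨V, hV, hg⟩ := cmap_iff.1 hg
  refine cmap_iff.2 ⟨fun p => ∃ i r, W (p.1, p.2.1, i, r) ∧ V (i, r, p.2.2.1, p.2.2.2), ?_,
    fun n k z => ?_⟩
  · refine RE.exists_nat (p := fun q : (ℕ × ℕ × ℕ × ℕ) × ℕ =>
      ∃ r, W (q.1.1, q.1.2.1, q.2, r) ∧ V (q.2, r, q.1.2.2.1, q.1.2.2.2)) ?_
    refine RE.exists_nat (p := fun q : ((ℕ × ℕ × ℕ × ℕ) × ℕ) × ℕ =>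
      W (q.1.1.1, q.1.1.2.1, q.1.2, q.2) ∧ V (q.1.2, q.2, q.1.1.2.2.1, q.1.1.2.2.2)) ?_
    exact (hW.comp (g := fun q : ((ℕ × ℕ × ℕ × ℕ) × ℕ) × ℕ => (q.1.1.1, q.1.1.2.1, q.1.2, q.2))
      (by fun_prop)).and (hV.comp (g := fun q : ((ℕ × ℕ × ℕ × ℕ) × ℕ) × ℕ =>
      (q.1.2, q.2, q.1.1.2.2.1, q.1.1.2.2.2)) (by fun_prop))
  · simp only [h, hg]
    constructor
    · rintro ⟨i, r, hi, j, s, hj, hd⟩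
      exact ⟨j, s, ⟨i, r, hi, hj⟩, hd⟩
    · rintro ⟨j, s, ⟨i, r, hi, hj⟩, hd⟩
      exact ⟨i, r, hi, j, s, hj, hd⟩

variable [EffectiveMetric Z]

@[fun_prop] theorem const (c : Y) [hc : CPt c] : CMap fun _ : Z => c := by
  refine cmap_iff.2 ⟨fun p => d (pt p.1) c < rad p.2.1,
    hc.re.comp (g := fun p : ℕ × ℕ × ℕ × ℕ => (p.1, p.2.1)) (by fun_prop), fun n k z => ?_⟩
  constructor
  · intro h
    obtain ⟨i, r, hi, -⟩ := exists_ball z one_pos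
    exact ⟨i, r, h, hi⟩
  · rintro ⟨i, r, h, -⟩
    exact h

variable [EffectiveMetric Y]

theorem fst_aux : CMap (fun p : Z × Y => p.1) := by
  refine cmap_iff.2 ⟨fun p => InnerBall Z p.1 p.2.1 p.2.2.1.unpair.1 p.2.2.2,
    (re_innerBall Z).comp (g := fun p : ℕ × ℕ × ℕ × ℕ => (p.1, p.2.1, p.2.2.1.unpair.1, p.2.2.2))
      (by fun_prop), ?_⟩
  rintro n k ⟨z, y⟩
  constructor
  · intro h
    dsimp only at h
    obtain ⟨r, hr⟩ := exists_rad_lt (ε := (rad k - d (pt n) z) / 2) (by linarith)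
    obtain ⟨c, hc⟩ := dense z (rad r) (rad_pos r)
    obtain ⟨c', hc'⟩ := dense y (rad r) (rad_pos r)
    refine ⟨Nat.pair c c', r, ?_, ?_⟩
    · have := d_triangle (pt n) z (pt c)
      rw [d_comm z] at this
      simp only [Nat.unpair_pair, InnerBall]
      linarith
    · simp [d_prod, pt_prod, hc, hc']
  · rintro ⟨i, r, hi, hd⟩
    rw [d_prod, max_lt_iff] at hd
    exact hi.mem hd.1

theorem snd_aux : CMap (fun p : Z × Y => p.2) := by
  refine cmap_iff.2 ⟨fun p => InnerBall Y p.1 p.2.1 p.2.2.1.unpair.2 p.2.2.2,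
    (re_innerBall Y).comp (g := fun p : ℕ × ℕ × ℕ × ℕ => (p.1, p.2.1, p.2.2.1.unpair.2, p.2.2.2))
      (by fun_prop), ?_⟩
  rintro n k ⟨y, z⟩
  constructor
  · intro h
    dsimp only at h
    obtain ⟨r, hr⟩ := exists_rad_lt (ε := (rad k - d (pt n) z) / 2) (by linarith)
    obtain ⟨c, hc⟩ := dense z (rad r) (rad_pos r)
    obtain ⟨c', hc'⟩ := dense y (rad r) (rad_pos r)
    refine ⟨Nat.pair c' c, r, ?_, ?_⟩
    · have := d_triangle (pt n) z (pt c)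
      rw [d_comm z] at this
      simp only [Nat.unpair_pair, InnerBall]
      linarith
    · simp [d_prod, pt_prod, hc, hc']
  · rintro ⟨i, r, hi, hd⟩
    rw [d_prod, max_lt_iff] at hd
    exact hi.mem hd.2

@[fun_prop] theorem fst {A : Type*} [BasicMetric A] {f : A → Z × Y} (hf : CMap f) :
    CMap fun x => (f x).1 := fst_aux.comp hf

@[fun_prop] theorem snd {A : Type*} [BasicMetric A] {f : A → Z × Y} (hf : CMap f) :
    CMap fun x => (f x).2 := snd_aux.comp hf

@[fun_prop] theorem id : CMap (fun z : Z => z) := by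
  refine cmap_iff.2 ⟨fun p => InnerBall Z p.1 p.2.1 p.2.2.1 p.2.2.2, re_innerBall Z, fun n k z => ?_⟩
  constructor
  · intro h
    obtain ⟨c, t, hc, ht⟩ := exists_ball z (ε := (rad k - d (pt n) z) / 4) (by linarith)
    exact ⟨c, t, innerBall_of_lt (δ := (rad k - d (pt n) z) / 2) (by linarith) hc (by linarith), hc⟩
  · rintro ⟨i, r, hi, hd⟩
    exact hi.mem hd

end CMap

/-! ### Effective metrics on the natural numbers, the one-point space, products and computable
metric spaces. -/

instance : EffectiveMetric ℕ where
  d_self z := by simp [d_nat]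
  d_comm z w := by simp [d_nat, abs_sub_comm]
  d_triangle x y z := abs_sub_le _ _ _
  dense z ε hε := ⟨z, by simpa [d_nat, pt_nat] using hε⟩
  re_dist := by
    refine (RE.ratOf_lt (α := ℕ × ℕ × ℕ) (f := fun p => ratMk (p.1 - p.2.1 + (p.2.1 - p.1)) 0 0)
      (g := fun p => p.2.2) (by fun_prop) (by fun_prop)).congr fun p => ?_
    rw [← Rat.cast_lt (K := ℝ), ratOf_ratMk, d_nat, pt_nat, pt_nat]
    have : |(p.1 : ℝ) - p.2.1| = ((p.1 - p.2.1 + (p.2.1 - p.1) : ℕ) : ℝ) := by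
      rcases le_total p.1 p.2.1 with h | h
      · rw [abs_of_nonpos (by simpa using h), Nat.sub_eq_zero_of_le h]
        push_cast [h]
        ring
      · rw [abs_of_nonneg (by simpa using h), Nat.sub_eq_zero_of_le h]
        push_cast [h]
        ring
    rw [this]
    norm_num

instance : EffectiveMetric Unit where
  d_self z := rfl
  d_comm z w := rfl
  d_triangle x y z := by change (0 : ℝ) ≤ 0 + 0; simp
  dense z ε hε := ⟨0, hε⟩
  re_dist := by
    refine (RE.ratOf_lt (α := ℕ × ℕ × ℕ) (f := fun p => ratMk 0 0 0)
      (g := fun p => p.2.2) (by fun_prop) (by fun_prop)).congr fun p => ?_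
    change (0 : ℝ) < _ ↔ _
    rw [ratOf_ratMk]
    norm_num

instance [EffectiveMetric Z] [EffectiveMetric Y] : EffectiveMetric (Z × Y) where
  d_self z := by simp [d_prod, d_self]
  d_comm z w := by rw [d_prod, d_prod, d_comm z.1, d_comm z.2]
  d_triangle x y z := by
    rw [d_prod, d_prod, d_prod]
    refine max_le ((d_triangle _ y.1 _).trans ?_) ((d_triangle _ y.2 _).trans ?_) <;>
    gcongr <;> simp
  dense z ε hε := by
    obtain ⟨c, hc⟩ := dense z.1 ε hε
    obtain ⟨c', hc'⟩ := dense z.2 ε hε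
    exact ⟨Nat.pair c c', by simp [d_prod, pt_prod, hc, hc']⟩
  re_dist := by
    simp only [d_prod, pt_prod, max_lt_iff]
    exact ((re_dist (Z := Z)).comp (g := fun p : ℕ × ℕ × ℕ => (p.1.unpair.1, p.2.1.unpair.1, p.2.2))
      (by fun_prop)).and ((re_dist (Z := Y)).comp (g := fun p : ℕ × ℕ × ℕ =>
      (p.1.unpair.2, p.2.1.unpair.2, p.2.2)) (by fun_prop))

instance {X : Type*} [ComputableMetricSpace X] : EffectiveMetric X where
  d_self z := dist_self z
  d_comm z w := dist_comm z w
  d_triangle x y z := dist_triangle x y z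
  dense z ε hε := by
    obtain ⟨i, hi⟩ := ComputableMetricSpace.dense_basicPoint.exists_dist_lt z hε
    exact ⟨i, by rwa [dist_comm] at hi⟩
  re_dist := by
    obtain ⟨g, hg, hc, hl⟩ := ComputableMetricSpace.computable_dist (X := X)
    -- Adding the error bound `2⁻ⁱ` turns the approximation number `i` into an upper bound of the
    -- distance; `ratMk 1 0 (2 ^ i - 1)` is the index of `2⁻ⁱ`.
    have : RE fun p : ℕ × ℕ × ℕ => ∃ i, ratOf (ratAdd (g ((p.1, p.2.1), i)) (ratMk 1 0 (2 ^ i - 1)))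
        < ratOf p.2.2 :=
      RE.exists_nat (p := fun q : (ℕ × ℕ × ℕ) × ℕ =>
        ratOf (ratAdd (g ((q.1.1, q.1.2.1), q.2)) (ratMk 1 0 (2 ^ q.2 - 1))) < ratOf q.1.2.2)
        (RE.ratOf_lt (by fun_prop) (by fun_prop))
    refine this.congr fun p => ?_
    have e : ∀ i, (ratOf (ratAdd (g ((p.1, p.2.1), i)) (ratMk 1 0 (2 ^ i - 1))) : ℝ) =
        ratOf (g ((p.1, p.2.1), i)) + (2 : ℝ)⁻¹ ^ i := by
      intro i
      rw [ratOf_ratAdd, ratOf_ratMk]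
      push_cast [Nat.one_le_two_pow]
      simp
    simp only [← Rat.cast_lt (K := ℝ), e]
    have hl' := hl (p.1, p.2.1)
    change dist _ _ < _ ↔ _
    constructor
    · intro h
      have h1 : Tendsto (fun i => (ratOf (g ((p.1, p.2.1), i)) : ℝ) + (2 : ℝ)⁻¹ ^ i) atTop
          (𝓝 (dist (ComputableMetricSpace.basicPoint p.1 : X) (ComputableMetricSpace.basicPoint p.2.1)
            + 0)) :=
        hl'.add (tendsto_pow_atTop_nhds_zero_of_lt_one (by norm_num) (by norm_num))
      rw [add_zero] at h1
      exact (h1.eventually_lt_const h).exists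
    · rintro ⟨i, hi⟩
      refine lt_of_le_of_lt ?_ hi
      refine le_of_tendsto hl' (eventually_atTop.2 ⟨i, fun j hj => ?_⟩)
      have := (abs_le.1 (hc (p.1, p.2.1) i j hj)).2
      linarith
end

theorem cmap_iff_sd {Z Y : Type*} [BasicMetric Z] [BasicMetric Y] {f : Z → Y} :
    CMap f ↔ SD fun p : ℕ × ℕ × Z => d (pt p.1) (f p.2.2) < rad p.2.1 := Iff.rfl

theorem sd_iff {Z : Type*} [BasicMetric Z] {P : Z → Prop} :
    SD P ↔ ∃ W : ℕ × ℕ → Prop, RE W ∧ ∀ z, P z ↔ ∃ i r, W (i, r) ∧ d (pt i) z < rad r := Iff.rfl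

attribute [irreducible] SD CMap

/-! ### Computable maps in the sense of names -/

section
variable {Z Y X : Type*} [BasicMetric Z] [BasicMetric Y] [BasicMetric X]
  [EffectiveMetric Z] [EffectiveMetric Y]

theorem IsCauchyName.d_le {h : ℕ → ℕ} {z : Z} (hz : IsCauchyName h z) (i : ℕ) :
    d (pt (h i)) z ≤ (2 : ℝ)⁻¹ ^ i := by
  have h1 : Tendsto (fun j => (2 : ℝ)⁻¹ ^ i + d (pt (h j)) z) atTop (𝓝 ((2 : ℝ)⁻¹ ^ i + 0)) :=
    hz.2.const_add _
  rw [add_zero] at h1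
  refine ge_of_tendsto h1 (eventually_atTop.2 ⟨i, fun j hj => ?_⟩)
  have := d_triangle (pt (h i)) (pt (h j)) z
  have h2 := hz.1 i j hj
  rw [d_comm] at h2
  linarith

/-- Half of the permitted error towards the limit leaves the other half for the triangle inequality
between two entries. -/
theorem isCauchyName_of_d_le {h : ℕ → ℕ} {z : Z} (hz : ∀ i, d (pt (h i)) z ≤ (2 : ℝ)⁻¹ ^ i / 2) :
    IsCauchyName h z := by
  refine ⟨fun i j hij => ?_, ?_⟩
  · have h1 := d_triangle (pt (h j)) z (pt (h i))
    rw [d_comm z] at h1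
    have h2 : (2 : ℝ)⁻¹ ^ j ≤ (2 : ℝ)⁻¹ ^ i :=
      pow_le_pow_of_le_one (by norm_num) (by norm_num) hij
    linarith [hz i, hz j]
  · refine squeeze_zero (fun i => d_nonneg _ _) hz ?_
    rw [show (0 : ℝ) = 0 / 2 by simp]
    exact (tendsto_pow_atTop_nhds_zero_of_lt_one (by norm_num) (by norm_num)).div_const 2

theorem rad_two_pow (k : ℕ) : rad (2 ^ k - 1) = (2 : ℝ)⁻¹ ^ k := by
  rw [rad]
  push_cast [Nat.one_le_two_pow]
  simp

theorem lt_rad_sub_rad {a : ℝ} {r t : ℕ} :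
    a < (ratOf (ratAdd (radIndex r) (ratNeg (radIndex t))) : ℝ) ↔ a + rad t < rad r := by
  rw [ratOf_ratAdd, ratOf_ratNeg, Rat.cast_add, Rat.cast_neg, ratOf_radIndex, ratOf_radIndex,
    ← sub_eq_add_neg, lt_sub_iff_add_lt]

/-- Because the inequalities are strict, there is a room `δ` such that basic points within `δ` of
`z` may follow `l`. This transfers an answer computed from `l` alone to every point for which `l` is
admissible. -/
theorem exists_isCauchyName_extending {z : Z} {l : List ℕ}
    (h1 : ∀ i j, i ≤ j → j < l.length →
      d (pt (l.getD j 0) : Z) (pt (l.getD i 0)) < (2 : ℝ)⁻¹ ^ i)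
    (h2 : ∀ i < l.length, d (pt (l.getD i 0)) z < (2 : ℝ)⁻¹ ^ i) :
    ∃ h : ℕ → ℕ, IsCauchyName h z ∧ (List.range l.length).map h = l := by
  obtain ⟨δ, hδ, hl⟩ : ∃ δ : ℝ, 0 < δ ∧
      ∀ i < l.length, d (pt (l.getD i 0)) z + δ ≤ (2 : ℝ)⁻¹ ^ i := by
    have : ∀ n ≤ l.length, ∃ δ : ℝ, 0 < δ ∧
        ∀ i < n, d (pt (l.getD i 0)) z + δ ≤ (2 : ℝ)⁻¹ ^ i := by
      intro n
      induction n with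
      | zero => exact fun _ => ⟨1, one_pos, by simp⟩
      | succ n ih =>
        intro hn
        obtain ⟨δ, hδ, h⟩ := ih (by omega)
        have h3 := h2 n (by omega)
        refine ⟨min δ ((2 : ℝ)⁻¹ ^ n - d (pt (l.getD n 0)) z),
          by rw [lt_min_iff]; constructor <;> linarith, ?_⟩
        rw [Nat.forall_lt_succ_right]
        refine ⟨fun i hi => le_trans (by gcongr; exact min_le_left _ _) (h i hi), ?_⟩
        have := min_le_right δ ((2 : ℝ)⁻¹ ^ n - d (pt (l.getD n 0)) z)
        linarith
    exact this _ le_rfl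
  -- The bound `δ` makes the new entries compatible with `l`, the bound `2⁻ⁱ / 2` makes them
  -- compatible with each other.
  choose c hc using fun i : ℕ => dense z (min δ ((2 : ℝ)⁻¹ ^ i / 2)) (by positivity)
  have hc1 : ∀ i, d (pt (c i)) z < δ := fun i => (hc i).trans_le (min_le_left _ _)
  have hc2 : ∀ i, d (pt (c i)) z < (2 : ℝ)⁻¹ ^ i / 2 := fun i => (hc i).trans_le (min_le_right _ _)
  refine ⟨fun i => if i < l.length then l.getD i 0 else c i, ⟨fun i j hij => ?_, ?_⟩, ?_⟩
  · dsimp only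
    by_cases hj : j < l.length
    · rw [if_pos hj, if_pos (hij.trans_lt hj)]
      exact (h1 i j hij hj).le
    · rw [if_neg hj]
      by_cases hi : i < l.length
      · rw [if_pos hi]
        have := d_triangle (pt (c j)) z (pt (l.getD i 0))
        rw [d_comm z] at this
        linarith [hl i hi, hc1 j]
      · rw [if_neg hi]
        have := d_triangle (pt (c j)) z (pt (c i))
        rw [d_comm z] at this
        have h2 : (2 : ℝ)⁻¹ ^ j ≤ (2 : ℝ)⁻¹ ^ i :=
          pow_le_pow_of_le_one (by norm_num) (by norm_num) hij
        linarith [hc2 i, hc2 j]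
  · have : Tendsto (fun i => d (pt (c i)) z) atTop (𝓝 0) :=
      (isCauchyName_of_d_le fun i => (hc2 i).le).2
    refine this.congr' (eventually_atTop.2 ⟨l.length, fun i hi => ?_⟩)
    dsimp only
    rw [if_neg (by omega)]
  · refine List.ext_getElem (by simp) fun i hi hi' => ?_
    simp only [List.length_map, List.length_range] at hi
    simp [hi]

theorem oracleOutputs_unique {ψ : List ℕ × ℕ → Option ℕ} {h : ℕ → ℕ} {n a b : ℕ}
    (ha : OracleOutputs ψ h n a) (hb : OracleOutputs ψ h n b) : a = b := by
  obtain ⟨k, hk, hk'⟩ := ha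
  obtain ⟨l, hl, hl'⟩ := hb
  rcases lt_trichotomy k l with h | rfl | h
  · rw [hl' k h] at hk; cases hk
  · rw [hk] at hl; exact Option.some.inj hl
  · rw [hk' l h] at hl; cases hl

/-- The partial map computed by a machine. -/
def machineMap (ψ : List ℕ × ℕ → Option ℕ) : (ℕ → ℕ) →. (ℕ → ℕ) := fun h =>
  ⟨∃ g : ℕ → ℕ, ∀ n, OracleOutputs ψ h n (g n), fun hg => hg.choose⟩

theorem mem_machineMap {ψ : List ℕ × ℕ → Option ℕ} {h g : ℕ → ℕ} :
    g ∈ machineMap ψ h ↔ ∀ n, OracleOutputs ψ h n (g n) := by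
  constructor
  · rintro ⟨hd, rfl⟩
    exact hd.choose_spec
  · intro hg
    exact ⟨⟨g, hg⟩, funext fun n =>
      oracleOutputs_unique ((⟨g, hg⟩ : ∃ g : ℕ → ℕ, ∀ n, OracleOutputs ψ h n (g n)).choose_spec n)
        (hg n)⟩

/-- For digit `n` the machine searches for a basic point whose ball of radius `2⁻¹ ^ (n + 1)` is
shown to contain the value: some ball enumerated for it in `W` must contain, by an entry of the name
and its error bound, the named point. That radius is the half error of `isCauchyName_of_d_le`. -/
theorem CMap.isComputableMap {f : Z → Y} (hf : CMap f) : IsComputableMap f := by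
  obtain ⟨W, hW, hf⟩ := cmap_iff.1 hf
  -- `U (σ, n, m)`: the initial segment `σ` of a name shows that `m` may be digit `n` of the value
  let U : List ℕ × ℕ × ℕ → Prop := fun p => ∃ i r, W (p.2.2, 2 ^ (p.2.1 + 1) - 1, i, r) ∧
    ∃ j, j < p.1.length ∧ d (pt i : Z) (pt (p.1.getD j 0)) <
      (ratOf (ratAdd (radIndex r) (ratNeg (radIndex (2 ^ j - 1)))) : ℝ)
  have hU : RE U := by
    refine RE.exists_nat (p := fun q : (List ℕ × ℕ × ℕ) × ℕ =>
      ∃ r, W (q.1.2.2, 2 ^ (q.1.2.1 + 1) - 1, q.2, r) ∧ ∃ j, j < q.1.1.length ∧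
      d (pt q.2 : Z) (pt (q.1.1.getD j 0)) <
      (ratOf (ratAdd (radIndex r) (ratNeg (radIndex (2 ^ j - 1)))) : ℝ)) ?_
    refine RE.exists_nat (p := fun q : ((List ℕ × ℕ × ℕ) × ℕ) × ℕ =>
      W (q.1.1.2.2, 2 ^ (q.1.1.2.1 + 1) - 1, q.1.2, q.2) ∧ ∃ j, j < q.1.1.1.length ∧
      d (pt q.1.2 : Z) (pt (q.1.1.1.getD j 0)) <
      (ratOf (ratAdd (radIndex q.2) (ratNeg (radIndex (2 ^ j - 1)))) : ℝ)) ?_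
    refine (hW.comp (by fun_prop)).and ?_
    refine RE.exists_nat (p := fun q : (((List ℕ × ℕ × ℕ) × ℕ) × ℕ) × ℕ =>
      q.2 < q.1.1.1.1.length ∧ d (pt q.1.1.2 : Z) (pt (q.1.1.1.1.getD q.2 0)) <
      (ratOf (ratAdd (radIndex q.1.2) (ratNeg (radIndex (2 ^ q.2 - 1)))) : ℝ)) ?_
    exact (RE.of_decide (Computable.fun_lt (by fun_prop) (by fun_prop))).and
      ((re_dist (Z := Z)).comp (g := fun q : (((List ℕ × ℕ × ℕ) × ℕ) × ℕ) × ℕ =>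
        (q.1.1.2, q.1.1.1.1.getD q.2 0,
          ratAdd (radIndex q.1.2) (ratNeg (radIndex (2 ^ q.2 - 1))))) (by fun_prop))
  have hUiff : ∀ σ n m, U (σ, n, m) ↔ ∃ i r, W (m, 2 ^ (n + 1) - 1, i, r) ∧ ∃ j < σ.length,
      d (pt i : Z) (pt (σ.getD j 0)) + (2 : ℝ)⁻¹ ^ j < rad r := by
    intro σ n m
    simp only [U, lt_rad_sub_rad, rad_two_pow]
  have getD_range : ∀ (h : ℕ → ℕ) (k j : ℕ), j < k → ((List.range k).map h).getD j 0 = h j := by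
    intro h k j hj
    simp [hj]
  have sound : ∀ (z : Z) (h : ℕ → ℕ), IsCauchyName h z → ∀ k n m,
      U ((List.range k).map h, n, m) → d (pt m) (f z) < (2 : ℝ)⁻¹ ^ n / 2 := by
    intro z h hz k n m hm
    obtain ⟨i, r, hi, j, hj, hd⟩ := (hUiff _ _ _).1 hm
    rw [getD_range h k j (by simpa using hj)] at hd
    have := (hf m (2 ^ (n + 1) - 1) z).2 ⟨i, r, hi, ?_⟩
    · rw [rad_two_pow, pow_succ] at this
      linarith
    · linarith [d_triangle (pt i) (pt (h j)) z, hz.d_le j]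
  have complete : ∀ (z : Z) (h : ℕ → ℕ), IsCauchyName h z → ∀ n,
      ∃ k m, U ((List.range k).map h, n, m) := by
    intro z h hz n
    obtain ⟨m, hm⟩ := dense (f z) (rad (2 ^ (n + 1) - 1)) (rad_pos _)
    obtain ⟨i, r, hi, hd⟩ := (hf _ _ _).1 hm
    obtain ⟨j, hj⟩ := exists_pow_lt_of_lt_one (half_pos (sub_pos.2 hd)) (y := (2 : ℝ)⁻¹)
      (by norm_num)
    refine ⟨j + 1, m, (hUiff _ _ _).2 ⟨i, r, hi, j, by simp, ?_⟩⟩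
    rw [getD_range h (j + 1) j (by simp)]
    have h1 := d_triangle (pt i) z (pt (h j))
    rw [d_comm z] at h1
    linarith [hz.d_le j]
  obtain ⟨u, hu, hUu⟩ := re_iff.1 hU
  -- The length of the oracle segment doubles as the search counter: it codes how much of the
  -- segment to use, the candidate digit and the witness for `u`. The first component of a pair is
  -- at most its code, so the requested part is always available.
  let ψ : List ℕ × ℕ → Option ℕ := fun p =>
    bif u ((p.1.take p.1.length.unpair.1, p.2, p.1.length.unpair.2.unpair.1),
      p.1.length.unpair.2.unpair.2) then some p.1.length.unpair.2.unpair.1 else none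
  have hψ : Computable ψ := by
    have h1 : Computable fun p : List ℕ × ℕ =>
        u ((p.1.take p.1.length.unpair.1, p.2, p.1.length.unpair.2.unpair.1),
          p.1.length.unpair.2.unpair.2) := by fun_prop
    exact Computable.cond h1 (by fun_prop) (by fun_prop)
  have take_range : ∀ (h : ℕ → ℕ) (K l : ℕ), l ≤ K →
      ((List.range K).map h).take l = (List.range l).map h := by
    intro h K l hl
    rw [← List.map_take, List.take_range, min_eq_left hl]
  have hψ1 : ∀ (h : ℕ → ℕ) K n m, ψ ((List.range K).map h, n) = some m →
      ∃ k, U ((List.range k).map h, n, m) := by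
    intro h K n m hm
    simp only [ψ, List.length_map, List.length_range,
      take_range h K _ (Nat.unpair_left_le _), cond_eq_ite] at hm
    split_ifs at hm with h1
    cases hm
    exact ⟨_, (hUu _).2 ⟨_, h1⟩⟩
  have hψ2 : ∀ (h : ℕ → ℕ) k n m, U ((List.range k).map h, n, m) →
      ∃ K m', ψ ((List.range K).map h, n) = some m' := by
    intro h k n m hm
    obtain ⟨w, hw⟩ := (hUu _).1 hm
    refine ⟨Nat.pair k (Nat.pair m w), m, ?_⟩
    simp only [ψ, List.length_map, List.length_range,
      take_range h _ _ (Nat.unpair_left_le _)]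
    simp [hw]
  refine ⟨machineMap ψ, ⟨ψ, hψ, fun h g => mem_machineMap⟩, fun z h hz => ?_⟩
  have out : ∀ n, ∃ m, OracleOutputs ψ h n m := by
    intro n
    obtain ⟨k, m, hm⟩ := complete z h hz n
    have hK := hψ2 h k n m hm
    classical
    obtain ⟨m', hm'⟩ := Nat.find_spec hK
    refine ⟨m', Nat.find hK, hm', fun j hj => ?_⟩
    have := Nat.find_min hK hj
    push Not at this
    exact Option.eq_none_iff_forall_ne_some.2 this
  choose g hg using out
  refine ⟨g, mem_machineMap.2 hg, isCauchyName_of_d_le fun n => ?_⟩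
  obtain ⟨K, hK, -⟩ := hg n
  obtain ⟨k, hk⟩ := hψ1 h K n _ hK
  exact (sound z h hz k n _ hk).le

/-- A machine answers after reading a finite segment `l` of a name, and the answer is valid for
every point with a name extending `l`. Enumerating the balls of points for which `l` is admissible,
over all `l` whose answer lands in the target ball, exhausts the preimage. -/
theorem IsComputableMap.cmap {f : Z → Y} (hf : IsComputableMap f) : CMap f := by
  obtain ⟨F, ⟨ψ, hψ, hF⟩, hf⟩ := hf
  -- `G l c t` ensures that `l` extends to a name of each point of the ball around `pt c` of radius
  -- `rad t`.
  let G : List ℕ → ℕ → ℕ → Prop := fun l c t => ∀ i < l.length,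
    d (pt (l.getD i 0) : Z) (pt c) < (ratOf (ratAdd (radIndex (2 ^ i - 1)) (ratNeg (radIndex t))) : ℝ) ∧
    ∀ j < i + 1, d (pt (l.getD i 0) : Z) (pt (l.getD j 0)) < (ratOf (radIndex (2 ^ j - 1)) : ℝ)
  have hG : RE fun p : List ℕ × ℕ × ℕ => G p.1 p.2.1 p.2.2 := by
    refine RE.forall_lt (p := fun q : (List ℕ × ℕ × ℕ) × ℕ =>
      d (pt (q.1.1.getD q.2 0) : Z) (pt q.1.2.1) <
        (ratOf (ratAdd (radIndex (2 ^ q.2 - 1)) (ratNeg (radIndex q.1.2.2))) : ℝ) ∧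
      ∀ j < q.2 + 1, d (pt (q.1.1.getD q.2 0) : Z) (pt (q.1.1.getD j 0)) <
        (ratOf (radIndex (2 ^ j - 1)) : ℝ)) ?_ (by fun_prop)
    refine ((re_dist (Z := Z)).comp (g := fun q : (List ℕ × ℕ × ℕ) × ℕ =>
      (q.1.1.getD q.2 0, q.1.2.1, ratAdd (radIndex (2 ^ q.2 - 1)) (ratNeg (radIndex q.1.2.2))))
      (by fun_prop)).and ?_
    refine RE.forall_lt (p := fun q : ((List ℕ × ℕ × ℕ) × ℕ) × ℕ =>
      d (pt (q.1.1.1.getD q.1.2 0) : Z) (pt (q.1.1.1.getD q.2 0)) <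
        (ratOf (radIndex (2 ^ q.2 - 1)) : ℝ)) ?_ (by fun_prop)
    exact (re_dist (Z := Z)).comp (g := fun q : ((List ℕ × ℕ × ℕ) × ℕ) × ℕ =>
      (q.1.1.1.getD q.1.2 0, q.1.1.1.getD q.2 0, radIndex (2 ^ q.2 - 1))) (by fun_prop)
  have hGiff : ∀ l c t, G l c t ↔ ∀ i < l.length,
      d (pt (l.getD i 0) : Z) (pt c) + rad t < (2 : ℝ)⁻¹ ^ i ∧
      ∀ j < i + 1, d (pt (l.getD i 0) : Z) (pt (l.getD j 0)) < (2 : ℝ)⁻¹ ^ j := by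
    intro l c t
    simp only [G, lt_rad_sub_rad, ratOf_radIndex, rad_two_pow]
  -- `A l n k m`: the machine answers on input `m` at `l` and at no proper initial segment, as
  -- `OracleOutputs` demands, and the answer with its error `2⁻ᵐ` lies in the ball around `pt n` of
  -- radius `rad k`.
  let A : List ℕ → ℕ → ℕ → ℕ → Prop := fun l n k m => ∃ o, ψ (l, m) = some o ∧
    (∀ j < l.length, ψ (l.take j, m) = none) ∧
    d (pt n : Y) (pt o) < (ratOf (ratAdd (radIndex k) (ratNeg (radIndex (2 ^ m - 1)))) : ℝ)
  have hA : RE fun p : List ℕ × ℕ × ℕ × ℕ => A p.1 p.2.1 p.2.2.1 p.2.2.2 := by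
    refine RE.exists_nat (p := fun q : (List ℕ × ℕ × ℕ × ℕ) × ℕ =>
      ψ (q.1.1, q.1.2.2.2) = some q.2 ∧ (∀ j < q.1.1.length, ψ (q.1.1.take j, q.1.2.2.2) = none) ∧
      d (pt q.1.2.1 : Y) (pt q.2) <
        (ratOf (ratAdd (radIndex q.1.2.2.1) (ratNeg (radIndex (2 ^ q.1.2.2.2 - 1)))) : ℝ)) ?_
    refine (RE.of_decide (Computable.fun_decide_eq (by fun_prop) (by fun_prop))).and
      (RE.and ?_ ?_)
    · refine RE.forall_lt (p := fun q : ((List ℕ × ℕ × ℕ × ℕ) × ℕ) × ℕ =>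
        ψ (q.1.1.1.take q.2, q.1.1.2.2.2) = none) ?_ (by fun_prop)
      exact RE.of_decide (Computable.fun_decide_eq (by fun_prop) (by fun_prop))
    · exact (re_dist (Z := Y)).comp (g := fun q : (List ℕ × ℕ × ℕ × ℕ) × ℕ =>
        (q.1.2.1, q.2, ratAdd (radIndex q.1.2.2.1) (ratNeg (radIndex (2 ^ q.1.2.2.2 - 1)))))
        (by fun_prop)
  have hAiff : ∀ l n k m, A l n k m ↔ ∃ o, ψ (l, m) = some o ∧
      (∀ j < l.length, ψ (l.take j, m) = none) ∧ d (pt n : Y) (pt o) + (2 : ℝ)⁻¹ ^ m < rad k := by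
    intro l n k m
    simp only [A, lt_rad_sub_rad, rad_two_pow]
  have take_range : ∀ (h : ℕ → ℕ) (K l : ℕ), l ≤ K →
      ((List.range K).map h).take l = (List.range l).map h := by
    intro h K l hl
    rw [← List.map_take, List.take_range, min_eq_left hl]
  refine cmap_iff.2 ⟨fun p => ∃ e m, G (Denumerable.ofNat (List ℕ) e) p.2.2.1 p.2.2.2 ∧
    A (Denumerable.ofNat (List ℕ) e) p.1 p.2.1 m, ?_, fun n k z => ?_⟩
  · refine RE.exists_nat (p := fun q : (ℕ × ℕ × ℕ × ℕ) × ℕ => ∃ m,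
      G (Denumerable.ofNat (List ℕ) q.2) q.1.2.2.1 q.1.2.2.2 ∧
      A (Denumerable.ofNat (List ℕ) q.2) q.1.1 q.1.2.1 m) ?_
    refine RE.exists_nat (p := fun q : ((ℕ × ℕ × ℕ × ℕ) × ℕ) × ℕ =>
      G (Denumerable.ofNat (List ℕ) q.1.2) q.1.1.2.2.1 q.1.1.2.2.2 ∧
      A (Denumerable.ofNat (List ℕ) q.1.2) q.1.1.1 q.1.1.2.1 q.2) ?_
    exact (hG.comp (g := fun q : ((ℕ × ℕ × ℕ × ℕ) × ℕ) × ℕ =>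
      (Denumerable.ofNat (List ℕ) q.1.2, q.1.1.2.2.1, q.1.1.2.2.2)) (by fun_prop)).and
      (hA.comp (g := fun q : ((ℕ × ℕ × ℕ × ℕ) × ℕ) × ℕ =>
      (Denumerable.ofNat (List ℕ) q.1.2, q.1.1.1, q.1.1.2.1, q.2)) (by fun_prop))
  · constructor
    · intro hnk
      -- a name of `z` with some room
      choose h hh using fun i : ℕ => dense z ((2 : ℝ)⁻¹ ^ i / 4) (by positivity)
      have hz : IsCauchyName h z := isCauchyName_of_d_le fun i => by
        have : (0 : ℝ) < 2⁻¹ ^ i := by positivity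
        linarith [hh i]
      obtain ⟨g, hg, hgz⟩ := hf z h hz
      obtain ⟨m, hm⟩ := exists_pow_lt_of_lt_one (half_pos (sub_pos.2 hnk)) (y := (2 : ℝ)⁻¹)
        (by norm_num)
      obtain ⟨K, hK, hK'⟩ := (hF h g).1 hg m
      -- `K` is the number of entries used; entries `i < K` are within `2⁻ⁱ / 4` of `z`, so a ball
      -- of radius below `2⁻¹ ^ K / 4` meets all requirements of `G`.
      obtain ⟨c, t, hc, ht⟩ := exists_ball z (ε := (2 : ℝ)⁻¹ ^ K / 4) (by positivity)
      refine ⟨c, t, ⟨Encodable.encode ((List.range K).map h), m, ?_, ?_⟩, hc⟩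
      · rw [Denumerable.ofNat_encode, hGiff]
        simp only [List.length_map, List.length_range]
        intro i hi
        have hp : ∀ j ≤ i, (2 : ℝ)⁻¹ ^ i ≤ (2 : ℝ)⁻¹ ^ j := fun j hj =>
          pow_le_pow_of_le_one (by norm_num) (by norm_num) hj
        have hpK : (2 : ℝ)⁻¹ ^ K ≤ (2 : ℝ)⁻¹ ^ i :=
          pow_le_pow_of_le_one (by norm_num) (by norm_num) hi.le
        have hpos : (0 : ℝ) < (2 : ℝ)⁻¹ ^ i := by positivity
        have e : ∀ j ≤ i, ((List.range K).map h).getD j 0 = h j := by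
          intro j hj
          simp [hj.trans_lt hi]
        refine ⟨?_, fun j hj => ?_⟩
        · rw [e i le_rfl]
          have h1 := d_triangle (pt (h i)) z (pt c)
          rw [d_comm z] at h1
          linarith [hh i]
        · rw [e i le_rfl, e j (by omega)]
          have h1 := d_triangle (pt (h i)) z (pt (h j))
          rw [d_comm z] at h1
          linarith [hh i, hh j, hp j (by omega)]
      · rw [Denumerable.ofNat_encode, hAiff]
        refine ⟨g m, hK, fun j hj => ?_, ?_⟩
        · simp only [List.length_map, List.length_range] at hj
          rw [take_range h K j hj.le]
          exact hK' j hj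
        · have h1 := d_triangle (pt n) (f z) (pt (g m))
          rw [d_comm (f z)] at h1
          linarith [hgz.d_le m]
    · rintro ⟨c, t, ⟨e, m, hG1, hA1⟩, hc⟩
      obtain ⟨o, ho, ho', hd⟩ := (hAiff _ _ _ _).1 hA1
      have hG2 := (hGiff _ _ _).1 hG1
      generalize Denumerable.ofNat (List ℕ) e = l at *
      obtain ⟨h, hz, hl⟩ := exists_isCauchyName_extending (z := z) (l := l)
        (fun i j hij hj => (hG2 j hj).2 i (by omega)) (fun i hi => by
          linarith [(hG2 i hi).1, d_triangle (pt (l.getD i 0)) (pt c) z])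
      obtain ⟨g, hg, hgz⟩ := hf z h hz
      have : OracleOutputs ψ h m o := by
        refine ⟨l.length, by rw [hl, ho], fun j hj => ?_⟩
        rw [← ho' j hj]
        conv_rhs => rw [← hl, take_range h _ j hj.le]
      have h1 := hgz.d_le m
      rw [← oracleOutputs_unique this ((hF h g).1 hg m)] at h1
      linarith [d_triangle (pt n) (pt o) (f z)]

theorem isComputableMap_iff {f : Z → Y} : IsComputableMap f ↔ CMap f :=
  ⟨IsComputableMap.cmap, CMap.isComputableMap⟩
end

/-! ### Computable functions of natural numbers -/

theorem RE.sd {p : ℕ → Prop} (hp : RE p) : SD p := by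
  refine sd_iff.2 ⟨fun q => p q.1, hp.comp (by fun_prop), fun n => ?_⟩
  simp only [pt_nat, d_nat_lt_rad]
  constructor
  · intro h
    exact ⟨n, 0, h, rfl⟩
  · rintro ⟨i, r, h, rfl⟩
    exact h

namespace CMap

theorem of_computable {f : ℕ → ℕ} (hf : Computable f) : CMap f := by
  refine cmap_iff.2 ⟨fun p => p.1 = f p.2.2.1,
    RE.of_decide (Computable.fun_decide_eq (by fun_prop) (by fun_prop)), fun n k z => ?_⟩
  simp only [pt_nat, d_nat_lt_rad]
  constructor
  · intro h
    exact ⟨z, 0, h, rfl⟩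
  · rintro ⟨i, r, h, rfl⟩
    exact h

theorem natPair_aux : CMap fun p : ℕ × ℕ => Nat.pair p.1 p.2 := by
  refine cmap_iff.2 ⟨fun p => p.1 = p.2.2.1,
    RE.of_decide (Computable.fun_decide_eq (by fun_prop) (by fun_prop)), fun n k z => ?_⟩
  simp only [pt_nat, d_nat_lt_rad]
  simp only [d_prod, max_lt_iff, pt_prod, pt_nat, d_nat_lt_rad]
  constructor
  · intro h
    exact ⟨n, 0, rfl, by simp [h]⟩
  · rintro ⟨i, r, rfl, h1, h2⟩
    rw [← h1, ← h2, Nat.pair_unpair]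

section
variable {Z Y X : Type*} [BasicMetric Z] [BasicMetric Y] [BasicMetric X] [EffectiveMetric Z]

@[fun_prop] theorem pair {f : Z → X} {g : Z → Y} (hf : CMap f) (hg : CMap g) :
    CMap fun z => (f z, g z) := by
  obtain ⟨V, hV, hf⟩ := cmap_iff.1 hf
  obtain ⟨W, hW, hg⟩ := cmap_iff.1 hg
  have h1 : SD fun p : ℕ × ℕ × Z => d (pt p.1.unpair.1) (f p.2.2) < rad p.2.1 :=
    sd_nat_nat_prod.2 ⟨fun p => V (p.1.unpair.1, p.2), hV.comp (by fun_prop), fun n k z => hf _ _ _⟩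
  have h2 : SD fun p : ℕ × ℕ × Z => d (pt p.1.unpair.2) (g p.2.2) < rad p.2.1 :=
    sd_nat_nat_prod.2 ⟨fun p => W (p.1.unpair.2, p.2), hW.comp (by fun_prop), fun n k z => hg _ _ _⟩
  refine cmap_iff_sd.2 ((h1.and h2).congr fun p => ?_)
  rw [d_prod, max_lt_iff, pt_prod]

@[fun_prop] theorem natPair {f g : Z → ℕ} (hf : CMap f) (hg : CMap g) :
    CMap fun z => Nat.pair (f z) (g z) :=
  natPair_aux.comp (g := fun z => (f z, g z)) (hf.pair hg)

theorem of_computable₂ {φ : ℕ → ℕ → ℕ} (hφ : Computable fun p : ℕ × ℕ => φ p.1 p.2)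
    {f g : Z → ℕ} (hf : CMap f) (hg : CMap g) : CMap fun z => φ (f z) (g z) := by
  have h : CMap fun n : ℕ => φ n.unpair.1 n.unpair.2 :=
    of_computable (hφ.comp Computable.unpair)
  simpa using h.comp (hf.natPair hg)

@[fun_prop] theorem natAdd {f g : Z → ℕ} (hf : CMap f) (hg : CMap g) :
    CMap fun z => f z + g z := of_computable₂ (φ := fun m n => m + n) (by fun_prop) hf hg

@[fun_prop] theorem natSub {f g : Z → ℕ} (hf : CMap f) (hg : CMap g) :
    CMap fun z => f z - g z := of_computable₂ (φ := fun m n => m - n) (by fun_prop) hf hg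

@[fun_prop] theorem natMul {f g : Z → ℕ} (hf : CMap f) (hg : CMap g) :
    CMap fun z => f z * g z := of_computable₂ (φ := fun m n => m * n) (by fun_prop) hf hg

@[fun_prop] theorem natDiv {f g : Z → ℕ} (hf : CMap f) (hg : CMap g) :
    CMap fun z => f z / g z := of_computable₂ (φ := fun m n => m / n) (by fun_prop) hf hg

@[fun_prop] theorem natMod {f g : Z → ℕ} (hf : CMap f) (hg : CMap g) :
    CMap fun z => f z % g z := of_computable₂ (φ := fun m n => m % n) (by fun_prop) hf hg

@[fun_prop] theorem fun_seqEntry {f g : Z → ℕ} (hf : CMap f) (hg : CMap g) :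
    CMap fun z => seqEntry (f z) (g z) :=
  of_computable₂ (φ := fun m n => seqEntry m n) (by fun_prop) hf hg

@[fun_prop] theorem fun_ratAdd {f g : Z → ℕ} (hf : CMap f) (hg : CMap g) :
    CMap fun z => ratAdd (f z) (g z) :=
  of_computable₂ (φ := fun m n => ratAdd m n) (by fun_prop) hf hg

@[fun_prop] theorem fun_ratMul {f g : Z → ℕ} (hf : CMap f) (hg : CMap g) :
    CMap fun z => ratMul (f z) (g z) :=
  of_computable₂ (φ := fun m n => ratMul m n) (by fun_prop) hf hg

@[fun_prop] theorem fun_ratNeg {f : Z → ℕ} (hf : CMap f) : CMap fun z => ratNeg (f z) :=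
  (of_computable (f := fun n => ratNeg n) (by fun_prop)).comp hf

@[fun_prop] theorem fun_radIndex {f : Z → ℕ} (hf : CMap f) : CMap fun z => radIndex (f z) :=
  (of_computable (f := fun n => radIndex n) (by fun_prop)).comp hf

@[fun_prop] theorem unpair_fst {f : Z → ℕ} (hf : CMap f) : CMap fun z => (f z).unpair.1 :=
  (of_computable (f := fun n => n.unpair.1) (by fun_prop)).comp hf

@[fun_prop] theorem unpair_snd {f : Z → ℕ} (hf : CMap f) : CMap fun z => (f z).unpair.2 :=
  (of_computable (f := fun n => n.unpair.2) (by fun_prop)).comp hf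

@[fun_prop] theorem fun_ratMk {f g h : Z → ℕ} (hf : CMap f) (hg : CMap g) (hh : CMap h) :
    CMap fun z => ratMk (f z) (g z) (h z) := by
  unfold ratMk; fun_prop

end
end CMap

instance (n : ℕ) : CPt n where
  re := by
    simp only [pt_nat, d_nat_lt_rad]
    exact RE.of_decide (Computable.fun_decide_eq (by fun_prop) (by fun_prop))

instance (u : Unit) : CPt u where
  re := (RE.of_bool (f := fun _ : ℕ × ℕ => true) (by fun_prop)).congr fun p => by
    change (0 : ℝ) < _ ↔ _
    simp [rad_pos]

instance {X : Type*} [BasicMetric X] [EffectiveMetric X] (n : ℕ) : CPt (pt n : X) where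
  re := by
    refine ((re_dist (Z := X)).comp (g := fun p : ℕ × ℕ => (p.1, n, radIndex p.2))
      (by fun_prop)).congr fun p => ?_
    simp

section
variable {Z Y X : Type*} [BasicMetric Z] [BasicMetric Y] [BasicMetric X] [EffectiveMetric Z]

namespace SD

theorem ratOf_lt {f g : Z → ℕ} (hf : CMap f) (hg : CMap g) :
    SD fun z => ratOf (f z) < ratOf (g z) := by
  have : RE fun n : ℕ => ratOf n.unpair.1 < ratOf n.unpair.2 :=
    RE.ratOf_lt (by fun_prop) (by fun_prop)
  simpa using this.sd.comp (hf.natPair hg)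

theorem ratOf_le {f g : Z → ℕ} (hf : CMap f) (hg : CMap g) :
    SD fun z => ratOf (f z) ≤ ratOf (g z) := by
  have : RE fun n : ℕ => ratOf n.unpair.1 ≤ ratOf n.unpair.2 :=
    RE.ratOf_le (by fun_prop) (by fun_prop)
  simpa using this.sd.comp (hf.natPair hg)

theorem natLt {f g : Z → ℕ} (hf : CMap f) (hg : CMap g) : SD fun z => f z < g z := by
  have : RE fun n : ℕ => n.unpair.1 < n.unpair.2 :=
    RE.of_decide (Computable.fun_lt (by fun_prop) (by fun_prop))
  simpa using this.sd.comp (hf.natPair hg)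

theorem natEq {f g : Z → ℕ} (hf : CMap f) (hg : CMap g) : SD fun z => f z = g z := by
  have : RE fun n : ℕ => n.unpair.1 = n.unpair.2 :=
    RE.of_decide (Computable.fun_decide_eq (by fun_prop) (by fun_prop))
  simpa using this.sd.comp (hf.natPair hg)

theorem natNe {f g : Z → ℕ} (hf : CMap f) (hg : CMap g) : SD fun z => f z ≠ g z :=
  ((natLt hf hg).or (natLt hg hf)).congr fun _ => lt_or_lt_iff_ne.symm

theorem all_lt {P : ℕ × Z → Prop} (hP : SD P) {b : Z → ℕ} (hb : CMap b) :
    SD fun z => ∀ i < b z, P (i, z) :=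
  hP.forall_lt.comp (f := fun z => (b z, z)) (by fun_prop)

end SD

/-! ### The real line -/

instance : EffectiveMetric ℝ where
  d_self z := by change |z - z| = 0; simp
  d_comm z w := abs_sub_comm _ _
  d_triangle x y z := abs_sub_le _ _ _
  dense z ε hε := by
    obtain ⟨n, h1, h2⟩ := exists_ratOf_between (show z - ε < z by linarith)
    refine ⟨n, ?_⟩
    change |(ratOf n : ℝ) - z| < ε
    rw [abs_lt]
    constructor <;> linarith
  re_dist := by
    have h1 : RE fun p : ℕ × ℕ × ℕ => ratOf p.1 < ratOf (ratAdd p.2.1 p.2.2) :=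
      RE.ratOf_lt (by fun_prop) (by fun_prop)
    have h2 : RE fun p : ℕ × ℕ × ℕ => ratOf p.2.1 < ratOf (ratAdd p.1 p.2.2) :=
      RE.ratOf_lt (by fun_prop) (by fun_prop)
    refine (h1.and h2).congr fun p => ?_
    change |(ratOf p.1 : ℝ) - ratOf p.2.1| < _ ↔ _
    rw [abs_lt, ratOf_ratAdd, ratOf_ratAdd, ← Rat.cast_lt (K := ℝ), ← Rat.cast_lt (K := ℝ)]
    push_cast
    constructor <;> rintro ⟨h1, h2⟩ <;> constructor <;> linarith

theorem d_real (x y : ℝ) : d x y = |x - y| := rfl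

theorem pt_real (n : ℕ) : (pt n : ℝ) = ratOf n := rfl

/-- Lower semicomputable real functions. -/
def LSC (f : Z → ℝ) : Prop := SD fun p : ℕ × Z => (ratOf p.1 : ℝ) < f p.2

/-- Upper semicomputable real functions. -/
def USC (f : Z → ℝ) : Prop := SD fun p : ℕ × Z => f p.2 < (ratOf p.1 : ℝ)

variable {f g : Z → ℝ}

theorem LSC.lt (hf : LSC f) {q : Z → ℕ} (hq : CMap q) : SD fun z => (ratOf (q z) : ℝ) < f z :=
  SD.comp (P := fun p : ℕ × Z => (ratOf p.1 : ℝ) < f p.2) hf (f := fun z => (q z, z))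
    (by fun_prop)

theorem USC.lt (hf : USC f) {q : Z → ℕ} (hq : CMap q) : SD fun z => f z < (ratOf (q z) : ℝ) :=
  SD.comp (P := fun p : ℕ × Z => f p.2 < (ratOf p.1 : ℝ)) hf (f := fun z => (q z, z))
    (by fun_prop)

theorem LSC.comp {f : Y → ℝ} (hf : LSC f) {q : Z → Y} (hq : CMap q) :
    LSC fun z => f (q z) :=
  SD.comp (P := fun p : ℕ × Y => (ratOf p.1 : ℝ) < f p.2) hf (f := fun p : ℕ × Z => (p.1, q p.2))
    (by fun_prop)

theorem USC.comp {f : Y → ℝ} (hf : USC f) {q : Z → Y} (hq : CMap q) :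
    USC fun z => f (q z) :=
  SD.comp (P := fun p : ℕ × Y => f p.2 < (ratOf p.1 : ℝ)) hf (f := fun p : ℕ × Z => (p.1, q p.2))
    (by fun_prop)

theorem LSC.of_cmap_id : LSC (fun x : ℝ => x) := by
  have h1 : RE fun p : ℕ × ℕ × ℕ => ratOf (ratAdd p.1 (radIndex p.2.2)) < ratOf p.2.1 :=
    RE.ratOf_lt (by fun_prop) (by fun_prop)
  refine sd_nat_prod.2 ⟨_, h1, fun q x => ?_⟩
  simp only [← Rat.cast_lt (K := ℝ), ratOf_ratAdd, Rat.cast_add, ratOf_radIndex, pt_real, d_real,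
    abs_lt]
  constructor
  · intro h
    obtain ⟨r, hr⟩ := exists_rad_lt (half_pos (sub_pos.2 h))
    obtain ⟨i, hi, hi'⟩ := exists_ratOf_between (show x - rad r < x by linarith [rad_pos r])
    exact ⟨i, r, by linarith, by linarith, by linarith [rad_pos r]⟩
  · rintro ⟨i, r, h1, h2, h3⟩
    linarith

theorem USC.of_cmap_id : USC (fun x : ℝ => x) := by
  have h1 : RE fun p : ℕ × ℕ × ℕ => ratOf (ratAdd p.2.1 (radIndex p.2.2)) < ratOf p.1 :=
    RE.ratOf_lt (by fun_prop) (by fun_prop)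
  refine sd_nat_prod.2 ⟨_, h1, fun q x => ?_⟩
  simp only [← Rat.cast_lt (K := ℝ), ratOf_ratAdd, Rat.cast_add, ratOf_radIndex, pt_real, d_real,
    abs_lt]
  constructor
  · intro h
    obtain ⟨r, hr⟩ := exists_rad_lt (half_pos (sub_pos.2 h))
    obtain ⟨i, hi, hi'⟩ := exists_ratOf_between (show x - rad r < x by linarith [rad_pos r])
    exact ⟨i, r, by linarith, by linarith, by linarith [rad_pos r]⟩
  · rintro ⟨i, r, h1, h2, h3⟩
    linarith

theorem CMap.lsc (hf : CMap f) : LSC f := LSC.of_cmap_id.comp hf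

theorem CMap.usc (hf : CMap f) : USC f := USC.of_cmap_id.comp hf

/-- Basic balls of `ℝ` are intervals with rational end points; each hypothesis handles one end. -/
theorem cmap_of_lsc_usc (h1 : LSC f) (h2 : USC f) : CMap f := by
  have h3 : SD fun p : ℕ × ℕ × Z => (ratOf (ratAdd p.1 (ratNeg (radIndex p.2.1))) : ℝ) < f p.2.2 :=
    LSC.lt (f := fun p : ℕ × ℕ × Z => f p.2.2) (h1.comp (by fun_prop)) (by fun_prop)
  have h4 : SD fun p : ℕ × ℕ × Z => f p.2.2 < (ratOf (ratAdd p.1 (radIndex p.2.1)) : ℝ) :=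
    USC.lt (f := fun p : ℕ × ℕ × Z => f p.2.2) (h2.comp (by fun_prop)) (by fun_prop)
  refine cmap_iff_sd.2 ((h3.and h4).congr fun p => ?_)
  rw [ratOf_ratAdd, ratOf_ratAdd, ratOf_ratNeg, d_real, pt_real, abs_lt]
  push_cast
  rw [ratOf_radIndex]
  constructor <;> rintro ⟨h1, h2⟩ <;> constructor <;> linarith

theorem SD.real_lt (hf : USC f) (hg : LSC g) : SD fun z => f z < g z := by
  have : SD fun z => ∃ n, f z < (ratOf n : ℝ) ∧ (ratOf n : ℝ) < g z :=
    SD.exists_nat (P := fun p : ℕ × Z => f p.2 < (ratOf p.1 : ℝ) ∧ (ratOf p.1 : ℝ) < g p.2)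
      (SD.and hf hg)
  refine this.congr fun z => ⟨exists_ratOf_between, ?_⟩
  rintro ⟨n, h1, h2⟩
  exact h1.trans h2

theorem LSC.add (hf : LSC f) (hg : LSC g) : LSC fun z => f z + g z := by
  have : SD fun p : ℕ × Z => ∃ a b, (ratOf a : ℝ) < f p.2 ∧ (ratOf b : ℝ) < g p.2 ∧
      ratOf p.1 < ratOf (ratAdd a b) := by
    refine SD.exists_nat (P := fun p : ℕ × ℕ × Z => ∃ b, (ratOf p.1 : ℝ) < f p.2.2 ∧
      (ratOf b : ℝ) < g p.2.2 ∧ ratOf p.2.1 < ratOf (ratAdd p.1 b)) ?_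
    refine SD.exists_nat (P := fun p : ℕ × ℕ × ℕ × Z => (ratOf p.2.1 : ℝ) < f p.2.2.2 ∧
      (ratOf p.1 : ℝ) < g p.2.2.2 ∧ ratOf p.2.2.1 < ratOf (ratAdd p.2.1 p.1)) ?_
    exact ((hf.comp (by fun_prop)).lt (by fun_prop)).and (((hg.comp (by fun_prop)).lt
      (by fun_prop)).and (SD.ratOf_lt (by fun_prop) (by fun_prop)))
  refine this.congr fun p => ?_
  simp only [ratOf_ratAdd, ← Rat.cast_lt (K := ℝ), Rat.cast_add]
  constructor
  · intro h
    obtain ⟨a, h1, h2⟩ := exists_ratOf_between (show f p.2 - (f p.2 + g p.2 - ratOf p.1) / 2 < f p.2 by linarith)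
    obtain ⟨b, h3, h4⟩ := exists_ratOf_between (show g p.2 - (f p.2 + g p.2 - ratOf p.1) / 2 < g p.2 by linarith)
    exact ⟨a, b, h2, h4, by linarith⟩
  · rintro ⟨a, b, h1, h2, h3⟩
    linarith

theorem LSC.neg (hf : LSC f) : USC fun z => - f z :=
  (LSC.lt (f := fun p : ℕ × Z => f p.2) (hf.comp (by fun_prop)) (q := fun p => ratNeg p.1)
    (by fun_prop)).congr fun p => by
      rw [ratOf_ratNeg]; push_cast; exact neg_lt

theorem USC.neg (hf : USC f) : LSC fun z => - f z :=
  (USC.lt (f := fun p : ℕ × Z => f p.2) (hf.comp (by fun_prop)) (q := fun p => ratNeg p.1)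
    (by fun_prop)).congr fun p => by
      rw [ratOf_ratNeg]; push_cast; exact lt_neg

theorem USC.add (hf : USC f) (hg : USC g) : USC fun z => f z + g z := by
  have := (hf.neg.add hg.neg).neg
  simpa [add_comm] using this

theorem USC.sub (hf : USC f) (hg : LSC g) : USC fun z => f z - g z := by
  simpa [sub_eq_add_neg] using hf.add hg.neg

theorem LSC.sup (hf : LSC f) (hg : LSC g) : LSC fun z => max (f z) (g z) :=
  (SD.or hf hg).congr fun _ => lt_max_iff

theorem LSC.inf (hf : LSC f) (hg : LSC g) : LSC fun z => min (f z) (g z) :=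
  (SD.and hf hg).congr fun _ => lt_min_iff

theorem USC.sup (hf : USC f) (hg : USC g) : USC fun z => max (f z) (g z) :=
  (SD.and hf hg).congr fun _ => max_lt_iff

theorem USC.inf (hf : USC f) (hg : USC g) : USC fun z => min (f z) (g z) :=
  (SD.or hf hg).congr fun _ => min_lt_iff

theorem ratOf_zero : ratOf 0 = 0 := by simp [ratOf]

theorem LSC.mul_of_nonneg (hf : LSC f) (hg : LSC g) (hf0 : ∀ z, 0 ≤ f z) (hg0 : ∀ z, 0 ≤ g z) :
    LSC fun z => f z * g z := by
  -- Negative bounds are accepted outright: if a factor vanishes, no nonnegative rational lies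
  -- strictly below it.
  have : SD fun p : ℕ × Z => ratOf p.1 < ratOf 0 ∨ ∃ a b, (ratOf a : ℝ) < f p.2 ∧
      (ratOf b : ℝ) < g p.2 ∧ ratOf p.1 ≤ ratOf (ratMul a b) ∧ ratOf 0 ≤ ratOf a ∧
      ratOf 0 ≤ ratOf b := by
    refine (SD.ratOf_lt (by fun_prop) (by fun_prop)).or ?_
    refine SD.exists_nat (P := fun p : ℕ × ℕ × Z => ∃ b, (ratOf p.1 : ℝ) < f p.2.2 ∧
      (ratOf b : ℝ) < g p.2.2 ∧ ratOf p.2.1 ≤ ratOf (ratMul p.1 b) ∧ ratOf 0 ≤ ratOf p.1 ∧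
      ratOf 0 ≤ ratOf b) ?_
    refine SD.exists_nat (P := fun p : ℕ × ℕ × ℕ × Z => (ratOf p.2.1 : ℝ) < f p.2.2.2 ∧
      (ratOf p.1 : ℝ) < g p.2.2.2 ∧ ratOf p.2.2.1 ≤ ratOf (ratMul p.2.1 p.1) ∧
      ratOf 0 ≤ ratOf p.2.1 ∧ ratOf 0 ≤ ratOf p.1) ?_
    exact ((hf.comp (by fun_prop)).lt (by fun_prop)).and (((hg.comp (by fun_prop)).lt
      (by fun_prop)).and ((SD.ratOf_le (by fun_prop) (by fun_prop)).and
      ((SD.ratOf_le (by fun_prop) (by fun_prop)).and (SD.ratOf_le (by fun_prop) (by fun_prop)))))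
  refine this.congr fun p => ?_
  simp only [ratOf_ratMul, ← Rat.cast_lt (K := ℝ), ← Rat.cast_le (K := ℝ), Rat.cast_mul, ratOf_zero,
    Rat.cast_zero]
  constructor
  · intro h
    rcases lt_or_ge (ratOf p.1 : ℝ) 0 with h0 | h0
    · exact Or.inl h0
    right
    have hf1 : 0 < f p.2 := (hf0 _).lt_of_ne' fun h1 => by rw [h1, zero_mul] at h; linarith
    have hg1 : 0 < g p.2 := (hg0 _).lt_of_ne' fun h1 => by rw [h1, mul_zero] at h; linarith
    have h1 : (ratOf p.1 : ℝ) / g p.2 < f p.2 := by rwa [div_lt_iff₀ hg1]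
    obtain ⟨a, ha, ha'⟩ := exists_ratOf_between h1
    have ha0 : (0 : ℝ) < ratOf a := (div_nonneg h0 hg1.le).trans_lt ha
    have h2 : (ratOf p.1 : ℝ) / ratOf a < g p.2 := by
      rw [div_lt_iff₀ ha0]; rw [div_lt_iff₀ hg1] at ha; linarith
    obtain ⟨b, hb, hb'⟩ := exists_ratOf_between h2
    refine ⟨a, b, ha', hb', ?_, ha0.le, (div_nonneg h0 ha0.le).trans hb.le⟩
    rw [div_lt_iff₀ ha0] at hb
    linarith
  · rintro (h | ⟨a, b, h1, h2, h3, h4, h5⟩)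
    · exact h.trans_le (mul_nonneg (hf0 _) (hg0 _))
    · exact h3.trans_lt (mul_lt_mul'' h1 h2 h4 h5)

theorem USC.mul_of_nonneg (hf : USC f) (hg : USC g) (hf0 : ∀ z, 0 ≤ f z) (hg0 : ∀ z, 0 ≤ g z) :
    USC fun z => f z * g z := by
  have : SD fun p : ℕ × Z => ∃ a b, f p.2 < (ratOf a : ℝ) ∧
      g p.2 < (ratOf b : ℝ) ∧ ratOf (ratMul a b) ≤ ratOf p.1 := by
    refine SD.exists_nat (P := fun p : ℕ × ℕ × Z => ∃ b, f p.2.2 < (ratOf p.1 : ℝ) ∧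
      g p.2.2 < (ratOf b : ℝ) ∧ ratOf (ratMul p.1 b) ≤ ratOf p.2.1) ?_
    refine SD.exists_nat (P := fun p : ℕ × ℕ × ℕ × Z => f p.2.2.2 < (ratOf p.2.1 : ℝ) ∧
      g p.2.2.2 < (ratOf p.1 : ℝ) ∧ ratOf (ratMul p.2.1 p.1) ≤ ratOf p.2.2.1) ?_
    exact ((hf.comp (by fun_prop)).lt (by fun_prop)).and (((hg.comp (by fun_prop)).lt
      (by fun_prop)).and (SD.ratOf_le (by fun_prop) (by fun_prop)))
  refine this.congr fun p => ?_
  simp only [ratOf_ratMul, ← Rat.cast_le (K := ℝ), Rat.cast_mul]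
  constructor
  · intro h
    have hc : Tendsto (fun t : ℝ => (f p.2 + t) * (g p.2 + t)) (𝓝[>] 0) (𝓝 (f p.2 * g p.2)) := by
      have : Continuous fun t : ℝ => (f p.2 + t) * (g p.2 + t) := by fun_prop
      simpa using this.continuousAt.tendsto.mono_left (nhdsWithin_le_nhds (a := (0 : ℝ)) (s := Set.Ioi 0))
    obtain ⟨t, ht, ht0⟩ := ((hc.eventually_lt_const h).and self_mem_nhdsWithin).exists
    have ht0 : 0 < t := ht0
    obtain ⟨a, ha, ha'⟩ := exists_ratOf_between (show f p.2 < f p.2 + t by linarith)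
    obtain ⟨b, hb, hb'⟩ := exists_ratOf_between (show g p.2 < g p.2 + t by linarith)
    refine ⟨a, b, ha, hb, le_trans ?_ ht.le⟩
    exact mul_le_mul ha'.le hb'.le ((hg0 _).trans hb.le) (by linarith [hf0 p.2])
  · rintro ⟨a, b, h1, h2, h3⟩
    exact (mul_lt_mul'' h1 h2 (hf0 _) (hg0 _)).trans_le h3

/-- The hypothesis `h` says that `f z` is the supremum of the `u n z`, in the form in which a search
uses it and without side conditions on boundedness. -/
theorem LSC.iSup_iff {u : ℕ → Z → ℝ} (hu : LSC fun p : ℕ × Z => u p.1 p.2)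
    (h : ∀ z (q : ℝ), q < f z ↔ ∃ n, q < u n z) : LSC f :=
  (SD.exists_nat (P := fun p : ℕ × ℕ × Z => (ratOf p.2.1 : ℝ) < u p.1 p.2.2)
    (LSC.lt (f := fun p : ℕ × ℕ × Z => u p.1 p.2.2) (hu.comp (q := fun p : ℕ × ℕ × Z => (p.1, p.2.2))
      (by fun_prop)) (by fun_prop))).congr fun _ => h _ _

theorem USC.iInf_iff {u : ℕ → Z → ℝ} (hu : USC fun p : ℕ × Z => u p.1 p.2)
    (h : ∀ z (q : ℝ), f z < q ↔ ∃ n, u n z < q) : USC f :=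
  (SD.exists_nat (P := fun p : ℕ × ℕ × Z => u p.1 p.2.2 < (ratOf p.2.1 : ℝ))
    (USC.lt (f := fun p : ℕ × ℕ × Z => u p.1 p.2.2) (hu.comp (q := fun p : ℕ × ℕ × Z => (p.1, p.2.2))
      (by fun_prop)) (by fun_prop))).congr fun _ => h _ _

/-! ### Closure properties of computable real functions. -/

namespace CMap

@[fun_prop] theorem fun_ratOf {f : Z → ℕ} (hf : CMap f) : CMap fun z => (ratOf (f z) : ℝ) := by
  refine cmap_of_lsc_usc ?_ ?_
  · exact (SD.ratOf_lt (Z := ℕ × Z) (f := fun p => p.1) (g := fun p => f p.2) (by fun_prop)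
      (by fun_prop)).congr fun p => Rat.cast_lt
  · exact (SD.ratOf_lt (Z := ℕ × Z) (g := fun p => p.1) (f := fun p => f p.2) (by fun_prop)
      (by fun_prop)).congr fun p => Rat.cast_lt

theorem of_eq {f g : Z → Y} (hf : CMap f) (h : ∀ z, f z = g z) : CMap g := by
  rwa [← funext h]

@[fun_prop] theorem natCast {f : Z → ℕ} (hf : CMap f) : CMap fun z => (f z : ℝ) := by
  have : CMap fun z => (ratOf (ratMk (f z) 0 0) : ℝ) := by fun_prop
  refine this.of_eq fun z => ?_
  simp [ratOf_ratMk]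

@[fun_prop] theorem fun_posRatOf {f : Z → ℕ} (hf : CMap f) : CMap fun z => (posRatOf (f z) : ℝ) := by
  have : CMap fun z => (ratOf (ratMk ((f z).unpair.1 + 1) 0 (f z).unpair.2) : ℝ) := by
    fun_prop
  refine this.of_eq fun z => ?_
  simp [ratOf_ratMk, posRatOf]

@[fun_prop] theorem zero : CMap fun _ : Z => (0 : ℝ) := by
  simpa using natCast (Z := Z) (f := fun _ => 0) (by fun_prop)

@[fun_prop] theorem add (hf : CMap f) (hg : CMap g) : CMap fun z => f z + g z :=
  cmap_of_lsc_usc (hf.lsc.add hg.lsc) (hf.usc.add hg.usc)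

@[fun_prop] theorem neg (hf : CMap f) : CMap fun z => - f z :=
  cmap_of_lsc_usc hf.usc.neg hf.lsc.neg

@[fun_prop] theorem sub (hf : CMap f) (hg : CMap g) : CMap fun z => f z - g z := by
  simp only [sub_eq_add_neg]; fun_prop

@[fun_prop] theorem sup (hf : CMap f) (hg : CMap g) : CMap fun z => max (f z) (g z) :=
  cmap_of_lsc_usc (hf.lsc.sup hg.lsc) (hf.usc.sup hg.usc)

@[fun_prop] theorem inf (hf : CMap f) (hg : CMap g) : CMap fun z => min (f z) (g z) :=
  cmap_of_lsc_usc (hf.lsc.inf hg.lsc) (hf.usc.inf hg.usc)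

@[fun_prop] theorem abs (hf : CMap f) : CMap fun z => |f z| := hf.sup hf.neg

theorem mul_of_nonneg (hf : CMap f) (hg : CMap g) (hf0 : ∀ z, 0 ≤ f z) (hg0 : ∀ z, 0 ≤ g z) :
    CMap fun z => f z * g z :=
  cmap_of_lsc_usc (hf.lsc.mul_of_nonneg hg.lsc hf0 hg0) (hf.usc.mul_of_nonneg hg.usc hf0 hg0)

-- Splitting both factors into positive and negative parts reduces this to nonnegative factors.
@[fun_prop] theorem mul (hf : CMap f) (hg : CMap g) : CMap fun z => f z * g z := by
  have h (a b : Z → ℝ) (ha : CMap a) (hb : CMap b) : CMap fun z => max (a z) 0 * max (b z) 0 :=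
    mul_of_nonneg (ha.sup zero) (hb.sup zero) (fun _ => le_max_right _ _) fun _ => le_max_right _ _
  have e (x : ℝ) : x = max x 0 - max (-x) 0 := by
    rcases le_total x 0 with h | h
    · simp [h]
    · simp [h]
  refine ((((h _ _ hf hg).sub (h _ _ hf hg.neg)).sub (h _ _ hf.neg hg)).add
    (h _ _ hf.neg hg.neg)).of_eq fun z => ?_
  conv_rhs => rw [e (f z), e (g z)]
  ring

/-- Rational upper bounds of `f z` give lower bounds of the inverse, and positive lower bounds give
upper bounds; multiplied out, the comparison involves only products of rationals. -/
theorem inv (hf : CMap f) (h0 : ∀ z, 0 < f z) : CMap fun z => (f z)⁻¹ := by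
  refine cmap_of_lsc_usc ?_ ?_
  · have : SD fun p : ℕ × Z => ∃ a, f p.2 < (ratOf a : ℝ) ∧
        ratOf (ratMul p.1 a) ≤ ratOf (ratMk 1 0 0) := by
      refine SD.exists_nat (P := fun p : ℕ × ℕ × Z => f p.2.2 < (ratOf p.1 : ℝ) ∧
        ratOf (ratMul p.2.1 p.1) ≤ ratOf (ratMk 1 0 0)) ?_
      exact (USC.lt (f := fun p : ℕ × ℕ × Z => f p.2.2) (hf.usc.comp (by fun_prop))
        (by fun_prop)).and (SD.ratOf_le (by fun_prop) (by fun_prop))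
    refine this.congr fun p => ?_
    simp only [ratOf_ratMul, ratOf_ratMk, ← Rat.cast_le (K := ℝ), Rat.cast_mul]
    push_cast
    simp only [sub_zero, zero_add, div_one]
    have hp := h0 p.2
    constructor
    · intro h
      rcases le_or_gt (ratOf p.1 : ℝ) 0 with h1 | h1
      · obtain ⟨a, ha, -⟩ := exists_ratOf_between (show f p.2 < f p.2 + 1 by linarith)
        exact ⟨a, ha, (mul_nonpos_of_nonpos_of_nonneg h1 (by linarith)).trans zero_le_one⟩
      · rw [lt_inv_comm₀ h1 hp] at h
        obtain ⟨a, ha, ha'⟩ := exists_ratOf_between h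
        refine ⟨a, ha, ?_⟩
        calc (ratOf p.1 : ℝ) * ratOf a
            ≤ (ratOf p.1 : ℝ) * (ratOf p.1 : ℝ)⁻¹ := by gcongr
          _ = 1 := mul_inv_cancel₀ h1.ne'
    · rintro ⟨a, h1, h2⟩
      have ha : (0 : ℝ) < ratOf a := hp.trans h1
      rw [← le_div_iff₀ ha, one_div] at h2
      exact h2.trans_lt ((inv_lt_inv₀ ha hp).2 h1)
  · have : SD fun p : ℕ × Z => ∃ a, (ratOf a : ℝ) < f p.2 ∧
        ratOf 0 < ratOf a ∧
        ratOf (ratMk 1 0 0) ≤ ratOf (ratMul p.1 a) := by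
      refine SD.exists_nat (P := fun p : ℕ × ℕ × Z => (ratOf p.1 : ℝ) < f p.2.2 ∧
        ratOf 0 < ratOf p.1 ∧
        ratOf (ratMk 1 0 0) ≤ ratOf (ratMul p.2.1 p.1)) ?_
      exact (LSC.lt (f := fun p : ℕ × ℕ × Z => f p.2.2) (hf.lsc.comp (by fun_prop))
        (by fun_prop)).and ((SD.ratOf_lt (by fun_prop) (by fun_prop)).and
        (SD.ratOf_le (by fun_prop) (by fun_prop)))
    refine this.congr fun p => ?_
    simp only [ratOf_ratMul, ratOf_ratMk, ← Rat.cast_le (K := ℝ), ← Rat.cast_lt (K := ℝ),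
      Rat.cast_mul, ratOf_zero]
    push_cast
    simp only [sub_zero, zero_add, div_one]
    have hp := h0 p.2
    constructor
    · intro h
      have h1 : (0 : ℝ) < ratOf p.1 := (inv_pos.2 hp).trans h
      rw [inv_lt_comm₀ hp h1] at h
      obtain ⟨a, ha, ha'⟩ := exists_ratOf_between h
      refine ⟨a, ha', (inv_pos.2 h1).trans ha, ?_⟩
      calc (1 : ℝ) = (ratOf p.1 : ℝ) * (ratOf p.1 : ℝ)⁻¹ := (mul_inv_cancel₀ h1.ne').symm
        _ ≤ _ := by gcongr
    · rintro ⟨a, h1, h2, h3⟩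
      rw [← div_le_iff₀ h2, one_div] at h3
      exact ((inv_lt_inv₀ hp h2).2 h1).trans_le h3

theorem div (hf : CMap f) (hg : CMap g) (h0 : ∀ z, 0 < g z) : CMap fun z => f z / g z := by
  simp only [div_eq_mul_inv]
  exact hf.mul (hg.inv h0)

@[fun_prop] theorem sqrt (hf : CMap f) : CMap fun z => √(f z) := by
  refine cmap_of_lsc_usc ?_ ?_
  · have : SD fun p : ℕ × Z => ratOf p.1 < ratOf 0 ∨
        (ratOf (ratMul p.1 p.1) : ℝ) < f p.2 :=
      (SD.ratOf_lt (by fun_prop) (by fun_prop)).or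
        (LSC.lt (f := fun p : ℕ × Z => f p.2) (hf.lsc.comp (by fun_prop)) (by fun_prop))
    refine this.congr fun p => ?_
    rw [← Rat.cast_lt (K := ℝ), ratOf_ratMul, ratOf_zero]
    push_cast
    rcases lt_or_ge (ratOf p.1 : ℝ) 0 with h | h
    · simp only [h, true_or, iff_true]
      exact h.trans_le (Real.sqrt_nonneg _)
    · rw [Real.lt_sqrt h, sq]
      simp [h.not_gt]
  · have : SD fun p : ℕ × Z => ratOf 0 < ratOf p.1 ∧
        f p.2 < (ratOf (ratMul p.1 p.1) : ℝ) :=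
      (SD.ratOf_lt (by fun_prop) (by fun_prop)).and
        (USC.lt (f := fun p : ℕ × Z => f p.2) (hf.usc.comp (by fun_prop)) (by fun_prop))
    refine this.congr fun p => ?_
    rw [← Rat.cast_lt (K := ℝ), ratOf_ratMul, ratOf_zero]
    push_cast
    rcases lt_or_ge (0 : ℝ) (ratOf p.1) with h | h
    · rw [Real.sqrt_lt' h, sq]
      simp [h]
    · simp only [h.not_gt, false_and, iff_false, not_lt]
      exact h.trans (Real.sqrt_nonneg _)

/-- Equality and inequality of natural numbers are both semidecidable, so the two branches glue. -/
theorem ite_nat {m n : Z → ℕ} (hm : CMap m) (hn : CMap n) {f g : Z → Y} (hf : CMap f)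
    (hg : CMap g) : CMap fun z => if m z = n z then f z else g z := by
  have h1 : SD fun p : ℕ × ℕ × Z => d (pt p.1) (f p.2.2) < rad p.2.1 := cmap_iff_sd.1 hf
  have h2 : SD fun p : ℕ × ℕ × Z => d (pt p.1) (g p.2.2) < rad p.2.1 :=
    cmap_iff_sd.1 hg
  have h3 : SD fun p : ℕ × ℕ × Z => m p.2.2 = n p.2.2 := SD.natEq (by fun_prop) (by fun_prop)
  have h4 : SD fun p : ℕ × ℕ × Z => m p.2.2 ≠ n p.2.2 := SD.natNe (by fun_prop) (by fun_prop)
  refine cmap_iff_sd.2 (((h3.and h1).or (h4.and h2)).congr fun p => ?_)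
  by_cases h : m p.2.2 = n p.2.2 <;> simp [h]

/-- Computable maps are closed under primitive recursion. -/
theorem natRec {g : Z → Y} {h : ℕ → Y → Z → Y} (hg : CMap g)
    (hh : CMap fun p : ℕ × Y × Z => h p.1 p.2.1 p.2.2) :
    CMap fun p : ℕ × Z => (Nat.rec (g p.2) (fun n y => h n y p.2) p.1 : Y) := by
  obtain ⟨W, hW, hh⟩ := cmap_iff.1 hh
  have hg' : SD fun p : ℕ × ℕ × Z => d (pt p.1) (g p.2.2) < rad p.2.1 :=
    cmap_iff_sd.1 hg
  have hV : RE fun e : ℕ => W (e.unpair.1.unpair.1, e.unpair.1.unpair.2, e.unpair.2.unpair.1,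
      e.unpair.2.unpair.2) := hW.comp (by fun_prop)
  have hball : SD fun p : ℕ × ℕ × Z => d (pt p.1) p.2.2 < rad p.2.1 :=
    cmap_iff_sd.1 (CMap.id (Z := Z))
  -- One step of the recursion on balls: if the value at stage `j` lies in the ball coded by `u` and
  -- the parameter in the ball around `pt b` of the same radius, then the value at stage `j + 1`
  -- lies in the ball coded by `v`.
  let S : ℕ → ℕ → ℕ → ℕ → Z → Prop := fun b j u v z =>
    W (v.unpair.1, v.unpair.2, Nat.pair j (Nat.pair u.unpair.1 b), u.unpair.2) ∧
      d (pt b) z < rad u.unpair.2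
  have hS : SD fun p : ℕ × ℕ × ℕ × Z => ∃ b, S b p.1 (seqEntry p.2.1 p.1)
      (seqEntry p.2.1 (p.1 + 1)) p.2.2.2 := by
    refine SD.exists_nat (P := fun p : ℕ × ℕ × ℕ × ℕ × Z => S p.1 p.2.1
      (seqEntry p.2.2.1 p.2.1) (seqEntry p.2.2.1 (p.2.1 + 1)) p.2.2.2.2) ?_
    refine SD.and ?_ ?_
    · refine (hV.sd.comp (f := fun p : ℕ × ℕ × ℕ × ℕ × Z =>
        Nat.pair (seqEntry p.2.2.1 (p.2.1 + 1))
          (Nat.pair (Nat.pair p.2.1 (Nat.pair (seqEntry p.2.2.1 p.2.1).unpair.1 p.1))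
            (seqEntry p.2.2.1 p.2.1).unpair.2)) (by fun_prop)).congr fun p => ?_
      simp
    · exact hball.comp (f := fun p : ℕ × ℕ × ℕ × ℕ × Z =>
        (p.1, (seqEntry p.2.2.1 p.2.1).unpair.2, p.2.2.2.2)) (by fun_prop)
  -- `L` codes a chain of balls, one for each stage, from a ball containing `g z` to the target
  -- ball.
  have key : SD fun p : ℕ × ℕ × ℕ × Z => ∃ L, seqEntry L p.2.2.1 = Nat.pair p.1 p.2.1 ∧
      d (pt (seqEntry L 0).unpair.1) (g p.2.2.2) < rad (seqEntry L 0).unpair.2 ∧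
      ∀ j < p.2.2.1, ∃ b, S b j (seqEntry L j) (seqEntry L (j + 1)) p.2.2.2 := by
    refine SD.exists_nat (P := fun p : ℕ × ℕ × ℕ × ℕ × Z =>
      seqEntry p.1 p.2.2.2.1 = Nat.pair p.2.1 p.2.2.1 ∧
      d (pt (seqEntry p.1 0).unpair.1) (g p.2.2.2.2) < rad (seqEntry p.1 0).unpair.2 ∧
      ∀ j < p.2.2.2.1, ∃ b, S b j (seqEntry p.1 j) (seqEntry p.1 (j + 1)) p.2.2.2.2) ?_
    refine (SD.natEq (by fun_prop) (by fun_prop)).and (SD.and ?_ ?_)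
    · exact hg'.comp (f := fun p : ℕ × ℕ × ℕ × ℕ × Z =>
        ((seqEntry p.1 0).unpair.1, (seqEntry p.1 0).unpair.2, p.2.2.2.2))
        (by fun_prop)
    · exact SD.all_lt (P := fun p : ℕ × ℕ × ℕ × ℕ × ℕ × Z => ∃ b, S b p.1
        (seqEntry p.2.1 p.1) (seqEntry p.2.1 (p.1 + 1)) p.2.2.2.2.2)
        (hS.comp (f := fun p : ℕ × ℕ × ℕ × ℕ × ℕ × Z => (p.1, p.2.1, 0, p.2.2.2.2.2))
        (by fun_prop)) (by fun_prop)
  refine cmap_iff_sd.2 (key.congr ?_)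
  rintro ⟨c, k, n, z⟩
  dsimp only
  have step : ∀ j c k (y : Y), d (pt c) (h j y z) < rad k ↔ ∃ u, d (pt u.unpair.1) y < rad u.unpair.2
      ∧ ∃ b, S b j u (Nat.pair c k) z := by
    intro j c k y
    rw [hh c k (j, y, z)]
    simp only [d_prod, pt_prod, max_lt_iff, pt_nat, d_nat_lt_rad, S, Nat.unpair_pair]
    constructor
    · rintro ⟨i, r, hi, rfl, hy, hz⟩
      exact ⟨Nat.pair i.unpair.2.unpair.1 r, by simpa using hy, i.unpair.2.unpair.2, by
        simpa using hi, by simpa using hz⟩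
    · rintro ⟨u, hy, b, hb, hz⟩
      exact ⟨_, _, hb, by simp, by simpa using hy, by simpa using hz⟩
  induction n generalizing c k with
  | zero =>
    constructor
    · intro hc
      obtain ⟨L, hL⟩ := exists_seqEntry (fun _ => Nat.pair c k) 1
      exact ⟨L, hL 0 one_pos, by rw [hL 0 one_pos]; simpa using hc, by simp⟩
    · rintro ⟨L, hL, hd, -⟩
      rw [hL] at hd
      simpa using hd
  | succ n ih =>
    change d (pt c) (h n _ z) < rad k ↔ _
    rw [step]
    constructor
    · rintro ⟨u, hu, hb⟩
      obtain ⟨L, hL, h0, hj⟩ := (ih _ _).1 hu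
      obtain ⟨L', hL'⟩ := exists_seqEntry
        (fun i => if i < n + 1 then seqEntry L i else Nat.pair c k) (n + 2)
      have e1 : ∀ i < n + 1, seqEntry L' i = seqEntry L i := fun i hi => by
        rw [hL' i (by omega), if_pos hi]
      have e2 : seqEntry L' (n + 1) = Nat.pair c k := by
        rw [hL' _ (by omega), if_neg (by omega)]
      refine ⟨L', e2, by rwa [e1 0 (by omega)], fun j hjn => ?_⟩
      rcases Nat.lt_succ_iff_lt_or_eq.1 hjn with hlt | rfl
      · rw [e1 j (by omega), e1 (j + 1) (by omega)]
        exact hj j hlt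
      · rw [e1 j (by omega), e2, hL]
        simpa using hb
    · rintro ⟨L, hL, h0, hj⟩
      refine ⟨seqEntry L n, (ih _ _).2 ⟨L, by simp, h0, fun j hjn => hj j (by omega)⟩, ?_⟩
      rw [← hL]
      exact hj n (by omega)

@[fun_prop] theorem sum {f : ℕ → Z → ℝ} (hf : CMap fun p : ℕ × Z => f p.1 p.2) {n : Z → ℕ}
    (hn : CMap n) : CMap fun z => ∑ i ∈ Finset.range (n z), f i z := by
  have := (natRec (Z := Z) (Y := ℝ) (g := fun _ => 0) (h := fun n y z => y + f n z) (by fun_prop)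
    (CMap.add (by fun_prop) (hf.comp (g := fun p : ℕ × ℝ × Z => (p.1, p.2.2)) (by fun_prop)))).comp
    (g := fun z => (n z, z)) (by fun_prop)
  refine this.of_eq fun z => ?_
  dsimp only
  induction n z with
  | zero => simp
  | succ m ih => rw [Finset.sum_range_succ, ← ih]

end CMap

instance (n : ℕ) : CPt (n : ℝ) where
  re := by
    have := (inferInstance : CPt (pt (ratMk n 0 0) : ℝ)).re
    rw [pt_real, ratOf_ratMk] at this
    simpa using this

instance : CPt (0 : ℝ) := by simpa using (inferInstance : CPt ((0 : ℕ) : ℝ))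

instance : CPt (1 : ℝ) := by simpa using (inferInstance : CPt ((1 : ℕ) : ℝ))

instance (n : ℕ) [n.AtLeastTwo] : CPt (no_index (OfNat.ofNat n : ℝ)) := by
  rw [← Nat.cast_ofNat (R := ℝ)]
  infer_instance

namespace CMap

@[fun_prop] theorem pow (hf : CMap f) {n : Z → ℕ} (hn : CMap n) : CMap fun z => f z ^ n z := by
  have := (natRec (Z := Z) (Y := ℝ) (g := fun _ => 1) (h := fun n y z => y * f z) (by fun_prop)
    (by fun_prop)).comp (g := fun z => (n z, z)) (by fun_prop)
  refine this.of_eq fun z => ?_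
  dsimp only
  induction n z with
  | zero => simp
  | succ m ih => rw [pow_succ, ← ih]

theorem pt_aux [EffectiveMetric Y] : CMap (fun n : ℕ => (pt n : Y)) := by
  refine cmap_iff.2 ⟨fun p => d (pt p.1 : Y) (pt p.2.2.1) < (ratOf (radIndex p.2.1) : ℝ),
    (re_dist (Z := Y)).comp (g := fun p : ℕ × ℕ × ℕ × ℕ => (p.1, p.2.2.1, radIndex p.2.1))
      (by fun_prop), fun n k z => ?_⟩
  simp only [pt_nat, d_nat_lt_rad, ratOf_radIndex]
  constructor
  · intro h
    exact ⟨z, 0, h, rfl⟩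
  · rintro ⟨i, r, h, rfl⟩
    exact h

@[fun_prop] theorem fun_pt [EffectiveMetric Y] {f : Z → ℕ} (hf : CMap f) :
    CMap fun z => (pt (f z) : Y) := pt_aux.comp hf

end CMap
end

/-! ### The basic functions -/

/-- Effective metric spaces with computable distances of basic points, and with a measurable
structure for which the basic balls are measurable. -/
class EffectiveMeasurable (Z : Type*) [BasicMetric Z] [MeasurableSpace Z] : Prop extends
    EffectiveMetric Z where
  re_lt_dist : RE fun p : ℕ × ℕ × ℕ => (ratOf p.2.2 : ℝ) < d (pt p.1 : Z) (pt p.2.1)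
  measurable_ball : ∀ i r, MeasurableSet {z : Z | d (pt i) z < rad r}

instance {X : Type*} [ComputableMetricSpace X] [MeasurableSpace X] [BorelSpace X] :
    EffectiveMeasurable X where
  re_lt_dist := by
    obtain ⟨g, hg, hc, hl⟩ := ComputableMetricSpace.computable_dist (X := X)
    have : RE fun p : ℕ × ℕ × ℕ => ∃ i, ratOf (ratAdd p.2.2 (ratMk 1 0 (2 ^ i - 1))) <
        ratOf (g ((p.1, p.2.1), i)) :=
      RE.exists_nat (p := fun q : (ℕ × ℕ × ℕ) × ℕ =>
        ratOf (ratAdd q.1.2.2 (ratMk 1 0 (2 ^ q.2 - 1))) < ratOf (g ((q.1.1, q.1.2.1), q.2)))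
        (RE.ratOf_lt (by fun_prop) (by fun_prop))
    refine this.congr fun p => ?_
    have e : ∀ i, (ratOf (ratAdd p.2.2 (ratMk 1 0 (2 ^ i - 1))) : ℝ) =
        ratOf p.2.2 + (2 : ℝ)⁻¹ ^ i := by
      intro i
      rw [ratOf_ratAdd, ratOf_ratMk]
      push_cast [Nat.one_le_two_pow]
      simp
    simp only [← Rat.cast_lt (K := ℝ), e]
    have hl' := hl (p.1, p.2.1)
    change _ < dist _ _ ↔ _
    constructor
    · intro h
      have h1 : Tendsto (fun i => (ratOf (g ((p.1, p.2.1), i)) : ℝ) - (2 : ℝ)⁻¹ ^ i) atTop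
          (𝓝 (dist (ComputableMetricSpace.basicPoint p.1 : X) (ComputableMetricSpace.basicPoint p.2.1)
            - 0)) :=
        hl'.sub (tendsto_pow_atTop_nhds_zero_of_lt_one (by norm_num) (by norm_num))
      rw [sub_zero] at h1
      obtain ⟨i, hi⟩ := (h1.eventually_const_lt h).exists
      exact ⟨i, by linarith⟩
    · rintro ⟨i, hi⟩
      have : (ratOf p.2.2 : ℝ) < ratOf (g ((p.1, p.2.1), i)) - (2 : ℝ)⁻¹ ^ i := by linarith
      refine lt_of_lt_of_le this ?_
      refine ge_of_tendsto hl' (eventually_atTop.2 ⟨i, fun j hj => ?_⟩)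
      have := (abs_le.1 (hc (p.1, p.2.1) i j hj)).1
      linarith
  measurable_ball i r := by
    have : {z : X | d (pt i) z < rad r} = Metric.ball (pt i) (rad r) := by
      ext z
      rw [Metric.mem_ball, dist_comm]
      rfl
    rw [this]
    exact measurableSet_ball

instance {X Y : Type*} [BasicMetric X] [BasicMetric Y] [MeasurableSpace X] [MeasurableSpace Y]
    [EffectiveMeasurable X] [EffectiveMeasurable Y] : EffectiveMeasurable (X × Y) where
  re_lt_dist := by
    simp only [d_prod, pt_prod, lt_max_iff]
    exact ((EffectiveMeasurable.re_lt_dist (Z := X)).comp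
      (g := fun p : ℕ × ℕ × ℕ => (p.1.unpair.1, p.2.1.unpair.1, p.2.2)) (by fun_prop)).or
      ((EffectiveMeasurable.re_lt_dist (Z := Y)).comp (g := fun p : ℕ × ℕ × ℕ =>
      (p.1.unpair.2, p.2.1.unpair.2, p.2.2)) (by fun_prop))
  measurable_ball i r := by
    have : {z : X × Y | d (pt i) z < rad r} =
        {x : X | d (pt i.unpair.1) x < rad r} ×ˢ {y : Y | d (pt i.unpair.2) y < rad r} := by
      ext z
      simp [d_prod, pt_prod]
    rw [this]
    exact (EffectiveMeasurable.measurable_ball _ _).prod (EffectiveMeasurable.measurable_ball _ _)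

section
variable {Z : Type*} [BasicMetric Z] [MeasurableSpace Z] [EffectiveMeasurable Z]

/-- Sections of semidecidable sets are measurable. -/
theorem measurableSet_section {A : Type*} [BasicMetric A] {P : A × Z → Prop} (hP : SD P) (a : A) :
    MeasurableSet {z | P (a, z)} := by
  obtain ⟨W, -, h⟩ := sd_iff.1 hP
  have : {z | P (a, z)} = ⋃ (i : ℕ) (r) (_ : W (i, r) ∧ d (pt i.unpair.1) a < rad r),
      {z | d (pt i.unpair.2) z < rad r} := by
    ext z
    simp [h, d_prod, pt_prod, and_assoc]
  rw [this]
  exact MeasurableSet.iUnion fun i => MeasurableSet.iUnion fun r => MeasurableSet.iUnion fun _ =>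
    EffectiveMeasurable.measurable_ball _ r

theorem CMap.measurable_section {A : Type*} [BasicMetric A] [EffectiveMetric A] {f : A × Z → ℝ}
    (hf : CMap f) (a : A) : Measurable fun z => f (a, z) := by
  refine measurable_of_Ioi fun c => ?_
  have : (fun z => f (a, z)) ⁻¹' Set.Ioi c =
      ⋃ (q : ℕ) (_ : c < (ratOf q : ℝ)), {z | (ratOf q : ℝ) < f (a, z)} := by
    ext z
    simp only [Set.mem_preimage, Set.mem_Ioi, Set.mem_iUnion, Set.mem_ofPred_eq, exists_prop]
    exact ⟨exists_ratOf_between, fun ⟨q, h1, h2⟩ => h1.trans h2⟩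
  rw [this]
  refine MeasurableSet.iUnion fun q => MeasurableSet.iUnion fun _ => ?_
  exact measurableSet_section (P := fun p : A × Z => (ratOf q : ℝ) < f p)
    (hf.lsc.lt (q := fun _ => q) (by fun_prop)) a

theorem CMap.measurable {f : Z → ℝ} (hf : CMap f) : Measurable f :=
  CMap.measurable_section (A := Unit) (f := fun p => f p.2) (by fun_prop) ()

variable (Z) in
theorem CMap.dist_pt : CMap fun p : ℕ × Z => d (pt p.1) p.2 := by
  refine cmap_of_lsc_usc ?_ ?_
  · have h : RE fun p : ℕ × ℕ × ℕ × ℕ =>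
        (ratOf (ratAdd p.1 (radIndex p.2.2.2)) : ℝ) < d (pt p.2.1 : Z) (pt p.2.2.1) :=
      (EffectiveMeasurable.re_lt_dist (Z := Z)).comp (g := fun p : ℕ × ℕ × ℕ × ℕ =>
        (p.2.1, p.2.2.1, ratAdd p.1 (radIndex p.2.2.2))) (by fun_prop)
    refine sd_nat_nat_prod.2 ⟨_, h, fun q n z => ?_⟩
    simp only [ratOf_ratAdd, Rat.cast_add, ratOf_radIndex]
    constructor
    · intro h
      obtain ⟨c, t, hc, ht⟩ := exists_ball z (half_pos (sub_pos.2 h))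
      refine ⟨c, t, ?_, hc⟩
      linarith [d_triangle (pt n) (pt c) z]
    · rintro ⟨c, t, h1, h2⟩
      have := d_triangle (pt n) z (pt c)
      rw [d_comm z] at this
      linarith
  · have h : RE fun p : ℕ × ℕ × ℕ × ℕ =>
        d (pt p.2.1 : Z) (pt p.2.2.1) < (ratOf (ratAdd p.1 (ratNeg (radIndex p.2.2.2))) : ℝ) :=
      (re_dist (Z := Z)).comp (g := fun p : ℕ × ℕ × ℕ × ℕ =>
        (p.2.1, p.2.2.1, ratAdd p.1 (ratNeg (radIndex p.2.2.2)))) (by fun_prop)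
    refine sd_nat_nat_prod.2 ⟨_, h, fun q n z => ?_⟩
    simp only [ratOf_ratAdd, ratOf_ratNeg, Rat.cast_neg, Rat.cast_add, ratOf_radIndex]
    constructor
    · intro h
      obtain ⟨c, t, hc, ht⟩ := exists_ball z (half_pos (sub_pos.2 h))
      refine ⟨c, t, ?_, hc⟩
      have := d_triangle (pt n) z (pt c)
      rw [d_comm z] at this
      linarith
    · rintro ⟨c, t, h1, h2⟩
      linarith [d_triangle (pt n) (pt c) z]

theorem bump_eq (c y : Z) {r s : ℝ} (h : r < s) :
    bump c r s y = max 0 (min 1 ((s - d c y) / (s - r))) := by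
  have h0 : 0 < s - r := sub_pos.2 h
  unfold bump
  split_ifs with h1 h2
  · rw [min_eq_left, max_eq_right zero_le_one]
    rw [le_div_iff₀ h0]; linarith
  · rw [min_eq_right, max_eq_right]
    · exact div_nonneg (by linarith) h0.le
    · rw [div_le_one h0]; linarith
  · rw [max_eq_left]
    exact (min_le_right _ _).trans (div_nonpos_of_nonpos_of_nonneg (by linarith) h0.le)

theorem posRatOf_pos (n : ℕ) : (0 : ℝ) < posRatOf n := by
  have : (0 : ℚ≥0) < posRatOf n := by unfold posRatOf; positivity
  exact_mod_cast this

/-- The recursion step in the definition of the basic functions. -/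
def basicStep (Z : Type*) [BasicMetric Z] (k : ℕ) (v : ℕ → ℝ) (y : Z) : ℝ :=
  if k = 0 then 1
  else if (k - 1) % 5 = 0 then
    bump (pt ((k - 1) / 5).unpair.1) (posRatOf ((k - 1) / 5).unpair.2.unpair.1 : ℝ)
      ((posRatOf ((k - 1) / 5).unpair.2.unpair.1 : ℝ) +
        (posRatOf ((k - 1) / 5).unpair.2.unpair.2 : ℝ)) y
  else if (k - 1) % 5 = 1 then
    max (v ((k - 1) / 5).unpair.1) (v ((k - 1) / 5).unpair.2)
  else if (k - 1) % 5 = 2 then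
    min (v ((k - 1) / 5).unpair.1) (v ((k - 1) / 5).unpair.2)
  else if (k - 1) % 5 = 3 then
    v ((k - 1) / 5).unpair.1 + v ((k - 1) / 5).unpair.2
  else (ratOf ((k - 1) / 5).unpair.1 : ℝ) * v ((k - 1) / 5).unpair.2

theorem basicFunction_eq_basicStep (k : ℕ) (y : Z) :
    basicFunction Z k y = basicStep Z k (fun j => basicFunction Z j y) y := by
  cases k with
  | zero => rw [basicFunction]; simp [basicStep]
  | succ n =>
    rw [basicFunction, basicStep, if_neg (Nat.succ_ne_zero n), Nat.add_sub_cancel]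
    split_ifs <;> rfl

theorem abs_ratOf_le (n : ℕ) : |(ratOf n : ℝ)| ≤ n := by
  have ha : (n.unpair.1.unpair.1 : ℝ) ≤ n := by
    exact_mod_cast (Nat.unpair_left_le _).trans (Nat.unpair_left_le _)
  have hb : (n.unpair.1.unpair.2 : ℝ) ≤ n := by
    exact_mod_cast (Nat.unpair_right_le _).trans (Nat.unpair_left_le _)
  have ha0 : (0 : ℝ) ≤ n.unpair.1.unpair.1 := Nat.cast_nonneg _
  have hb0 : (0 : ℝ) ≤ n.unpair.1.unpair.2 := Nat.cast_nonneg _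
  have hc0 : (0 : ℝ) ≤ n.unpair.2 := Nat.cast_nonneg _
  rw [ratOf]
  push_cast
  rw [abs_div, abs_of_pos (by linarith : (0 : ℝ) < (n.unpair.2 : ℝ) + 1)]
  refine (div_le_self (abs_nonneg _) (by linarith)).trans ?_
  rw [abs_le]
  constructor <;> linarith

theorem unpair_fst_lt {k : ℕ} (hk : k ≠ 0) : ((k - 1) / 5).unpair.1 < k :=
  ((Nat.unpair_left_le _).trans (Nat.div_le_self _ 5)).trans_lt (by omega)

theorem unpair_snd_lt {k : ℕ} (hk : k ≠ 0) : ((k - 1) / 5).unpair.2 < k :=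
  ((Nat.unpair_right_le _).trans (Nat.div_le_self _ 5)).trans_lt (by omega)

/-- Maxima and minima do not increase errors, sums double them, and a rational factor has an index
below `k` and hence absolute value at most `i`. The constant `i + 2` covers all cases. -/
theorem abs_basicStep_sub_le {k i : ℕ} (hk : k ≤ i) {v w : ℕ → ℝ} {η : ℝ} (hη : 0 ≤ η)
    (h : ∀ j < k, |v j - w j| ≤ η) (y : Z) :
    |basicStep Z k v y - basicStep Z k w y| ≤ (i + 2) * η := by
  have hi : (0 : ℝ) ≤ i := Nat.cast_nonneg i
  unfold basicStep
  have h1 : η ≤ (i + 2) * η := by nlinarith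
  split_ifs with h0
  · simpa using by positivity
  · simpa using by positivity
  · exact (abs_max_sub_max_le_max _ _ _ _).trans
      ((max_le (h _ (unpair_fst_lt h0)) (h _ (unpair_snd_lt h0))).trans h1)
  · exact (abs_min_sub_min_le_max _ _ _ _).trans
      ((max_le (h _ (unpair_fst_lt h0)) (h _ (unpair_snd_lt h0))).trans h1)
  · have h2 := h _ (unpair_fst_lt h0)
    have h3 := h _ (unpair_snd_lt h0)
    rw [add_sub_add_comm]
    refine (abs_add_le _ _).trans ?_
    nlinarith
  · rw [← mul_sub, abs_mul]
    have h3 := h _ (unpair_snd_lt h0)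
    have h4 := abs_ratOf_le ((k - 1) / 5).unpair.1
    have h5 : ((((k - 1) / 5).unpair.1 : ℕ) : ℝ) ≤ i := by
      exact_mod_cast (unpair_fst_lt h0).le.trans hk
    calc _ ≤ (i : ℝ) * η := mul_le_mul (h4.trans h5) h3 (abs_nonneg _) hi
      _ ≤ _ := by nlinarith

/-- A vector that nearly satisfies the defining recursion is near the solution: each level
multiplies the inherited error by at most `i + 2` and adds `ε`, and the factor `i + 3` absorbs both.
So values of basic functions can be guessed and verified, which avoids a course-of-values recursion.
-/
theorem abs_sub_basicFunction_le {i : ℕ} {ε : ℝ} (hε : 0 ≤ ε) {v : ℕ → ℝ} {y : Z}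
    (h : ∀ k ≤ i, |v k - basicStep Z k v y| ≤ ε) (k : ℕ) (hk : k ≤ i) :
    |v k - basicFunction Z k y| ≤ ε * (i + 3) ^ (k + 1) := by
  have hi : (0 : ℝ) ≤ i := Nat.cast_nonneg i
  induction k using Nat.strong_induction_on with
  | _ k ih =>
    have hp : (1 : ℝ) ≤ (i + 3) ^ k := one_le_pow₀ (by linarith)
    have h1 : ∀ j < k, |v j - basicFunction Z j y| ≤ ε * (i + 3) ^ k := by
      intro j hj
      refine (ih j hj (hj.le.trans hk)).trans ?_
      gcongr
      · linarith
      · omega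
    have h2 := abs_basicStep_sub_le hk (by positivity) h1 y
    rw [← basicFunction_eq_basicStep] at h2
    have h3 := abs_sub_le (v k) (basicStep Z k v y) (basicFunction Z k y)
    have h4 := h k hk
    rw [pow_succ]
    nlinarith

/-- A bound for the basic function of index `k`. -/
def basicBound (k : ℕ) : ℝ := (k + 3) ^ (k + 1)

theorem abs_basicFunction_le (k : ℕ) (y : Z) : |basicFunction Z k y| ≤ basicBound k := by
  -- The zero vector violates each clause of the recursion by at most `1`.
  have h := abs_sub_basicFunction_le (i := k) (ε := 1) zero_le_one (v := fun _ => 0) (y := y) (fun j hj => ?_) k le_rfl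
  · simpa [basicBound] using h
  · unfold basicStep
    split_ifs
    · simp
    · have hr := posRatOf_pos ((j - 1) / 5).unpair.2.unpair.2
      rw [bump_eq _ _ (by linarith), zero_sub, abs_neg, abs_of_nonneg (le_max_left _ _)]
      exact max_le zero_le_one (min_le_left _ _)
    all_goals simp

theorem CMap.basicStep_seqEntry : CMap fun p : ℕ × ℕ × Z =>
    basicStep Z p.1 (fun j => (ratOf (seqEntry p.2.1 j) : ℝ)) p.2.2 := by
  have hd := CMap.dist_pt Z
  have hb : CMap fun p : ℕ × ℕ × Z => bump (pt p.1.unpair.1)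
      (posRatOf p.1.unpair.2.unpair.1 : ℝ) ((posRatOf p.1.unpair.2.unpair.1 : ℝ) +
        (posRatOf p.1.unpair.2.unpair.2 : ℝ)) p.2.2 := by
    have e : ∀ p : ℕ × ℕ × Z, bump (pt p.1.unpair.1)
      (posRatOf p.1.unpair.2.unpair.1 : ℝ) ((posRatOf p.1.unpair.2.unpair.1 : ℝ) +
        (posRatOf p.1.unpair.2.unpair.2 : ℝ)) p.2.2 = max 0 (min 1
        (((posRatOf p.1.unpair.2.unpair.1 : ℝ) + (posRatOf p.1.unpair.2.unpair.2 : ℝ)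
         - d (pt p.1.unpair.1) p.2.2) / (posRatOf p.1.unpair.2.unpair.2 : ℝ))) := by
      intro p
      have := posRatOf_pos p.1.unpair.2.unpair.2
      rw [bump_eq _ _ (by linarith), add_sub_cancel_left]
    refine CMap.of_eq ?_ fun p => (e p).symm
    exact CMap.zero.sup (CMap.inf (by fun_prop) (CMap.div (CMap.sub (by fun_prop)
      (hd.comp (g := fun p : ℕ × ℕ × Z => (p.1.unpair.1, p.2.2)) (by fun_prop))) (by fun_prop)
      fun p => posRatOf_pos _))
  unfold basicStep
  refine ite_nat (by fun_prop) (by fun_prop) (by fun_prop) ?_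
  refine ite_nat (by fun_prop) (by fun_prop)
    (hb.comp (g := fun p : ℕ × ℕ × Z => ((p.1 - 1) / 5, p.2.1, p.2.2)) (by fun_prop)) ?_
  refine ite_nat (by fun_prop) (by fun_prop) (by fun_prop) ?_
  refine ite_nat (by fun_prop) (by fun_prop) (by fun_prop) ?_
  exact ite_nat (by fun_prop) (by fun_prop) (by fun_prop) (by fun_prop)

theorem exists_basicFunction_approx (i : ℕ) (y : Z) {ε : ℝ} (hε : 0 < ε) :
    ∃ V n, (∀ k < i + 1, |(ratOf (seqEntry V k) : ℝ) -
        basicStep Z k (fun j => (ratOf (seqEntry V j) : ℝ)) y| < rad n) ∧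
      (i + 3) ^ (i + 1) * rad n < ε := by
  have hi : (0 : ℝ) ≤ i := Nat.cast_nonneg i
  obtain ⟨n, hn⟩ := exists_rad_lt (show 0 < ε / (i + 3) ^ (i + 1) by positivity)
  have hr := rad_pos n
  -- With errors at most `rad n / (i + 4)`, the defect in the recursion is at most `(i + 3) / (i +
  -- 4) * rad n`, which is strictly below `rad n`.
  choose s hs using fun k => exists_ratOf_between
    (show basicFunction Z k y < basicFunction Z k y + rad n / (i + 4) by
      have : 0 < rad n / (i + 4) := by positivity
      linarith)
  obtain ⟨V, hV⟩ := exists_seqEntry s (i + 1)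
  refine ⟨V, n, fun k hk => ?_, by rwa [lt_div_iff₀ (by positivity), mul_comm] at hn⟩
  have h1 : ∀ j < i + 1, |(ratOf (seqEntry V j) : ℝ) - basicFunction Z j y| ≤ rad n / (i + 4) := by
    intro j hj
    rw [hV j hj, abs_le]
    have : 0 < rad n / (i + 4) := by positivity
    constructor <;> linarith [(hs j).1, (hs j).2]
  have h2 := abs_basicStep_sub_le (Nat.lt_succ_iff.1 hk) (by positivity)
    (fun j hj => h1 j (hj.trans hk)) y
  rw [← basicFunction_eq_basicStep] at h2
  have h3 := abs_sub_le (ratOf (seqEntry V k) : ℝ) (basicFunction Z k y)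
    (basicStep Z k (fun j => (ratOf (seqEntry V j) : ℝ)) y)
  rw [abs_sub_comm (basicFunction Z k y)] at h3
  have h4 := h1 k hk
  have h5 : rad n / (i + 4) * (i + 4) = rad n := by field_simp
  have h6 : 0 < rad n / (i + 4) := by positivity
  nlinarith

variable (Z) in
-- Search for a rational vector `V` that passes the test with defect below `rad n`; its entry `i` is
-- then correct up to `(i + 3) ^ (i + 1) * rad n`. `exists_basicFunction_approx` guarantees success.
theorem CMap.basicFunction_aux : CMap fun p : ℕ × Z => basicFunction Z p.1 p.2 := by
  have hstep := CMap.basicStep_seqEntry (Z := Z)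
  have hrad : CMap fun n : ℕ => rad n :=
    CMap.of_eq (f := fun n : ℕ => (ratOf (radIndex n) : ℝ)) (by fun_prop)
      fun n => ratOf_radIndex n
  have hC : SD fun p : ℕ × ℕ × ℕ × ℕ × Z => ∀ k < p.2.2.2.1 + 1, |(ratOf (seqEntry p.2.1 k) : ℝ) -
        basicStep Z k (fun j => (ratOf (seqEntry p.2.1 j) : ℝ)) p.2.2.2.2| < rad p.1 := by
    refine SD.all_lt (P := fun p : ℕ × ℕ × ℕ × ℕ × ℕ × Z => |(ratOf (seqEntry p.2.2.1 p.1) : ℝ) -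
        basicStep Z p.1 (fun j => (ratOf (seqEntry p.2.2.1 j) : ℝ)) p.2.2.2.2.2| < rad p.2.1)
        ?_ (by fun_prop)
    refine SD.real_lt (CMap.usc ?_) (CMap.lsc (hrad.comp (by fun_prop)))
    exact CMap.abs (CMap.sub (by fun_prop) (hstep.comp
      (g := fun p : ℕ × ℕ × ℕ × ℕ × ℕ × Z => (p.1, p.2.2.1, p.2.2.2.2.2)) (by fun_prop)))
  have herr : CMap fun p : ℕ × ℕ × ℕ × ℕ × Z => ((p.2.2.2.1 : ℝ) + 3) ^ (p.2.2.2.1 + 1) * rad p.1 := by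
    have := hrad.comp (g := fun p : ℕ × ℕ × ℕ × ℕ × Z => p.1) (by fun_prop)
    fun_prop
  have sound : ∀ V n i (y : Z), (∀ k < i + 1, |(ratOf (seqEntry V k) : ℝ) -
        basicStep Z k (fun j => (ratOf (seqEntry V j) : ℝ)) y| < rad n) →
      |(ratOf (seqEntry V i) : ℝ) - basicFunction Z i y| ≤ (i + 3) ^ (i + 1) * rad n := by
    intro V n i y h
    have := abs_sub_basicFunction_le (rad_pos n).le
      (v := fun j => (ratOf (seqEntry V j) : ℝ)) (fun k hk => (h k (by omega)).le) i le_rfl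
    rwa [mul_comm]
  refine cmap_of_lsc_usc ?_ ?_
  · have : SD fun p : ℕ × ℕ × Z => ∃ V n, (∀ k < p.2.1 + 1, |(ratOf (seqEntry V k) : ℝ) -
        basicStep Z k (fun j => (ratOf (seqEntry V j) : ℝ)) p.2.2| < rad n) ∧
        (ratOf p.1 : ℝ) < ratOf (seqEntry V p.2.1) - ((p.2.1 : ℝ) + 3) ^ (p.2.1 + 1) * rad n := by
      refine SD.exists_nat (P := fun p : ℕ × ℕ × ℕ × Z => ∃ n, (∀ k < p.2.2.1 + 1, |(ratOf (seqEntry p.1 k) : ℝ) -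
        basicStep Z k (fun j => (ratOf (seqEntry p.1 j) : ℝ)) p.2.2.2| < rad n) ∧
        (ratOf p.2.1 : ℝ) < ratOf (seqEntry p.1 p.2.2.1) - ((p.2.2.1 : ℝ) + 3) ^ (p.2.2.1 + 1) * rad n) ?_
      refine SD.exists_nat (P := fun p : ℕ × ℕ × ℕ × ℕ × Z => (∀ k < p.2.2.2.1 + 1, |(ratOf (seqEntry p.2.1 k) : ℝ) -
        basicStep Z k (fun j => (ratOf (seqEntry p.2.1 j) : ℝ)) p.2.2.2.2| < rad p.1) ∧
        (ratOf p.2.2.1 : ℝ) < ratOf (seqEntry p.2.1 p.2.2.2.1) - ((p.2.2.2.1 : ℝ) + 3) ^ (p.2.2.2.1 + 1) * rad p.1) ?_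
      exact hC.and (SD.real_lt (CMap.usc (by fun_prop)) (CMap.lsc (by fun_prop)))
    refine this.congr ?_
    rintro ⟨q, i, y⟩
    constructor
    · intro h
      dsimp only at h
      obtain ⟨V, n, h1, h2⟩ := exists_basicFunction_approx i y (half_pos (sub_pos.2 h))
      refine ⟨V, n, h1, ?_⟩
      have := abs_le.1 (sound V n i y h1)
      dsimp only
      linarith
    · rintro ⟨V, n, h1, h2⟩
      have := abs_le.1 (sound V n i y h1)
      dsimp only at h2 ⊢
      linarith
  · have : SD fun p : ℕ × ℕ × Z => ∃ V n, (∀ k < p.2.1 + 1, |(ratOf (seqEntry V k) : ℝ) -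
        basicStep Z k (fun j => (ratOf (seqEntry V j) : ℝ)) p.2.2| < rad n) ∧
        ratOf (seqEntry V p.2.1) + ((p.2.1 : ℝ) + 3) ^ (p.2.1 + 1) * rad n < (ratOf p.1 : ℝ) := by
      refine SD.exists_nat (P := fun p : ℕ × ℕ × ℕ × Z => ∃ n, (∀ k < p.2.2.1 + 1, |(ratOf (seqEntry p.1 k) : ℝ) -
        basicStep Z k (fun j => (ratOf (seqEntry p.1 j) : ℝ)) p.2.2.2| < rad n) ∧
        ratOf (seqEntry p.1 p.2.2.1) + ((p.2.2.1 : ℝ) + 3) ^ (p.2.2.1 + 1) * rad n < (ratOf p.2.1 : ℝ)) ?_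
      refine SD.exists_nat (P := fun p : ℕ × ℕ × ℕ × ℕ × Z => (∀ k < p.2.2.2.1 + 1, |(ratOf (seqEntry p.2.1 k) : ℝ) -
        basicStep Z k (fun j => (ratOf (seqEntry p.2.1 j) : ℝ)) p.2.2.2.2| < rad p.1) ∧
        ratOf (seqEntry p.2.1 p.2.2.2.1) + ((p.2.2.2.1 : ℝ) + 3) ^ (p.2.2.2.1 + 1) * rad p.1 < (ratOf p.2.2.1 : ℝ)) ?_
      exact hC.and (SD.real_lt (CMap.usc (by fun_prop)) (CMap.lsc (by fun_prop)))
    refine this.congr ?_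
    rintro ⟨q, i, y⟩
    constructor
    · intro h
      dsimp only at h
      obtain ⟨V, n, h1, h2⟩ := exists_basicFunction_approx i y (half_pos (sub_pos.2 h))
      refine ⟨V, n, h1, ?_⟩
      have := abs_le.1 (sound V n i y h1)
      dsimp only
      linarith
    · rintro ⟨V, n, h1, h2⟩
      have := abs_le.1 (sound V n i y h1)
      dsimp only at h2 ⊢
      linarith

@[fun_prop] theorem CMap.fun_basicFunction {A : Type*} [BasicMetric A] [EffectiveMetric A] {i : A → ℕ}
    {y : A → Z} (hi : CMap i) (hy : CMap y) : CMap fun a => basicFunction Z (i a) (y a) :=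
  (CMap.basicFunction_aux Z).comp (hi.pair hy)

@[fun_prop] theorem CMap.fun_basicBound {A : Type*} [BasicMetric A] [EffectiveMetric A] {i : A → ℕ}
    (hi : CMap i) : CMap fun a => basicBound (i a) := by
  unfold basicBound; fun_prop

theorem measurable_basicFunction (i : ℕ) : Measurable (basicFunction Z i) :=
  CMap.measurable (f := fun z => basicFunction Z i z) (by fun_prop)

theorem integrable_basicFunction (i : ℕ) (μ : Measure Z) [IsFiniteMeasure μ] :
    Integrable (basicFunction Z i) μ :=
  Integrable.of_bound (measurable_basicFunction i).aestronglyMeasurable (basicBound i)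
    (ae_of_all _ fun z => abs_basicFunction_le i z)

end

/-! ### Spaces of measures -/

/-- Truncation at `0` is needed since a negative base could have a large even power. -/
theorem pow_le_exp_neg (x : ℝ) (n : ℕ) :
    (max 0 (1 - x / (n + 1))) ^ (n + 1) ≤ Real.exp (-x) := by
  have h1 : max 0 (1 - x / (n + 1)) ≤ Real.exp (-(x / (n + 1))) :=
    max_le (Real.exp_pos _).le (by linarith [Real.add_one_le_exp (-(x / (n + 1)))])
  calc _ ≤ Real.exp (-(x / (n + 1))) ^ (n + 1) := by gcongr
    _ = Real.exp (-x) := by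
      rw [← Real.exp_nat_mul]
      congr 1
      push_cast
      field_simp

theorem exp_neg_le_inv_pow {x : ℝ} (hx : 0 ≤ x) (n : ℕ) :
    Real.exp (-x) ≤ ((1 + x / (n + 1)) ^ (n + 1))⁻¹ := by
  have h2 : 0 ≤ x / (n + 1) := by positivity
  have h1 : 1 + x / (n + 1) ≤ Real.exp (x / (n + 1)) := by
    linarith [Real.add_one_le_exp (x / (n + 1))]
  rw [Real.exp_neg]
  refine inv_anti₀ (by positivity) ?_
  calc _ ≤ Real.exp (x / (n + 1)) ^ (n + 1) := by gcongr
    _ = Real.exp x := by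
      rw [← Real.exp_nat_mul]
      congr 1
      push_cast
      field_simp

section
variable {A : Type*} [BasicMetric A] [EffectiveMetric A]

-- With `x = |f a|`, the limits of `(1 - x / n) ^ n` and of `((1 + x / n) ^ n)⁻¹` approach `exp
-- (-x)` from below and from above.
@[fun_prop] theorem CMap.exp_neg_abs {f : A → ℝ} (hf : CMap f) :
    CMap fun a => Real.exp (-|f a|) := by
  have hn : CMap fun p : ℕ × A => ((p.1 : ℝ) + 1)⁻¹ :=
    CMap.inv (by fun_prop) fun p => by positivity
  refine cmap_of_lsc_usc ?_ ?_
  · refine LSC.iSup_iff (u := fun n a => (max 0 (1 - |f a| / (n + 1))) ^ (n + 1))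
      (CMap.lsc ?_) fun a q => ⟨fun h => ?_, fun ⟨n, hn⟩ => ?_⟩
    · simp only [div_eq_mul_inv]
      fun_prop
    · have h1 := (tendsto_add_atTop_iff_nat 1).2 (Real.tendsto_one_add_div_pow_exp (-|f a|))
      obtain ⟨n, hn⟩ := (h1.eventually_const_lt h).exists
      obtain ⟨m, hm⟩ := exists_nat_ge |f a|
      obtain ⟨n, hn, hnm⟩ := ((h1.eventually_const_lt h).and (eventually_ge_atTop m)).exists
      refine ⟨n, hn.trans_le ?_⟩
      have h2 : |f a| / (n + 1) ≤ 1 := by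
        rw [div_le_one (by positivity)]
        have : (m : ℝ) ≤ n := by exact_mod_cast hnm
        linarith
      have h3 : 1 + -|f a| / ((n + 1 : ℕ) : ℝ) = 1 - |f a| / (n + 1) := by
        push_cast
        ring
      rw [h3]
      refine pow_le_pow_left₀ (by linarith) (le_max_right _ _) _
    · exact hn.trans_le (pow_le_exp_neg _ n)
  · refine USC.iInf_iff (u := fun n a => ((1 + |f a| / (n + 1)) ^ (n + 1))⁻¹)
      (CMap.usc (CMap.inv ?_ fun p => by positivity)) fun a q => ⟨fun h => ?_, fun ⟨n, hn⟩ => ?_⟩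
    · simp only [div_eq_mul_inv]
      fun_prop
    · have h1 := (tendsto_add_atTop_iff_nat 1).2 (Real.tendsto_one_add_div_pow_exp (|f a|))
      have h2 := h1.inv₀ (Real.exp_pos _).ne'
      rw [← Real.exp_neg] at h2
      obtain ⟨n, hn⟩ := (h2.eventually_lt_const h).exists
      exact ⟨n, by simpa using hn⟩
    · exact (exp_neg_le_inv_pow (abs_nonneg _) n).trans_lt hn

theorem SD.re_nat {P : ℕ → Prop} (hP : SD P) : RE P := by
  obtain ⟨W, hW, h⟩ := sd_iff.1 hP
  refine (RE.exists_nat (p := fun q : ℕ × ℕ => W q) hW).congr fun n => ?_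
  rw [h]
  simp only [pt_nat, d_nat_lt_rad]
  constructor
  · rintro ⟨i, r, hi, rfl⟩
    exact ⟨r, hi⟩
  · rintro ⟨r, hi⟩
    exact ⟨n, r, hi, rfl⟩

theorem CMap.fun_rad {n : A → ℕ} (hn : CMap n) : CMap fun a => rad (n a) :=
  CMap.of_eq (f := fun a => (ratOf (radIndex (n a)) : ℝ)) (by fun_prop) fun _ => ratOf_radIndex _

attribute [fun_prop] CMap.fun_rad

instance : CPt (2⁻¹ : ℝ) := by
  have h : CPt ((pt (ratMk 1 0 1) : ℝ)) := inferInstance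
  rw [pt_real, ratOf_ratMk] at h
  norm_num at h
  rwa [one_div] at h
end

/-! ### The distance of measures and integrals of basic functions. -/

section
variable {Z : Type*} [BasicMetric Z] [MeasurableSpace Z]

/-- The summands of the distance of two measures. -/
def measureDistTerm (μ ν : Measure Z) (i : ℕ) : ℝ :=
  (2 : ℝ)⁻¹ ^ i *
    (1 - Real.exp (-|∫ x, basicFunction Z i x ∂μ - ∫ x, basicFunction Z i x ∂ν|))

theorem measureDistTerm_nonneg (μ ν : Measure Z) (i : ℕ) : 0 ≤ measureDistTerm μ ν i := by
  unfold measureDistTerm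
  have : Real.exp (-|∫ x, basicFunction Z i x ∂μ - ∫ x, basicFunction Z i x ∂ν|) ≤ 1 := by
    rw [Real.exp_le_one_iff]; simp
  have h2 : 0 ≤ 1 - Real.exp (-|∫ x, basicFunction Z i x ∂μ - ∫ x, basicFunction Z i x ∂ν|) := by
    linarith
  positivity

theorem measureDistTerm_le (μ ν : Measure Z) (i : ℕ) : measureDistTerm μ ν i ≤ (2 : ℝ)⁻¹ ^ i := by
  unfold measureDistTerm
  have := Real.exp_pos (-|∫ x, basicFunction Z i x ∂μ - ∫ x, basicFunction Z i x ∂ν|)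
  have h2 : (0 : ℝ) < 2⁻¹ ^ i := by positivity
  nlinarith

theorem summable_measureDistTerm (μ ν : Measure Z) : Summable (measureDistTerm μ ν) :=
  Summable.of_nonneg_of_le (measureDistTerm_nonneg μ ν) (measureDistTerm_le μ ν)
    (summable_geometric_of_lt_one (by norm_num) (by norm_num))

theorem measureDist_eq_tsum (μ ν : Measure Z) : measureDist μ ν = ∑' i, measureDistTerm μ ν i := rfl

theorem sum_le_measureDist (μ ν : Measure Z) (N : ℕ) :
    ∑ i ∈ Finset.range N, measureDistTerm μ ν i ≤ measureDist μ ν :=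
  (summable_measureDistTerm μ ν).sum_le_tsum _ fun i _ => measureDistTerm_nonneg μ ν i

theorem measureDist_le_sum (μ ν : Measure Z) (N : ℕ) :
    measureDist μ ν ≤ ∑ i ∈ Finset.range N, measureDistTerm μ ν i + 2 * 2⁻¹ ^ N := by
  rw [measureDist_eq_tsum, ← (summable_measureDistTerm μ ν).sum_add_tsum_nat_add N]
  gcongr
  have hs : Summable fun i : ℕ => (2 : ℝ)⁻¹ ^ (i + N) :=
    (summable_nat_add_iff N).2 (summable_geometric_of_lt_one (by norm_num) (by norm_num))
  refine ((summable_nat_add_iff N).2 (summable_measureDistTerm μ ν)).tsum_le_tsum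
    (fun i => measureDistTerm_le μ ν (i + N)) hs |>.trans ?_
  simp only [pow_add]
  rw [tsum_mul_right, tsum_geometric_inv_two]

theorem measureDist_self (μ : Measure Z) : measureDist μ μ = 0 := by simp [measureDist]

theorem measureDist_comm (μ ν : Measure Z) : measureDist μ ν = measureDist ν μ := by
  simp only [measureDist, abs_sub_comm]

theorem measureDist_triangle (μ ν ρ : Measure Z) :
    measureDist μ ρ ≤ measureDist μ ν + measureDist ν ρ := by
  simp only [measureDist_eq_tsum]
  rw [← (summable_measureDistTerm μ ν).tsum_add (summable_measureDistTerm ν ρ)]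
  refine (summable_measureDistTerm μ ρ).tsum_le_tsum (fun i => ?_)
    ((summable_measureDistTerm μ ν).add (summable_measureDistTerm ν ρ))
  unfold measureDistTerm
  rw [← mul_add]
  gcongr
  set a := ∫ x, basicFunction Z i x ∂μ
  set b := ∫ x, basicFunction Z i x ∂ν
  set c := ∫ x, basicFunction Z i x ∂ρ
  have h1 : Real.exp (-|a - b|) * Real.exp (-|b - c|) ≤ Real.exp (-|a - c|) := by
    rw [← Real.exp_add, Real.exp_le_exp]
    linarith [abs_sub_le a b c]
  have h2 : Real.exp (-|a - b|) ≤ 1 := by rw [Real.exp_le_one_iff]; simp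
  have h3 : Real.exp (-|b - c|) ≤ 1 := by rw [Real.exp_le_one_iff]; simp
  nlinarith

/-- The term `i` of the distance bounds `1 - exp (-c)` by `2 ^ i * r`. If `c ≥ rad k`, then `1 - exp
(-c) ≥ 1 - 1 / (1 + rad k) = rad (k + 1)`. -/
theorem abs_integral_sub_lt_of_measureDist_lt {μ ν : Measure Z} {i k : ℕ} {r : ℝ}
    (h : measureDist μ ν < r) (hr : 2 ^ i * r < rad (k + 1)) :
    |∫ x, basicFunction Z i x ∂μ - ∫ x, basicFunction Z i x ∂ν| < rad k := by
  have h1 : measureDistTerm μ ν i ≤ measureDist μ ν :=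
    (summable_measureDistTerm μ ν).le_tsum i fun j _ => measureDistTerm_nonneg μ ν j
  set c := |∫ x, basicFunction Z i x ∂μ - ∫ x, basicFunction Z i x ∂ν| with hc
  have h2 : (2 : ℝ)⁻¹ ^ i * (1 - Real.exp (-c)) < r := lt_of_le_of_lt h1 h
  have h3 : 1 - Real.exp (-c) < rad (k + 1) := by
    refine lt_of_le_of_lt ?_ hr
    have : (2 : ℝ) ^ i * ((2 : ℝ)⁻¹ ^ i * (1 - Real.exp (-c))) = 1 - Real.exp (-c) := by
      rw [← mul_assoc, ← mul_pow]; simp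
    rw [← this]
    gcongr
  by_contra! h4
  have h5 : Real.exp (-c) ≤ (1 + rad k)⁻¹ := by
    rw [Real.exp_neg]
    have := rad_pos k
    refine inv_anti₀ (by positivity) ?_
    linarith [Real.add_one_le_exp c]
  have h6 : (1 + rad k)⁻¹ = 1 - rad (k + 1) := by
    unfold rad
    push_cast
    field_simp
    ring
  linarith

/-- An effective space of measures: a space whose points are measures (by means of the map `m`),
with the distance of measures and with a dense sequence of basic measures such that the integrals
of the basic functions against them are computable. -/
structure IsMeasureModel {M : Type*} [BasicMetric M] (m : M → Measure Z) : Prop where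
  d_eq : ∀ a b, d a b = measureDist (m a) (m b)
  cmap_pt : CMap fun p : ℕ × ℕ => ∫ x, basicFunction Z p.1 x ∂(m (pt p.2))
  dense : ∀ a, ∃ s : ℕ → ℕ, ∀ i, Tendsto (fun k => ∫ x, basicFunction Z i x ∂(m (pt (s k)))) atTop
    (𝓝 (∫ x, basicFunction Z i x ∂(m a)))

/-- Partial sums plus the geometric remainder are computable upper bounds. Upper bounds suffice,
because membership in open balls and the laws of `EffectiveMetric` ask for nothing more. -/
theorem USC.measureDist {A : Type*} [BasicMetric A] [EffectiveMetric A] {μ ν : A → Measure Z}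
    (hμ : CMap fun p : ℕ × A => ∫ x, basicFunction Z p.1 x ∂(μ p.2))
    (hν : CMap fun p : ℕ × A => ∫ x, basicFunction Z p.1 x ∂(ν p.2)) :
    USC fun a => measureDist (μ a) (ν a) := by
  refine USC.iInf_iff (u := fun N a => ∑ i ∈ Finset.range N, measureDistTerm (μ a) (ν a) i +
    2 * 2⁻¹ ^ N) (CMap.usc ?_) fun a q => ⟨fun h => ?_, fun ⟨n, hn⟩ => ?_⟩
  · have h1 : CMap fun p : ℕ × A => measureDistTerm (μ p.2) (ν p.2) p.1 := by
      unfold measureDistTerm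
      fun_prop
    have h2 : CMap fun p : ℕ × ℕ × A => measureDistTerm (μ p.2.2) (ν p.2.2) p.1 :=
      h1.comp (g := fun p : ℕ × ℕ × A => (p.1, p.2.2)) (by fun_prop)
    have h3 : CMap fun p : ℕ × A => ∑ i ∈ Finset.range p.1, measureDistTerm (μ p.2) (ν p.2) i :=
      CMap.sum (f := fun i (p : ℕ × A) => measureDistTerm (μ p.2) (ν p.2) i) h2 (by fun_prop)
    fun_prop
  · obtain ⟨N, hN⟩ := exists_pow_lt_of_lt_one (half_pos (sub_pos.2 h)) (y := (2 : ℝ)⁻¹)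
      (by norm_num)
    exact ⟨N, by linarith [sum_le_measureDist (μ a) (ν a) N]⟩
  · exact (measureDist_le_sum _ _ _).trans_lt hn

namespace IsMeasureModel
variable {M : Type*} [BasicMetric M] {m : M → Measure Z} (hm : IsMeasureModel m)
include hm

theorem effectiveMetric : EffectiveMetric M where
  d_self a := by rw [hm.d_eq, measureDist_self]
  d_comm a b := by rw [hm.d_eq, hm.d_eq, measureDist_comm]
  d_triangle a b c := by rw [hm.d_eq, hm.d_eq, hm.d_eq]; exact measureDist_triangle _ _ _
  dense a ε hε := by
    obtain ⟨s, hs⟩ := hm.dense a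
    -- The remainder `2 * 2⁻¹ ^ N` is below `ε / 2`, and the finitely many remaining terms tend to
    -- `0`.
    obtain ⟨N, hN⟩ := exists_pow_lt_of_lt_one (show 0 < ε / 4 by linarith) (y := (2 : ℝ)⁻¹)
      (by norm_num)
    have h1 : Tendsto (fun k => ∑ i ∈ Finset.range N, measureDistTerm (m (pt (s k))) (m a) i) atTop
        (𝓝 (∑ i ∈ Finset.range N, measureDistTerm (m a) (m a) i)) := by
      refine tendsto_finsetSum _ fun i _ => ?_
      have : Continuous fun t : ℝ => (2 : ℝ)⁻¹ ^ i *
          (1 - Real.exp (-|t - ∫ x, basicFunction Z i x ∂(m a)|)) := by fun_prop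
      exact (this.tendsto _).comp (hs i)
    have h2 : ∑ i ∈ Finset.range N, measureDistTerm (m a) (m a) i = 0 :=
      Finset.sum_eq_zero fun i _ => by simp [measureDistTerm]
    rw [h2] at h1
    obtain ⟨k, hk⟩ := (h1.eventually_lt_const (half_pos hε)).exists
    refine ⟨s k, ?_⟩
    rw [hm.d_eq]
    linarith [measureDist_le_sum (m (pt (s k))) (m a) N]
  re_dist := by
    have h1 : CMap fun p : ℕ × ℕ × ℕ => ∫ x, basicFunction Z p.1 x ∂(m (pt p.2.1)) :=
      hm.cmap_pt.comp (g := fun p : ℕ × ℕ × ℕ => (p.1, p.2.1)) (by fun_prop)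
    have h2 : CMap fun p : ℕ × ℕ × ℕ => ∫ x, basicFunction Z p.1 x ∂(m (pt p.2.2)) :=
      hm.cmap_pt.comp (g := fun p : ℕ × ℕ × ℕ => (p.1, p.2.2)) (by fun_prop)
    have h3 : USC fun p : ℕ × ℕ => measureDist (m (pt p.1)) (m (pt p.2)) := USC.measureDist h1 h2
    have h4 : SD fun n : ℕ => measureDist (m (pt n.unpair.1)) (m (pt n.unpair.2.unpair.1)) <
        (ratOf n.unpair.2.unpair.2 : ℝ) :=
      USC.lt (f := fun n : ℕ => measureDist (m (pt n.unpair.1)) (m (pt n.unpair.2.unpair.1)))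
        (h3.comp (q := fun n : ℕ => (n.unpair.1, n.unpair.2.unpair.1)) (by fun_prop)) (by fun_prop)
    refine (h4.re_nat.comp (g := fun p : ℕ × ℕ × ℕ => Nat.pair p.1 (Nat.pair p.2.1 p.2.2))
      (by fun_prop)).congr fun p => ?_
    simp [hm.d_eq]

/-- The integrals determine upper bounds for the distances to basic measures. With the converse
`cmap_integral`, computing a measure amounts to computing its integrals of basic functions. -/
theorem cmap_of {A : Type*} [BasicMetric A] [EffectiveMetric A] {f : A → M}
    (hf : CMap fun p : ℕ × A => ∫ x, basicFunction Z p.1 x ∂(m (f p.2))) : CMap f := by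
  refine cmap_iff_sd.2 ?_
  simp only [hm.d_eq]
  have h1 : CMap fun p : ℕ × ℕ × ℕ × A => ∫ x, basicFunction Z p.1 x ∂(m (pt p.2.1)) :=
    hm.cmap_pt.comp (g := fun p : ℕ × ℕ × ℕ × A => (p.1, p.2.1)) (by fun_prop)
  have h2 : CMap fun p : ℕ × ℕ × ℕ × A => ∫ x, basicFunction Z p.1 x ∂(m (f p.2.2.2)) :=
    hf.comp (g := fun p : ℕ × ℕ × ℕ × A => (p.1, p.2.2.2)) (by fun_prop)
  exact SD.real_lt (USC.measureDist (A := ℕ × ℕ × A) h1 h2) (CMap.lsc (by fun_prop))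

/-- The integral is read off at a basic measure so near that the error is below `rad k`. -/
theorem cmap_integral : CMap fun p : ℕ × M => ∫ x, basicFunction Z p.1 x ∂(m p.2) := by
  have := hm.effectiveMetric
  have hball : SD fun p : ℕ × ℕ × M => d (pt p.1) p.2.2 < rad p.2.1 :=
    cmap_iff_sd.1 (CMap.id (Z := M))
  have hpt : CMap fun p : ℕ × ℕ × ℕ × ℕ × ℕ × M => ∫ x, basicFunction Z p.2.2.2.2.1 x ∂(m (pt p.2.2.1)) :=
    hm.cmap_pt.comp (g := fun p : ℕ × ℕ × ℕ × ℕ × ℕ × M => (p.2.2.2.2.1, p.2.2.1)) (by fun_prop)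
  have hcond : SD fun p : ℕ × ℕ × ℕ × ℕ × ℕ × M => d (pt p.2.2.1) p.2.2.2.2.2 < rad p.2.1 ∧
      2 ^ p.2.2.2.2.1 * rad p.2.1 < rad (p.1 + 1) := by
    refine SD.and (hball.comp (f := fun p : ℕ × ℕ × ℕ × ℕ × ℕ × M => (p.2.2.1, p.2.1, p.2.2.2.2.2))
      (by fun_prop)) (SD.real_lt (CMap.usc (by fun_prop)) (CMap.lsc (by fun_prop)))
  have complete : ∀ (i : ℕ) (a : M) (ε : ℝ), 0 < ε → ∃ n r k, d (pt n) a < rad r ∧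
      2 ^ i * rad r < rad (k + 1) ∧ rad k < ε := by
    intro i a ε hε
    obtain ⟨k, hk⟩ := exists_rad_lt hε
    obtain ⟨r, hr⟩ := exists_rad_lt (div_pos (rad_pos (k + 1)) (by positivity : (0 : ℝ) < 2 ^ i))
    obtain ⟨n, hn⟩ := EffectiveMetric.dense a _ (rad_pos r)
    refine ⟨n, r, k, hn, ?_, hk⟩
    rwa [lt_div_iff₀ (by positivity), mul_comm] at hr
  refine cmap_of_lsc_usc ?_ ?_
  · have : SD fun p : ℕ × ℕ × M => ∃ n r k, (d (pt n) p.2.2 < rad r ∧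
        2 ^ p.2.1 * rad r < rad (k + 1)) ∧
        (ratOf p.1 : ℝ) + rad k < ∫ x, basicFunction Z p.2.1 x ∂(m (pt n)) := by
      refine SD.exists_nat (P := fun p : ℕ × ℕ × ℕ × M => ∃ r k, (d (pt p.1) p.2.2.2 < rad r ∧
        2 ^ p.2.2.1 * rad r < rad (k + 1)) ∧
        (ratOf p.2.1 : ℝ) + rad k < ∫ x, basicFunction Z p.2.2.1 x ∂(m (pt p.1))) ?_
      refine SD.exists_nat (P := fun p : ℕ × ℕ × ℕ × ℕ × M => ∃ k, (d (pt p.2.1) p.2.2.2.2 < rad p.1 ∧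
        2 ^ p.2.2.2.1 * rad p.1 < rad (k + 1)) ∧
        (ratOf p.2.2.1 : ℝ) + rad k < ∫ x, basicFunction Z p.2.2.2.1 x ∂(m (pt p.2.1))) ?_
      refine SD.exists_nat (P := fun p : ℕ × ℕ × ℕ × ℕ × ℕ × M => (d (pt p.2.2.1) p.2.2.2.2.2 < rad p.2.1 ∧
        2 ^ p.2.2.2.2.1 * rad p.2.1 < rad (p.1 + 1)) ∧
        (ratOf p.2.2.2.1 : ℝ) + rad p.1 < ∫ x, basicFunction Z p.2.2.2.2.1 x ∂(m (pt p.2.2.1))) ?_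
      exact hcond.and (SD.real_lt (CMap.usc (by fun_prop)) hpt.lsc)
    refine this.congr ?_
    rintro ⟨q, i, a⟩
    constructor
    · intro h
      dsimp only at h
      obtain ⟨n, r, k, h1, h2, h3⟩ := complete i a _ (half_pos (sub_pos.2 h))
      refine ⟨n, r, k, ⟨h1, h2⟩, ?_⟩
      rw [hm.d_eq] at h1
      have := (abs_lt.1 (abs_integral_sub_lt_of_measureDist_lt h1 h2)).1
      dsimp only
      linarith
    · rintro ⟨n, r, k, ⟨h1, h2⟩, h3⟩
      rw [hm.d_eq] at h1
      have := (abs_lt.1 (abs_integral_sub_lt_of_measureDist_lt h1 h2)).2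
      dsimp only at h3 ⊢
      linarith
  · have : SD fun p : ℕ × ℕ × M => ∃ n r k, (d (pt n) p.2.2 < rad r ∧
        2 ^ p.2.1 * rad r < rad (k + 1)) ∧
        ∫ x, basicFunction Z p.2.1 x ∂(m (pt n)) + rad k < (ratOf p.1 : ℝ) := by
      refine SD.exists_nat (P := fun p : ℕ × ℕ × ℕ × M => ∃ r k, (d (pt p.1) p.2.2.2 < rad r ∧
        2 ^ p.2.2.1 * rad r < rad (k + 1)) ∧
        ∫ x, basicFunction Z p.2.2.1 x ∂(m (pt p.1)) + rad k < (ratOf p.2.1 : ℝ)) ?_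
      refine SD.exists_nat (P := fun p : ℕ × ℕ × ℕ × ℕ × M => ∃ k, (d (pt p.2.1) p.2.2.2.2 < rad p.1 ∧
        2 ^ p.2.2.2.1 * rad p.1 < rad (k + 1)) ∧
        ∫ x, basicFunction Z p.2.2.2.1 x ∂(m (pt p.2.1)) + rad k < (ratOf p.2.2.1 : ℝ)) ?_
      refine SD.exists_nat (P := fun p : ℕ × ℕ × ℕ × ℕ × ℕ × M => (d (pt p.2.2.1) p.2.2.2.2.2 < rad p.2.1 ∧
        2 ^ p.2.2.2.2.1 * rad p.2.1 < rad (p.1 + 1)) ∧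
        ∫ x, basicFunction Z p.2.2.2.2.1 x ∂(m (pt p.2.2.1)) + rad p.1 < (ratOf p.2.2.2.1 : ℝ)) ?_
      exact hcond.and (SD.real_lt (CMap.usc (by fun_prop)) (CMap.lsc (by fun_prop)))
    refine this.congr ?_
    rintro ⟨q, i, a⟩
    constructor
    · intro h
      dsimp only at h
      obtain ⟨n, r, k, h1, h2, h3⟩ := complete i a _ (half_pos (sub_pos.2 h))
      refine ⟨n, r, k, ⟨h1, h2⟩, ?_⟩
      rw [hm.d_eq] at h1
      have := (abs_lt.1 (abs_integral_sub_lt_of_measureDist_lt h1 h2)).2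
      dsimp only
      linarith
    · rintro ⟨n, r, k, ⟨h1, h2⟩, h3⟩
      rw [hm.d_eq] at h1
      have := (abs_lt.1 (abs_integral_sub_lt_of_measureDist_lt h1 h2)).1
      dsimp only at h3 ⊢
      linarith

end IsMeasureModel
end

section
variable {Z : Type*} [BasicMetric Z] [MeasurableSpace Z] [EffectiveMeasurable Z]

/-! ### Basic measures -/

theorem integral_listSum {f : Z → ℝ} (hf : Measurable f) {C : ℝ} (hC : ∀ z, |f z| ≤ C)
    (L : List ℕ) :
    ∫ z, f z ∂((L.map fun c => (posRatOf c.unpair.1 : ℝ≥0) •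
      (diracProba (pt c.unpair.2 : Z)).toFiniteMeasure).sum : FiniteMeasure Z) =
    ∑ k ∈ Finset.range L.length,
      (posRatOf (L.getD k 0).unpair.1 : ℝ) * f (pt (L.getD k 0).unpair.2) := by
  have hi : ∀ ρ : FiniteMeasure Z, Integrable f (ρ : Measure Z) := fun ρ =>
    Integrable.of_bound hf.aestronglyMeasurable C (ae_of_all _ hC)
  induction L with
  | nil => simp
  | cons c L ih =>
    rw [List.map_cons, List.sum_cons, FiniteMeasure.toMeasure_add, integral_add_measure (hi _) (hi _),
      ih, List.length_cons, Finset.sum_range_succ', add_comm]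
    congr 1
    rw [FiniteMeasure.toMeasure_smul, integral_smul_nnreal_measure]
    have : ∫ z, f z ∂((diracProba (pt c.unpair.2 : Z)).toFiniteMeasure : Measure Z) =
        f (pt c.unpair.2) := integral_dirac' f _ hf.stronglyMeasurable
    rw [this, NNReal.smul_def, smul_eq_mul]
    rfl

/-- The list of the codes of the summands of a basic measure. -/
def basicList (n : ℕ) : List ℕ := n.unpair.1 :: Denumerable.ofNat (List ℕ) n.unpair.2

theorem integral_basicMeasure (i n : ℕ) :
    ∫ z, basicFunction Z i z ∂(basicMeasure Z n : Measure Z) =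
    ∑ k ∈ Finset.range (basicList n).length, (posRatOf ((basicList n).getD k 0).unpair.1 : ℝ) *
      basicFunction Z i (pt ((basicList n).getD k 0).unpair.2) :=
  integral_listSum (measurable_basicFunction i) (abs_basicFunction_le i) _

theorem computable_basicList : Computable basicList :=
  Computable.list_cons.comp (Computable.fst.comp Computable.unpair)
    ((Computable.ofNat (List ℕ)).comp (Computable.snd.comp Computable.unpair))

theorem CMap.integral_basicMeasure :
    CMap fun p : ℕ × ℕ => ∫ z, basicFunction Z p.1 z ∂(basicMeasure Z p.2 : Measure Z) := by
  simp only [_root_.integral_basicMeasure]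
  have h1 : CMap fun n : ℕ => (basicList n).length :=
    CMap.of_computable (Computable.list_length.comp computable_basicList)
  have h2 : CMap fun p : ℕ × ℕ => (basicList p.1).getD p.2 0 := by
    refine CMap.of_computable₂ (φ := fun n k => (basicList n).getD k 0) ?_
      (by fun_prop) (by fun_prop)
    exact (Primrec.list_getD 0).to_comp.comp (computable_basicList.comp Computable.fst)
      Computable.snd
  have h3 : CMap fun p : ℕ × ℕ × ℕ => (basicList p.2.2).getD p.1 0 :=
    h2.comp (g := fun p : ℕ × ℕ × ℕ => (p.2.2, p.1)) (by fun_prop)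
  refine CMap.sum (f := fun k (p : ℕ × ℕ) => (posRatOf ((basicList p.2).getD k 0).unpair.1 : ℝ) *
      basicFunction Z p.1 (pt ((basicList p.2).getD k 0).unpair.2)) ?_ (h1.comp (by fun_prop))
  fun_prop

variable (Z) in
/-- The vectors of the integrals of the basic functions against the basic measures. -/
def basicVectors : Set (ℕ → ℝ) :=
  Set.range fun c i => ∫ z, basicFunction Z i z ∂(basicMeasure Z c : Measure Z)

theorem exists_posRatOf_between {a b : ℝ} (ha : 0 ≤ a) (h : a < b) :
    ∃ n, a < posRatOf n ∧ (posRatOf n : ℝ) < b := by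
  obtain ⟨q, h1, h2⟩ := exists_rat_btwn h
  have hq : 0 < q := by exact_mod_cast ha.trans_lt h1
  obtain ⟨a, ha⟩ : ∃ a : ℕ, q.num = a + 1 :=
    ⟨(q.num - 1).toNat, by have := Rat.num_pos.2 hq; omega⟩
  obtain ⟨b, hb⟩ := Nat.exists_eq_succ_of_ne_zero q.den_pos.ne'
  have h3 : (posRatOf (Nat.pair a b) : ℝ) = q := by
    unfold posRatOf
    rw [Nat.unpair_pair]
    conv_rhs => rw [← Rat.num_div_den q, ha, hb]
    push_cast
    rfl
  exact ⟨Nat.pair a b, by rwa [h3], by rwa [h3]⟩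

/-- Basic measures have positive weights and at least one atom; hence the weights are approximated
from strictly above, which includes vanishing ones, and the sum has `N + 1` terms. -/
theorem sum_mem_closure_basicVectors (w : ℕ → ℝ) (hw : ∀ j, 0 ≤ w j) (N : ℕ) :
    (fun i => ∑ j ∈ Finset.range (N + 1), w j * basicFunction Z i (pt j)) ∈
      closure (basicVectors Z) := by
  choose q hq using fun m j => exists_posRatOf_between (hw j)
    (show w j < w j + rad m by linarith [rad_pos m])
  have hq1 : ∀ j, Tendsto (fun m => (posRatOf (q m j) : ℝ)) atTop (𝓝 (w j)) := by
    intro j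
    have h1 : Tendsto (fun m => w j + rad m) atTop (𝓝 (w j + 0)) :=
      tendsto_const_nhds.add tendsto_one_div_add_atTop_nhds_zero_nat
    rw [add_zero] at h1
    exact tendsto_of_tendsto_of_tendsto_of_le_of_le tendsto_const_nhds h1 (fun m => (hq m j).1.le)
      (fun m => (hq m j).2.le)
  have hL : ∀ m, ∃ c, basicList c = (List.range (N + 1)).map fun j => Nat.pair (q m j) j := by
    intro m
    rw [List.range_succ_eq_map, List.map_cons]
    exact ⟨Nat.pair (Nat.pair (q m 0) 0) (Encodable.encode (List.map (fun j => Nat.pair (q m j) j)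
      ((List.range N).map Nat.succ))), by simp [basicList]⟩
  choose c hc using hL
  refine mem_closure_of_tendsto (f := fun m i =>
    ∫ z, basicFunction Z i z ∂(basicMeasure Z (c m) : Measure Z)) (b := atTop) ?_
    (Eventually.of_forall fun m => ⟨c m, rfl⟩)
  refine tendsto_pi_nhds.2 fun i => ?_
  have : ∀ m, ∫ z, basicFunction Z i z ∂(basicMeasure Z (c m) : Measure Z) =
      ∑ j ∈ Finset.range (N + 1), (posRatOf (q m j) : ℝ) * basicFunction Z i (pt j) := by
    intro m
    rw [integral_basicMeasure, hc, List.length_map, List.length_range]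
    refine Finset.sum_congr rfl fun k hk => ?_
    have : k < N + 1 := Finset.mem_range.1 hk
    simp [List.getD_eq_getElem?_getD, List.getElem?_range this]
  simp only [this]
  exact tendsto_finsetSum _ fun j _ => (hq1 j).mul_const _

/-- The first basic point within distance `rad n`. -/
def nearIndex (n : ℕ) (z : Z) : ℕ :=
  open Classical in Nat.find (EffectiveMetric.dense z (rad n) (rad_pos n))

theorem d_nearIndex (n : ℕ) (z : Z) : d (pt (nearIndex n z)) z < rad n := by
  classical
  exact Nat.find_spec (EffectiveMetric.dense z (rad n) (rad_pos n))

theorem measurable_nearIndex (n : ℕ) : Measurable (nearIndex n : Z → ℕ) := by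
  classical
  exact measurable_find _ fun k => EffectiveMeasurable.measurable_ball k n

/-- Computable functions are continuous; `Z` carries no topology here, so convergence is expressed
by distances. -/
theorem CMap.tendsto {f : Z → ℝ} (hf : CMap f) {u : ℕ → Z} {z : Z}
    (hu : ∀ n, d (u n) z < rad n) : Tendsto (fun n => f (u n)) atTop (𝓝 (f z)) := by
  have key : ∀ P : Z → Prop, SD P → P z → ∀ᶠ n in atTop, P (u n) := by
    intro P hP hz
    obtain ⟨W, -, h⟩ := sd_iff.1 hP
    obtain ⟨i, r, hi, hr⟩ := (h z).1 hz
    obtain ⟨k, hk⟩ := exists_rad_lt (sub_pos.2 hr)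
    refine eventually_atTop.2 ⟨k, fun n hn => (h _).2 ⟨i, r, hi, ?_⟩⟩
    have h1 := d_triangle (pt i) z (u n)
    rw [d_comm z] at h1
    have h2 : rad n ≤ rad k := by
      unfold rad
      gcongr
    linarith [hu n]
  refine tendsto_order.2 ⟨fun a ha => ?_, fun a ha => ?_⟩
  · obtain ⟨q, h1, h2⟩ := exists_ratOf_between ha
    filter_upwards [key (fun z => (ratOf q : ℝ) < f z) (hf.lsc.lt (q := fun _ => q) (by fun_prop)) h2]
      with n hn using h1.trans hn
  · obtain ⟨q, h1, h2⟩ := exists_ratOf_between ha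
    filter_upwards [key (fun z => f z < (ratOf q : ℝ)) (hf.usc.lt (q := fun _ => q) (by fun_prop)) h1]
      with n hn using hn.trans h2

/-- Density of the basic measures. Moving each `z` to `pt (nearIndex n z)` turns `μ` into a
countable sum of point masses, whose finite truncations are covered by
`sum_mem_closure_basicVectors`. As `n` grows, dominated convergence recovers the integrals against
`μ`. -/
theorem integral_mem_closure_basicVectors (μ : Measure Z) [IsFiniteMeasure μ] :
    (fun i => ∫ z, basicFunction Z i z ∂μ) ∈ closure (basicVectors Z) := by
  have h1 : ∀ n, (fun i => ∫ z, basicFunction Z i (pt (nearIndex n z)) ∂μ) ∈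
      closure (basicVectors Z) := by
    intro n
    have h2 : ∀ i, HasSum (fun j => μ.real (nearIndex n ⁻¹' {j}) * basicFunction Z i (pt j))
        (∫ z, basicFunction Z i (pt (nearIndex n z)) ∂μ) := by
      intro i
      have hint : Integrable (fun j => basicFunction Z i (pt j)) (μ.map (nearIndex n)) :=
        Integrable.of_bound (Measurable.of_discrete).aestronglyMeasurable (basicBound i)
          (ae_of_all _ fun z => abs_basicFunction_le i _)
      have e : ∫ z, basicFunction Z i (pt (nearIndex n z)) ∂μ =
          ∫ j, basicFunction Z i (pt j) ∂(μ.map (nearIndex n)) :=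
        (integral_map (measurable_nearIndex n).aemeasurable hint.aestronglyMeasurable).symm
      rw [e]
      have := hasSum_integral_iUnion (μ := μ.map (nearIndex (Z := Z) n))
        (f := fun j => basicFunction Z i (pt j)) (s := fun j : ℕ => {j})
        (fun j => measurableSet_singleton j)
        (fun a b hab => by simpa using hab) hint.integrableOn
      rw [Set.iUnion_of_singleton, setIntegral_univ] at this
      refine this.congr_fun fun j => ?_
      rw [Measure.restrict_singleton, integral_smul_measure, integral_dirac, smul_eq_mul,
        Measure.map_apply (measurable_nearIndex n) (measurableSet_singleton j)]
      rfl
    have h3 := closure_closure (s := basicVectors Z)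
    rw [← h3]
    refine mem_closure_of_tendsto (b := atTop) (f := fun N i => ∑ j ∈ Finset.range (N + 1),
      μ.real (nearIndex n ⁻¹' {j}) * basicFunction Z i (pt j)) ?_ (Eventually.of_forall fun N =>
      sum_mem_closure_basicVectors _ (fun j => measureReal_nonneg) N)
    exact tendsto_pi_nhds.2 fun i => (tendsto_add_atTop_iff_nat 1).2 (h2 i).tendsto_sum_nat
  rw [← closure_closure]
  refine mem_closure_of_tendsto (b := atTop) (f := fun n i =>
    ∫ z, basicFunction Z i (pt (nearIndex n z)) ∂μ) ?_ (Eventually.of_forall h1)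
  refine tendsto_pi_nhds.2 fun i => ?_
  refine tendsto_integral_of_dominated_convergence (fun _ => basicBound i) (fun n => ?_)
    (integrable_const _) (fun n => ae_of_all _ fun z => abs_basicFunction_le i _)
    (ae_of_all _ fun z => CMap.tendsto (f := fun z => basicFunction Z i z) (by fun_prop)
      fun n => d_nearIndex n z)
  exact ((Measurable.of_discrete (f := fun j : ℕ => basicFunction Z i (pt j))).comp
    (measurable_nearIndex n)).aestronglyMeasurable

theorem isMeasureModel_finiteMeasure :
    IsMeasureModel (fun μ : FiniteMeasure Z => (μ : Measure Z)) where
  d_eq _ _ := rfl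
  cmap_pt := CMap.integral_basicMeasure
  dense μ := by
    obtain ⟨v, hv, hl⟩ := mem_closure_iff_seq_limit.1
      (integral_mem_closure_basicVectors (μ : Measure Z))
    choose s hs using hv
    refine ⟨s, fun i => ?_⟩
    rw [← funext hs] at hl
    exact tendsto_pi_nhds.1 hl i

instance : EffectiveMetric (FiniteMeasure Z) := isMeasureModel_finiteMeasure.effectiveMetric

theorem integral_basicFunction_zero (μ : Measure Z) :
    ∫ z, basicFunction Z 0 z ∂μ = μ.real Set.univ := by
  simp [basicFunction]

theorem mass_basicMeasure_pos (n : ℕ) : 0 < (basicMeasure Z n : Measure Z).real Set.univ := by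
  rw [← integral_basicFunction_zero, integral_basicMeasure]
  refine Finset.sum_pos (fun k _ => ?_) (by simp [basicList])
  simpa [basicFunction] using posRatOf_pos _

theorem integral_normalize [Nonempty Z] (f : Z → ℝ) {μ : FiniteMeasure Z}
    (hμ : (μ : Measure Z).real Set.univ ≠ 0) :
    ∫ z, f z ∂(μ.normalize : Measure Z) =
      (∫ z, f z ∂(μ : Measure Z)) / (μ : Measure Z).real Set.univ := by
  have h0 : μ ≠ 0 := by
    rintro rfl
    simp at hμ
  rw [FiniteMeasure.toMeasure_normalize_eq_of_nonzero _ h0, integral_smul_nnreal_measure,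
    NNReal.smul_def, smul_eq_mul, div_eq_inv_mul]
  rfl

/-- The basic function of index `0` is the constant `1`, so the normalizing constant is itself one
of the computable integrals. -/
theorem integral_pt_probabilityMeasure (f : Z → ℝ) (n : ℕ) :
    ∫ z, f z ∂((pt n : ProbabilityMeasure Z) : Measure Z) =
    (∫ z, f z ∂(basicMeasure Z n : Measure Z)) /
      ∫ z, basicFunction Z 0 z ∂(basicMeasure Z n : Measure Z) := by
  have : Nonempty Z := ⟨pt 0⟩
  rw [integral_basicFunction_zero]
  exact integral_normalize f (mass_basicMeasure_pos n).ne'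

theorem isMeasureModel_probabilityMeasure :
    IsMeasureModel (fun μ : ProbabilityMeasure Z => (μ : Measure Z)) where
  d_eq _ _ := rfl
  cmap_pt := by
    simp only [integral_pt_probabilityMeasure]
    have h1 := CMap.integral_basicMeasure (Z := Z)
    refine CMap.div h1 (h1.comp (g := fun p : ℕ × ℕ => (0, p.2)) (by fun_prop)) fun p => ?_
    rw [integral_basicFunction_zero]
    exact mass_basicMeasure_pos _
  dense μ := by
    obtain ⟨s, hs⟩ := isMeasureModel_finiteMeasure.dense μ.toFiniteMeasure
    refine ⟨s, fun i => ?_⟩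
    have h0 := hs 0
    have h1 := hs i
    have e : ∫ x, basicFunction Z 0 x ∂(μ.toFiniteMeasure : Measure Z) = 1 := by
      rw [integral_basicFunction_zero]
      exact probReal_univ (μ := (μ : Measure Z))
    -- Normalizing approximating finite measures does no harm, since their masses tend to `1`.
    have := h1.div h0 (by rw [e]; exact one_ne_zero)
    rw [e, div_one] at this
    simp only [integral_pt_probabilityMeasure]
    exact this

instance : EffectiveMetric (ProbabilityMeasure Z) := isMeasureModel_probabilityMeasure.effectiveMetric

end

/-! ### Computability of integrals -/

/-- The index of a rational multiple of a bump function. -/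
def bumpIndex (e : ℕ) : ℕ :=
  -- After the shift by one for the constant function, residue `4` selects scalar multiples and
  -- residue `0` bumps.
  5 * Nat.pair e.unpair.1 (5 * e.unpair.2 + 1) + 5

/-- The index of the maximum of `0` and of the first `n` functions given by a sequence of codes. -/
def maxIndex (L n : ℕ) : ℕ :=
  -- The index `5` is that of `ratOf 0` times the constant `1`, the zero function; the `+ 2` selects
  -- maxima.
  Nat.rec 5 (fun j y => 5 * Nat.pair y (bumpIndex (seqEntry L j)) + 2) n

section
variable {A Z : Type*} [BasicMetric A] [EffectiveMetric A] [BasicMetric Z] [MeasurableSpace Z]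
  [EffectiveMeasurable Z]

theorem basicFunction_bumpIndex (e : ℕ) (z : Z) : basicFunction Z (bumpIndex e) z =
    (ratOf e.unpair.1 : ℝ) * bump (pt e.unpair.2.unpair.1) (posRatOf e.unpair.2.unpair.2.unpair.1 : ℝ)
      ((posRatOf e.unpair.2.unpair.2.unpair.1 : ℝ) + posRatOf e.unpair.2.unpair.2.unpair.2) z := by
  have h1 : ∀ m, (5 * m + 4) % 5 = 4 := by omega
  have h2 : ∀ m, (5 * m + 4) / 5 = m := by omega
  rw [bumpIndex, show ∀ m, 5 * m + 5 = 5 * m + 4 + 1 from fun _ => rfl, basicFunction]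
  simp only [h1, h2]
  norm_num
  left
  rw [basicFunction]
  simp

theorem basicFunction_maxIndex_zero (L : ℕ) (z : Z) : basicFunction Z (maxIndex L 0) z = 0 := by
  change basicFunction Z (4 + 1) z = 0
  rw [basicFunction]
  simp [ratOf_zero]

theorem basicFunction_maxIndex_succ (L n : ℕ) (z : Z) :
    basicFunction Z (maxIndex L (n + 1)) z =
      max (basicFunction Z (maxIndex L n) z) (basicFunction Z (bumpIndex (seqEntry L n)) z) := by
  have h1 : ∀ m, (5 * m + 1) % 5 = 1 := by omega
  have h2 : ∀ m, (5 * m + 1) / 5 = m := by omega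
  change basicFunction Z (5 * Nat.pair (maxIndex L n) (bumpIndex (seqEntry L n)) + 1 + 1) z = _
  rw [basicFunction]
  simp only [h1, h2, Nat.unpair_pair]
  norm_num

@[fun_prop] theorem CMap.fun_maxIndex {L n : A → ℕ} (hL : CMap L) (hn : CMap n) :
    CMap fun a => maxIndex (L a) (n a) := by
  have := (CMap.natRec (Z := ℕ) (Y := ℕ) (g := fun _ => 5)
    (h := fun j y L => 5 * Nat.pair y (bumpIndex (seqEntry L j)) + 2) (by fun_prop)
    (by unfold bumpIndex; fun_prop)).comp (g := fun a => (n a, L a)) (by fun_prop)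
  exact this

/-- The function `f (a, ·)` is the supremum of the rational multiples of bumps that are verifiably
below it. Finite maxima of these are basic functions, so their integrals are computable, and by
dominated convergence they exhaust the integral of `f (a, ·)`. -/
theorem LSC.integral_of_unit {f : A × Z → ℝ} (hf : CMap f) (h0 : ∀ p, 0 ≤ f p) (h1 : ∀ p, f p ≤ 1) :
    LSC fun p : A × FiniteMeasure Z => ∫ z, f (p.1, z) ∂(p.2 : Measure Z) := by
  obtain ⟨W, hW, h⟩ := sd_nat_prod.1 (show SD fun p : ℕ × A × Z => (ratOf p.1 : ℝ) < f p.2 from hf.lsc)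
  -- A code is active at `a` if its multiple of a bump is seen to be below `f (a, ·)`: either the
  -- factor is at most `0`, or the support lies in a ball on which `f (a, ·)` is known to exceed the
  -- factor.
  let Act : ℕ → A → Prop := fun e a => ratOf e.unpair.1 ≤ ratOf 0 ∨
    ∃ i r, W (e.unpair.1, Nat.pair i e.unpair.2.unpair.1, r) ∧ d (pt i) a < rad r ∧
      (posRatOf e.unpair.2.unpair.2.unpair.1 : ℝ) + posRatOf e.unpair.2.unpair.2.unpair.2 < rad r
  have hAct : SD fun p : ℕ × A => Act p.1 p.2 := by
    refine (SD.ratOf_le (by fun_prop) (by fun_prop)).or ?_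
    refine SD.exists_nat (P := fun p : ℕ × ℕ × A => ∃ r, W (p.2.1.unpair.1, Nat.pair p.1 p.2.1.unpair.2.unpair.1, r) ∧ d (pt p.1) p.2.2 < rad r ∧
      (posRatOf p.2.1.unpair.2.unpair.2.unpair.1 : ℝ) + posRatOf p.2.1.unpair.2.unpair.2.unpair.2 < rad r) ?_
    refine SD.exists_nat (P := fun p : ℕ × ℕ × ℕ × A => W (p.2.2.1.unpair.1, Nat.pair p.2.1 p.2.2.1.unpair.2.unpair.1, p.1) ∧ d (pt p.2.1) p.2.2.2 < rad p.1 ∧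
      (posRatOf p.2.2.1.unpair.2.unpair.2.unpair.1 : ℝ) + posRatOf p.2.2.1.unpair.2.unpair.2.unpair.2 < rad p.1) ?_
    refine SD.and ?_ (SD.and ?_ (SD.real_lt (CMap.usc (by fun_prop)) (CMap.lsc (by fun_prop))))
    · have : RE fun e : ℕ => W (e.unpair.1, e.unpair.2.unpair.1, e.unpair.2.unpair.2) :=
        hW.comp (by fun_prop)
      refine (this.sd.comp (f := fun p : ℕ × ℕ × ℕ × A => Nat.pair p.2.2.1.unpair.1
        (Nat.pair (Nat.pair p.2.1 p.2.2.1.unpair.2.unpair.1) p.1)) (by fun_prop)).congr fun p => ?_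
      simp
    · exact (cmap_iff_sd.1 (CMap.id (Z := A))).comp (f := fun p : ℕ × ℕ × ℕ × A => (p.2.1, p.1, p.2.2.2))
        (by fun_prop)
  have hbump : ∀ e (z : Z), basicFunction Z (bumpIndex e) z = (ratOf e.unpair.1 : ℝ) * max 0 (min 1
      (((posRatOf e.unpair.2.unpair.2.unpair.1 : ℝ) + posRatOf e.unpair.2.unpair.2.unpair.2
        - d (pt e.unpair.2.unpair.1) z) / posRatOf e.unpair.2.unpair.2.unpair.2)) := by
    intro e z
    have := posRatOf_pos e.unpair.2.unpair.2.unpair.2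
    rw [basicFunction_bumpIndex, bump_eq _ _ (by linarith), add_sub_cancel_left]
  have sound : ∀ e a, Act e a → ∀ z, basicFunction Z (bumpIndex e) z ≤ f (a, z) := by
    intro e a he z
    rw [hbump]
    rcases he with he | ⟨i, r, hw, hi, hr⟩
    · refine le_trans (mul_nonpos_of_nonpos_of_nonneg ?_ (le_max_left _ _)) (h0 _)
      rw [ratOf_zero] at he
      exact_mod_cast he
    · have hδ := posRatOf_pos e.unpair.2.unpair.2.unpair.2
      by_cases hz : d (pt e.unpair.2.unpair.1) z < rad r
      · have h2 : (ratOf e.unpair.1 : ℝ) < f (a, z) :=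
          (h _ (a, z)).2 ⟨_, r, hw, by simp [d_prod, pt_prod, hi, hz]⟩
        calc _ ≤ f (a, z) * max 0 (min 1
              (((posRatOf e.unpair.2.unpair.2.unpair.1 : ℝ) + posRatOf e.unpair.2.unpair.2.unpair.2
              - d (pt e.unpair.2.unpair.1) z) / posRatOf e.unpair.2.unpair.2.unpair.2)) := by gcongr
          _ ≤ f (a, z) * 1 := by
            gcongr
            · exact h0 _
            · exact max_le zero_le_one (min_le_left _ _)
          _ = _ := mul_one _
      · rw [max_eq_left, mul_zero]
        · exact h0 _
        · exact (min_le_right _ _).trans (div_nonpos_of_nonpos_of_nonneg (by linarith) hδ.le)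
  have complete : ∀ a z (c : ℝ), 0 ≤ c → c < f (a, z) →
      ∃ e, Act e a ∧ c < basicFunction Z (bumpIndex e) z := by
    intro a z c hc0 hc
    obtain ⟨q, hq, hq'⟩ := exists_ratOf_between hc
    obtain ⟨i, r, hw, hr⟩ := (h q (a, z)).1 hq'
    simp only [d_prod, pt_prod, max_lt_iff] at hr
    obtain ⟨ρ, h3, h4⟩ := exists_posRatOf_between (d_nonneg _ _) hr.2
    obtain ⟨δ, h5, h6⟩ := exists_posRatOf_between le_rfl (sub_pos.2 h4)
    refine ⟨Nat.pair q (Nat.pair i.unpair.2 (Nat.pair ρ δ)), Or.inr ⟨i.unpair.1, r, by simpa using hw,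
      hr.1, by simp only [Nat.unpair_pair]; linarith⟩, ?_⟩
    rw [hbump]
    simp only [Nat.unpair_pair]
    rwa [min_eq_left, max_eq_right zero_le_one, mul_one]
    rw [one_le_div h5]
    linarith
  have hint : CMap fun p : ℕ × A × FiniteMeasure Z => ∫ z, basicFunction Z p.1 z ∂(p.2.2 : Measure Z) :=
    isMeasureModel_finiteMeasure.cmap_integral.comp
      (g := fun p : ℕ × A × FiniteMeasure Z => (p.1, p.2.2)) (by fun_prop)
  have key : SD fun p : ℕ × A × FiniteMeasure Z => ∃ L n, (∀ j < n, Act (seqEntry L j) p.2.1) ∧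
      (ratOf p.1 : ℝ) < ∫ z, basicFunction Z (maxIndex L n) z ∂(p.2.2 : Measure Z) := by
    refine SD.exists_nat (P := fun p : ℕ × ℕ × A × FiniteMeasure Z => ∃ n,
      (∀ j < n, Act (seqEntry p.1 j) p.2.2.1) ∧ (ratOf p.2.1 : ℝ) <
        ∫ z, basicFunction Z (maxIndex p.1 n) z ∂(p.2.2.2 : Measure Z)) ?_
    refine SD.exists_nat (P := fun p : ℕ × ℕ × ℕ × A × FiniteMeasure Z =>
      (∀ j < p.1, Act (seqEntry p.2.1 j) p.2.2.2.1) ∧ (ratOf p.2.2.1 : ℝ) <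
        ∫ z, basicFunction Z (maxIndex p.2.1 p.1) z ∂(p.2.2.2.2 : Measure Z)) ?_
    refine SD.and ?_ (SD.real_lt (CMap.usc (by fun_prop)) (CMap.lsc ?_))
    · exact SD.all_lt (P := fun p : ℕ × ℕ × ℕ × ℕ × A × FiniteMeasure Z =>
        Act (seqEntry p.2.2.1 p.1) p.2.2.2.2.1) (hAct.comp
        (f := fun p : ℕ × ℕ × ℕ × ℕ × A × FiniteMeasure Z => (seqEntry p.2.2.1 p.1, p.2.2.2.2.1))
        (by fun_prop)) (by fun_prop)
    · exact hint.comp (g := fun p : ℕ × ℕ × ℕ × A × FiniteMeasure Z =>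
        (maxIndex p.2.1 p.1, p.2.2.2.1, p.2.2.2.2)) (by fun_prop)
  have hmax : ∀ L n a, (∀ j < n, Act (seqEntry L j) a) → ∀ z,
      basicFunction Z (maxIndex L n) z ≤ f (a, z) := by
    intro L n a hj z
    induction n with
    | zero => rw [basicFunction_maxIndex_zero]; exact h0 _
    | succ n ih =>
      rw [basicFunction_maxIndex_succ]
      exact max_le (ih fun j hjn => hj j (by omega)) (sound _ _ (hj n (by omega)) z)
  have hmax0 : ∀ L n (z : Z), 0 ≤ basicFunction Z (maxIndex L n) z := by
    intro L n z
    induction n with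
    | zero => rw [basicFunction_maxIndex_zero]
    | succ n ih => rw [basicFunction_maxIndex_succ]; exact ih.trans (le_max_left _ _)
  have hmaxj : ∀ L n j, j < n → ∀ z : Z,
      basicFunction Z (bumpIndex (seqEntry L j)) z ≤ basicFunction Z (maxIndex L n) z := by
    intro L n j hj z
    induction n with
    | zero => omega
    | succ n ih =>
      rw [basicFunction_maxIndex_succ]
      rcases Nat.lt_succ_iff_lt_or_eq.1 hj with hj | rfl
      · exact (ih hj).trans (le_max_left _ _)
      · exact le_max_right _ _
  refine key.congr ?_
  rintro ⟨Q, a, μ⟩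
  dsimp only
  have hm : Measurable fun z => f (a, z) := hf.measurable_section a
  constructor
  · intro hQ
    classical
    have hact0 : Act 0 a := Or.inl (by simp)
    -- Activity is not decidable, but a sequence only has to exist; inactive codes are replaced by
    -- `0`, which is always active since its factor is `0`.
    let s : ℕ → ℕ := fun j => if Act j a then j else 0
    have hs : ∀ j, Act (s j) a := fun j => by
      by_cases hj : Act j a <;> simp [s, hj, hact0]
    choose L hL using fun n => exists_seqEntry s n
    have hLact : ∀ n, ∀ j < n, Act (seqEntry (L n) j) a := fun n j hj => by
      rw [hL n j hj]; exact hs j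
    have lim : Tendsto (fun n => ∫ z, basicFunction Z (maxIndex (L n) n) z ∂(μ : Measure Z)) atTop
        (𝓝 (∫ z, f (a, z) ∂(μ : Measure Z))) := by
      refine tendsto_integral_of_dominated_convergence (fun _ => 1)
        (fun n => (measurable_basicFunction _).aestronglyMeasurable) (integrable_const _)
        (fun n => ae_of_all _ fun z => ?_) (ae_of_all _ fun z => ?_)
      · rw [Real.norm_of_nonneg (hmax0 _ _ _)]
        exact (hmax _ _ a (hLact n) z).trans (h1 _)
      · refine tendsto_order.2 ⟨fun c hc => ?_, fun c hc => Eventually.of_forall fun n =>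
          (hmax _ _ a (hLact n) z).trans_lt hc⟩
        rcases lt_or_ge c 0 with hc0 | hc0
        · exact Eventually.of_forall fun n => hc0.trans_le (hmax0 _ _ _)
        · obtain ⟨e, he, hce⟩ := complete a z c hc0 hc
          filter_upwards [eventually_gt_atTop e] with n hn
          refine hce.trans_le ?_
          have := hmaxj (L n) n e hn z
          rwa [hL n e hn, show s e = e from if_pos he] at this
    obtain ⟨n, hn⟩ := (lim.eventually_const_lt hQ).exists
    exact ⟨L n, n, hLact n, hn⟩
  · rintro ⟨L, n, hj, hQ⟩
    refine hQ.trans_le (integral_mono (integrable_basicFunction _ _)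
      (Integrable.of_bound hm.aestronglyMeasurable 1 (ae_of_all _ fun z => ?_)) (hmax L n a hj))
    rw [Real.norm_of_nonneg (h0 _)]
    exact h1 _

theorem CMap.fun_basicIntegral {i : A → ℕ} (hi : CMap i) {μ : A → FiniteMeasure Z} (hμ : CMap μ) :
    CMap fun a => ∫ z, basicFunction Z (i a) z ∂(μ a : Measure Z) :=
  isMeasureModel_finiteMeasure.cmap_integral.comp (g := fun a => (i a, μ a)) (by fun_prop)

@[fun_prop] theorem CMap.mass {μ : A → FiniteMeasure Z} (hμ : CMap μ) :
    CMap fun a => (μ a : Measure Z).real Set.univ :=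
  (CMap.fun_basicIntegral (i := fun _ => 0) (by fun_prop) hμ).of_eq fun _ =>
    integral_basicFunction_zero _

/-- Upper bounds come from lower bounds for the integral of `1 - f`, as the total mass is
computable. -/
theorem CMap.integral_of_unit {f : A × Z → ℝ} (hf : CMap f) (h0 : ∀ p, 0 ≤ f p) (h1 : ∀ p, f p ≤ 1) :
    CMap fun p : A × FiniteMeasure Z => ∫ z, f (p.1, z) ∂(p.2 : Measure Z) := by
  refine cmap_of_lsc_usc (LSC.integral_of_unit hf h0 h1) ?_
  have h2 := LSC.integral_of_unit (f := fun p => 1 - f p) (by fun_prop)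
    (fun p => sub_nonneg.2 (h1 p)) (fun p => by linarith [h0 p])
  have h3 : CMap fun p : A × FiniteMeasure Z => (p.2 : Measure Z).real Set.univ := by fun_prop
  refine (h3.usc.sub h2).congr fun p => ?_
  dsimp only
  have hm : Measurable fun z => f (p.2.1, z) := hf.measurable_section p.2.1
  rw [integral_sub (integrable_const _) (Integrable.of_bound hm.aestronglyMeasurable 1
    (ae_of_all _ fun z => ?_))]
  · simp
  · rw [Real.norm_of_nonneg (h0 _)]
    exact h1 _

/-- The integral of a computable function, bounded by a computable function of the parameter, is
a computable function of the parameter and the measure. -/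
theorem CMap.integral {f : A → Z → ℝ} (hf : CMap fun p : A × Z => f p.1 p.2) {K : A → ℝ}
    (hK : CMap K) (hb : ∀ a z, |f a z| ≤ K a) {μ : A → FiniteMeasure Z} (hμ : CMap μ) :
    CMap fun a => ∫ z, f a z ∂(μ a : Measure Z) := by
  have hK0 : ∀ a, 0 ≤ K a := fun a => (abs_nonneg _).trans (hb a (pt 0))
  -- An affine change of values into `[0, 1]`; `K + 1` replaces `K`, which may vanish.
  have h1 : CMap fun p : A × Z => (f p.1 p.2 / (K p.1 + 1) + 1) / 2 :=
    CMap.div (CMap.add (CMap.div hf (by fun_prop) fun p => by linarith [hK0 p.1]) (by fun_prop))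
      (by fun_prop) fun _ => two_pos
  have h2 : ∀ a z, |f a z / (K a + 1)| ≤ 1 := by
    intro a z
    have := hK0 a
    rw [abs_div, abs_of_pos (by linarith : 0 < K a + 1), div_le_one (by linarith)]
    linarith [hb a z]
  have h3 := CMap.integral_of_unit h1 (fun p => by linarith [(abs_le.1 (h2 p.1 p.2)).1])
    (fun p => by linarith [(abs_le.1 (h2 p.1 p.2)).2])
  have h4 := h3.comp (g := fun a => (a, μ a)) (by fun_prop)
  have h5 : CMap fun a => (K a + 1) * (2 * ∫ z, (f a z / (K a + 1) + 1) / 2 ∂(μ a : Measure Z) -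
      (μ a : Measure Z).real Set.univ) := by fun_prop
  refine h5.of_eq fun a => ?_
  have hm : Measurable fun z => f a z := hf.measurable_section a
  have hi : Integrable (fun z => f a z) (μ a : Measure Z) :=
    Integrable.of_bound hm.aestronglyMeasurable (K a) (ae_of_all _ (hb a))
  rw [integral_div, integral_add (hi.div_const _) (integrable_const _), integral_div]
  have := hK0 a
  simp
  field_simp
  ring

end

/-! ### Computable maps between spaces of measures -/

section
variable {A Z W : Type*} [BasicMetric A] [EffectiveMetric A] [BasicMetric Z] [MeasurableSpace Z]
  [EffectiveMeasurable Z] [BasicMetric W] [MeasurableSpace W] [EffectiveMeasurable W]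

attribute [fun_prop] CMap.fun_basicIntegral

@[fun_prop] theorem CMap.toFiniteMeasure {μ : A → ProbabilityMeasure Z} (hμ : CMap μ) :
    CMap fun a => (μ a).toFiniteMeasure :=
  (isMeasureModel_finiteMeasure.cmap_of (f := fun μ : ProbabilityMeasure Z => μ.toFiniteMeasure)
    isMeasureModel_probabilityMeasure.cmap_integral).comp hμ

theorem CMap.finiteMeasureMap_aux {φ : Z → W} (hφ : CMap φ) (hm : Measurable φ) :
    CMap fun μ : FiniteMeasure Z => μ.map φ := by
  refine isMeasureModel_finiteMeasure.cmap_of ?_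
  have e : ∀ (i : ℕ) (μ : FiniteMeasure Z), ∫ w, basicFunction W i w ∂(μ.map φ : Measure W) =
      ∫ z, basicFunction W i (φ z) ∂(μ : Measure Z) := fun i μ => by
    rw [FiniteMeasure.toMeasure_map]
    exact integral_map hm.aemeasurable (measurable_basicFunction i).aestronglyMeasurable
  simp only [e]
  exact CMap.integral (f := fun (p : ℕ × FiniteMeasure Z) z => basicFunction W p.1 (φ z))
    (K := fun p => basicBound p.1) (by fun_prop) (by fun_prop)
    (fun p z => abs_basicFunction_le _ _) (by fun_prop)

theorem CMap.finiteMeasureMap {φ : Z → W} (hφ : CMap φ) (hm : Measurable φ)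
    {μ : A → FiniteMeasure Z} (hμ : CMap μ) : CMap fun a => (μ a).map φ :=
  (CMap.finiteMeasureMap_aux hφ hm).comp hμ

/-- By Fubini's theorem the integrals of basic functions are iterated, and `CMap.integral` applies
twice. -/
theorem CMap.finiteMeasureProd_aux :
    CMap fun p : FiniteMeasure Z × FiniteMeasure W => p.1.prod p.2 := by
  refine isMeasureModel_finiteMeasure.cmap_of ?_
  have e : ∀ (i : ℕ) (μ : FiniteMeasure Z) (ν : FiniteMeasure W),
      ∫ p, basicFunction (Z × W) i p ∂(μ.prod ν : Measure (Z × W)) =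
      ∫ z, ∫ w, basicFunction (Z × W) i (z, w) ∂(ν : Measure W) ∂(μ : Measure Z) := fun i μ ν => by
    rw [FiniteMeasure.toMeasure_prod]
    exact integral_prod _ (integrable_basicFunction i _)
  simp only [e]
  have h1 : CMap fun p : (ℕ × FiniteMeasure Z × FiniteMeasure W) × Z =>
      ∫ w, basicFunction (Z × W) p.1.1 (p.2, w) ∂(p.1.2.2 : Measure W) :=
    CMap.integral (f := fun (p : (ℕ × FiniteMeasure Z × FiniteMeasure W) × Z) w =>
      basicFunction (Z × W) p.1.1 (p.2, w)) (K := fun p => basicBound p.1.1) (by fun_prop)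
      (by fun_prop) (fun p z => abs_basicFunction_le _ _) (by fun_prop)
  refine CMap.integral (f := fun (p : ℕ × FiniteMeasure Z × FiniteMeasure W) z =>
      ∫ w, basicFunction (Z × W) p.1 (z, w) ∂(p.2.2 : Measure W))
    (K := fun p => basicBound p.1 * (p.2.2 : Measure W).real Set.univ) h1 (by fun_prop)
    (fun p z => ?_) (by fun_prop)
  exact norm_integral_le_of_norm_le_const (f := fun w => basicFunction (Z × W) p.1 (z, w))
    (C := basicBound p.1) (ae_of_all _ fun w => abs_basicFunction_le _ _)

@[fun_prop] theorem CMap.finiteMeasureProd {μ : A → FiniteMeasure Z} {ν : A → FiniteMeasure W}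
    (hμ : CMap μ) (hν : CMap ν) : CMap fun a => (μ a).prod (ν a) :=
  CMap.finiteMeasureProd_aux.comp (g := fun a => (μ a, ν a)) (by fun_prop)

/-- A probability measure, computable from a given finite measure, which equals the given measure
if that is a probability measure. -/
def toProbability (μ : FiniteMeasure Z) : ProbabilityMeasure Z :=
  haveI : Nonempty Z := ⟨pt 0⟩
  (μ + (1 - μ.mass) • (diracProba (pt 0 : Z)).toFiniteMeasure).normalize

theorem toProbability_toFiniteMeasure (μ : ProbabilityMeasure Z) :
    toProbability μ.toFiniteMeasure = μ := by
  simp [toProbability]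

theorem integral_add_smul_dirac {f : Z → ℝ} (hf : Measurable f) {C : ℝ} (hC : ∀ z, |f z| ≤ C)
    (μ : FiniteMeasure Z) :
    ∫ z, f z ∂((μ + (1 - μ.mass) • (diracProba (pt 0 : Z)).toFiniteMeasure : FiniteMeasure Z) :
      Measure Z) = ∫ z, f z ∂(μ : Measure Z) +
        max 0 (1 - (μ : Measure Z).real Set.univ) * f (pt 0) := by
  have hi : ∀ ρ : FiniteMeasure Z, Integrable f (ρ : Measure Z) := fun ρ =>
    Integrable.of_bound hf.aestronglyMeasurable C (ae_of_all _ hC)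
  rw [FiniteMeasure.toMeasure_add, integral_add_measure (hi _) (hi _),
    FiniteMeasure.toMeasure_smul, integral_smul_nnreal_measure]
  have : ∫ z, f z ∂((diracProba (pt 0 : Z)).toFiniteMeasure : Measure Z) = f (pt 0) :=
    integral_dirac' f _ hf.stronglyMeasurable
  rw [this, NNReal.smul_def, smul_eq_mul, NNReal.coe_sub_def, max_comm]
  rfl

/-- Adding the missing mass `max 0 (1 - mass)` at `pt 0` raises the total to `max 1 mass`, so the
normalization divides by a positive computable number, even at the zero measure. -/
theorem CMap.toProbability_aux : CMap (toProbability (Z := Z)) := by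
  have : Nonempty Z := ⟨pt 0⟩
  refine isMeasureModel_probabilityMeasure.cmap_of ?_
  have e0 : ∀ μ : FiniteMeasure Z, ((μ + (1 - μ.mass) • (diracProba (pt 0 : Z)).toFiniteMeasure :
      FiniteMeasure Z) : Measure Z).real Set.univ = max 1 ((μ : Measure Z).real Set.univ) := by
    intro μ
    rw [← integral_basicFunction_zero, integral_add_smul_dirac (measurable_basicFunction 0)
      (abs_basicFunction_le 0), integral_basicFunction_zero]
    simp only [basicFunction, mul_one]
    rcases le_total ((μ : Measure Z).real Set.univ) 1 with h | h
    · rw [max_eq_right (by linarith), max_eq_left h]; ring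
    · rw [max_eq_left (by linarith), max_eq_right h]; ring
  have e : ∀ (i : ℕ) (μ : FiniteMeasure Z), ∫ z, basicFunction Z i z ∂(toProbability μ : Measure Z) =
      (∫ z, basicFunction Z i z ∂(μ : Measure Z) + max 0 (1 - (μ : Measure Z).real Set.univ) *
        basicFunction Z i (pt 0)) / max 1 ((μ : Measure Z).real Set.univ) := by
    intro i μ
    rw [toProbability, integral_normalize, e0, integral_add_smul_dirac (measurable_basicFunction i)
      (abs_basicFunction_le i)]
    rw [e0]
    positivity
  simp only [e]
  exact CMap.div (by fun_prop) (by fun_prop) fun p => by positivity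

@[fun_prop] theorem CMap.toProbability {μ : A → FiniteMeasure Z} (hμ : CMap μ) :
    CMap fun a => toProbability (μ a) := CMap.toProbability_aux.comp hμ

end

/-! ### Computable series -/

section
variable {B : Type*} [BasicMetric B] [EffectiveMetric B]

theorem summable_of_tail_le {u : ℕ → ℝ} (h0 : ∀ i, 0 ≤ u i) {e : ℕ → ℝ}
    (ht : ∀ n N, n ≤ N → ∑ i ∈ Finset.Ico n N, u i ≤ e n) : Summable u :=
  summable_of_sum_range_le h0 (c := e 0) fun N => by
    rw [Finset.range_eq_Ico]
    exact ht 0 N N.zero_le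

/-- The sum of a computable series of nonnegative functions is computable if the tails of the
series have computable bounds that tend to zero. -/
theorem CMap.tsum {u e : ℕ → B → ℝ} (hu : CMap fun p : ℕ × B => u p.1 p.2)
    (h0 : ∀ i b, 0 ≤ u i b) (he : CMap fun p : ℕ × B => e p.1 p.2)
    (hlim : ∀ b, Tendsto (fun n => e n b) atTop (𝓝 0))
    (ht : ∀ b n N, n ≤ N → ∑ i ∈ Finset.Ico n N, u i b ≤ e n b) :
    CMap fun b => ∑' i, u i b := by
  have hs : ∀ b, Summable fun i => u i b := fun b => summable_of_tail_le (fun i => h0 i b) (ht b)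
  have hu' : CMap fun p : ℕ × ℕ × B => u p.1 p.2.2 :=
    hu.comp (g := fun p : ℕ × ℕ × B => (p.1, p.2.2)) (by fun_prop)
  have hp : CMap fun p : ℕ × B => ∑ i ∈ Finset.range p.1, u i p.2 :=
    CMap.sum (f := fun i (p : ℕ × B) => u i p.2) hu' (by fun_prop)
  have hl : ∀ b, Tendsto (fun n => ∑ i ∈ Finset.range n, u i b) atTop (𝓝 (∑' i, u i b)) :=
    fun b => (hs b).hasSum.tendsto_sum_nat
  refine cmap_of_lsc_usc ?_ ?_
  · refine LSC.iSup_iff (u := fun n b => ∑ i ∈ Finset.range n, u i b) hp.lsc fun b q =>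
      ⟨fun h => ((hl b).eventually_const_lt h).exists, fun ⟨n, hn⟩ =>
        hn.trans_le ((hs b).sum_le_tsum _ fun i _ => h0 i b)⟩
  · refine USC.iInf_iff (u := fun n b => ∑ i ∈ Finset.range n, u i b + e n b)
      (CMap.usc (by fun_prop)) fun b q => ⟨fun h => ?_, fun ⟨n, hn⟩ => ?_⟩
    · have := (hl b).add (hlim b)
      rw [add_zero] at this
      exact (this.eventually_lt_const h).exists
    · refine lt_of_le_of_lt ?_ hn
      refine le_of_tendsto (hl b) (eventually_atTop.2 ⟨n, fun N hN => ?_⟩)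
      rw [← Finset.sum_range_add_sum_Ico _ hN]
      gcongr
      exact ht b n N hN

/-- A positive upper bound for the tails of the series `∑ m i` with sum `J`. -/
def tailBound (J : ℝ) (m : ℕ → ℝ) (n : ℕ) : ℝ := J - ∑ i ∈ Finset.range n, m i + 2⁻¹ ^ n

section
variable {J : ℝ} {m : ℕ → ℝ} (hJ : HasSum m J) (hm : ∀ i, 0 ≤ m i)
include hJ hm

/-- The summand `2⁻¹ ^ n` gives strict positivity even if the tail vanishes, so that division by the
square root is possible. -/
theorem tailBound_pos (n : ℕ) : 0 < tailBound J m n := by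
  have h1 := sum_le_hasSum (Finset.range n) (fun i _ => hm i) hJ
  have h2 : (0 : ℝ) < 2⁻¹ ^ n := by positivity
  unfold tailBound
  linarith

omit hJ hm in
theorem le_tailBound_sub (n : ℕ) : m n ≤ tailBound J m n - tailBound J m (n + 1) := by
  have h2 : (0 : ℝ) < 2⁻¹ ^ n := by positivity
  unfold tailBound
  rw [Finset.sum_range_succ, pow_succ]
  linarith

omit hJ in
theorem antitone_tailBound : Antitone (tailBound J m) :=
  antitone_nat_of_succ_le fun n => by linarith [le_tailBound_sub (J := J) (m := m) n, hm n]

omit hm in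
theorem tendsto_tailBound : Tendsto (tailBound J m) atTop (𝓝 0) := by
  have h1 : Tendsto (fun n : ℕ => (2 : ℝ)⁻¹ ^ n) atTop (𝓝 0) :=
    tendsto_pow_atTop_nhds_zero_of_lt_one (by norm_num) (by norm_num)
  have h2 := (hJ.tendsto_sum_nat.const_sub J).add h1
  rwa [sub_self, add_zero] at h2

omit hm in
theorem tendsto_sqrt_tailBound : Tendsto (fun n => √(tailBound J m n)) atTop (𝓝 0) := by
  simpa using (tendsto_tailBound hJ).sqrt

/-- A discrete form of `∫ dR / √R = 2 √R`: one has `m i ≤ R i - R (i + 1)`, and `(R - R') / √R ≤ 2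
(√R - √R')` for `R' ≤ R`, so the sum telescopes. -/
theorem sum_div_sqrt_tailBound_le {n N : ℕ} (h : n ≤ N) :
    ∑ i ∈ Finset.Ico n N, (√(tailBound J m i))⁻¹ * m i ≤ 2 * √(tailBound J m n) := by
  suffices H : ∑ i ∈ Finset.Ico n N, (√(tailBound J m i))⁻¹ * m i ≤
      2 * (√(tailBound J m n) - √(tailBound J m N)) by
    linarith [Real.sqrt_nonneg (tailBound J m N)]
  induction N, h using Nat.le_induction with
  | base => simp
  | succ N hN ih =>
    rw [Finset.sum_Ico_succ_top hN]
    have h1 := le_tailBound_sub (J := J) (m := m) N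
    have ha := tailBound_pos hJ hm N
    have hb := tailBound_pos hJ hm (N + 1)
    have hab := antitone_tailBound (J := J) hm N.le_succ
    have h2 : (√(tailBound J m N))⁻¹ * m N ≤ 2 * (√(tailBound J m N) - √(tailBound J m (N + 1))) := by
      rw [inv_mul_le_iff₀ (Real.sqrt_pos.2 ha)]
      have e1 := Real.sq_sqrt ha.le
      have e2 := Real.sq_sqrt hb.le
      have h3 := Real.sqrt_le_sqrt hab
      nlinarith [Real.sqrt_nonneg (tailBound J m (N + 1))]
    linarith

end

/-- A factor that cuts off a series with the weights `v` as soon as its weighted partial sums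
exceed `C + 1`. -/
def cutoff (C : ℕ) (v S : ℕ → ℝ) (i : ℕ) : ℝ :=
  max 0 (min 1 (C + 1 - ∑ j ∈ Finset.range (i + 1), v j * S j))

theorem cutoff_nonneg (C : ℕ) (v S : ℕ → ℝ) (i : ℕ) : 0 ≤ cutoff C v S i := le_max_left _ _

theorem cutoff_le_one (C : ℕ) (v S : ℕ → ℝ) (i : ℕ) : cutoff C v S i ≤ 1 :=
  max_le zero_le_one (min_le_left _ _)

theorem cutoff_eq_one {C : ℕ} {v S : ℕ → ℝ} {i : ℕ}
    (h : ∑ j ∈ Finset.range (i + 1), v j * S j ≤ C) : cutoff C v S i = 1 := by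
  unfold cutoff
  rw [min_eq_left (by linarith), max_eq_right zero_le_one]

/-- The factor at `i` looks at the partial sum including the term `i`, so the term that would carry
the sum beyond `C + 1` is already removed. -/
theorem sum_cutoff_mul_le {C : ℕ} {v S : ℕ → ℝ} (h : ∀ i, 0 ≤ v i * S i) (n N : ℕ) :
    ∑ i ∈ Finset.Ico n N, cutoff C v S i * (v i * S i) ≤ C + 1 := by
  have hC : (0 : ℝ) ≤ C + 1 := by positivity
  suffices H : ∑ i ∈ Finset.Ico n N, cutoff C v S i * (v i * S i) ≤
      min (∑ i ∈ Finset.range N, v i * S i) (C + 1) from H.trans (min_le_right _ _)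
  rcases le_or_gt N n with hN | hN
  · rw [Finset.Ico_eq_empty_of_le hN, Finset.sum_empty]
    exact le_min (Finset.sum_nonneg fun i _ => h i) hC
  induction N, hN.le using Nat.le_induction with
  | base => omega
  | succ N hnN ih =>
    have ih' : ∑ i ∈ Finset.Ico n N, cutoff C v S i * (v i * S i) ≤
      min (∑ i ∈ Finset.range N, v i * S i) (C + 1) := by
      rcases hnN.eq_or_lt with rfl | h1
      · rw [Finset.Ico_self, Finset.sum_empty]
        exact le_min (Finset.sum_nonneg fun i _ => h i) hC
      · exact ih h1
    rw [Finset.sum_Ico_succ_top hnN]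
    have hv := h N
    by_cases hc : ∑ j ∈ Finset.range (N + 1), v j * S j ≤ C + 1
    · rw [min_eq_left hc, Finset.sum_range_succ]
      have := cutoff_le_one C v S N
      nlinarith [ih'.trans (min_le_left _ _)]
    · have : cutoff C v S N = 0 := by
        unfold cutoff
        exact max_eq_left ((min_le_right _ _).trans (by linarith))
      rw [this, zero_mul, add_zero]
      refine ih'.trans (min_le_min_right _ ?_)
      rw [Finset.sum_range_succ]
      linarith

/-- For `i ≥ n` the weight is at least `1 / √(R n)`, with `R` the tail bound, so the unweighted tail
is at most `√(R n)` times the weighted one. Nothing relates `S` to `m`: the bound holds for all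
values of the parameters. -/
theorem sum_cutoff_le {J : ℝ} {m : ℕ → ℝ} (hJ : HasSum m J) (hm : ∀ i, 0 ≤ m i) {S : ℕ → ℝ}
    (hS : ∀ i, 0 ≤ S i) (C n N : ℕ) :
    ∑ i ∈ Finset.Ico n N, cutoff C (fun i => (√(tailBound J m i))⁻¹) S i * S i ≤
      √(tailBound J m n) * (C + 1) := by
  have h1 := sum_cutoff_mul_le (C := C) (v := fun i => (√(tailBound J m i))⁻¹) (S := S)
    (fun i => mul_nonneg (by positivity) (hS i)) n N
  refine le_trans ?_ (mul_le_mul_of_nonneg_left h1 (Real.sqrt_nonneg _))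
  rw [Finset.mul_sum]
  refine Finset.sum_le_sum fun i hi => ?_
  have hi' := antitone_tailBound (J := J) hm (Finset.mem_Ico.1 hi).1
  have h2 : 1 ≤ √(tailBound J m n) * (√(tailBound J m i))⁻¹ := by
    rw [← div_eq_mul_inv, one_le_div (Real.sqrt_pos.2 (tailBound_pos hJ hm i))]
    exact Real.sqrt_le_sqrt hi'
  have h3 : 0 ≤ cutoff C (fun i => (√(tailBound J m i))⁻¹) S i * S i :=
    mul_nonneg (cutoff_nonneg _ _ _ _) (hS i)
  calc _ = 1 * (cutoff C (fun i => (√(tailBound J m i))⁻¹) S i * S i) := (one_mul _).symm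
    _ ≤ √(tailBound J m n) * (√(tailBound J m i))⁻¹ *
        (cutoff C (fun i => (√(tailBound J m i))⁻¹) S i * S i) := by gcongr
    _ = _ := by ring

theorem CMap.tailBound {J : B → ℝ} (hJ : CMap J) {m : ℕ → B → ℝ}
    (hm : CMap fun p : ℕ × B => m p.1 p.2) :
    CMap fun p : ℕ × B => tailBound (J p.2) (fun i => m i p.2) p.1 := by
  have hm' : CMap fun p : ℕ × ℕ × B => m p.1 p.2.2 :=
    hm.comp (g := fun p : ℕ × ℕ × B => (p.1, p.2.2)) (by fun_prop)
  unfold _root_.tailBound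
  have : CMap fun p : ℕ × B => ∑ i ∈ Finset.range p.1, m i p.2 :=
    CMap.sum (f := fun i (p : ℕ × B) => m i p.2) hm' (by fun_prop)
  fun_prop

theorem CMap.cutoff {v S : ℕ → B → ℝ} (hv : CMap fun p : ℕ × B => v p.1 p.2)
    (hS : CMap fun p : ℕ × B => S p.1 p.2) (C : ℕ) :
    CMap fun p : ℕ × B => cutoff C (fun i => v i p.2) (fun i => S i p.2) p.1 := by
  have h : CMap fun p : ℕ × ℕ × B => v p.1 p.2.2 * S p.1 p.2.2 :=
    (hv.comp (g := fun p : ℕ × ℕ × B => (p.1, p.2.2)) (by fun_prop)).mul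
      (hS.comp (g := fun p : ℕ × ℕ × B => (p.1, p.2.2)) (by fun_prop))
  unfold _root_.cutoff
  have : CMap fun p : ℕ × B => ∑ i ∈ Finset.range (p.1 + 1), v i p.2 * S i p.2 :=
    CMap.sum (f := fun i (p : ℕ × B) => v i p.2 * S i p.2) h (by fun_prop)
  fun_prop

end

/-! ### Integral tests as sums of computable functions -/

theorem coe_tsum_ofReal {u : ℕ → ℝ} (h0 : ∀ i, 0 ≤ u i) :
    ((∑' i, ENNReal.ofReal (u i) : ℝ≥0∞) : EReal) =
      ⨆ n : ℕ, ((∑ i ∈ Finset.range n, u i : ℝ) : EReal) := by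
  have h1 : Tendsto (fun n => ((∑ i ∈ Finset.range n, u i : ℝ) : EReal)) atTop
      (𝓝 ((∑' i, ENNReal.ofReal (u i) : ℝ≥0∞) : EReal)) := by
    have h2 := (continuous_coe_ennreal_ereal.tendsto _).comp
      (ENNReal.summable (f := fun i => ENNReal.ofReal (u i))).hasSum.tendsto_sum_nat
    refine h2.congr fun n => ?_
    rw [Function.comp, ← ENNReal.ofReal_sum_of_nonneg fun i _ => h0 i, EReal.coe_ennreal_ofReal,
      max_eq_left (Finset.sum_nonneg fun i _ => h0 i)]
  refine tendsto_nhds_unique h1 (tendsto_atTop_iSup fun a b hab => ?_)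
  exact EReal.coe_le_coe_iff.2 (Finset.sum_le_sum_of_subset_of_nonneg
    (Finset.range_mono hab) fun i _ _ => h0 i)

/-- The terms are the successive differences of the running maxima of `0` and the approximating
functions, truncated at `n`. Truncation keeps the supremum and bounds the terms, which makes their
integrals computable. -/
theorem IsLowerSemicomputable.exists_sum {Q : Type*} [BasicMetric Q] [EffectiveMetric Q]
    {t : Q → ℝ≥0∞} (ht : IsLowerSemicomputable t) :
    ∃ τ : ℕ → Q → ℝ, (CMap fun p : ℕ × Q => τ p.1 p.2) ∧ (∀ i q, 0 ≤ τ i q) ∧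
      (∀ i q, τ i q ≤ i + 1) ∧ ∀ q, t q = ∑' i, ENNReal.ofReal (τ i q) := by
  obtain ⟨g, hg, hsup⟩ := ht
  have hg := hg.cmap
  let H : ℕ → Q → ℝ := fun n q => Nat.rec 0 (fun k y => max y (g (k, q))) n
  have hH : CMap fun p : ℕ × Q => H p.1 p.2 :=
    CMap.natRec (Z := Q) (Y := ℝ) (g := fun _ => 0) (h := fun k y q => max y (g (k, q)))
      (by fun_prop) (by fun_prop)
  have hHs : ∀ n q, H (n + 1) q = max (H n q) (g (n, q)) := fun n q => rfl
  have hH0 : ∀ q, H 0 q = 0 := fun q => rfl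
  have hmono : ∀ n q, H n q ≤ H (n + 1) q := fun n q => by rw [hHs]; exact le_max_left _ _
  have hnn : ∀ n q, 0 ≤ H n q := fun n q => by
    induction n with
    | zero => exact le_rfl
    | succ n ih => exact ih.trans (hmono n q)
  let h : ℕ → Q → ℝ := fun n q => min n (H n q)
  have hh : CMap fun p : ℕ × Q => h p.1 p.2 := by
    change CMap fun p : ℕ × Q => min (p.1 : ℝ) (H p.1 p.2)
    fun_prop
  have h0 : ∀ q, h 0 q = 0 := fun q => by simp [h, hH0]
  have hhm : ∀ n q, h n q ≤ h (n + 1) q := fun n q =>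
    min_le_min (by push_cast; linarith) (hmono n q)
  have hh0 : ∀ n q, 0 ≤ h n q := fun n q => le_min (Nat.cast_nonneg n) (hnn n q)
  refine ⟨fun i q => h (i + 1) q - h i q, ?_, fun i q => sub_nonneg.2 (hhm i q), fun i q => ?_,
    fun q => ?_⟩
  · exact CMap.sub (hh.comp (g := fun p : ℕ × Q => (p.1 + 1, p.2)) (by fun_prop)) hh
  · have : h (i + 1) q ≤ i + 1 := (min_le_left _ _).trans (by push_cast; rfl)
    linarith [hh0 i q]
  · refine EReal.coe_ennreal_injective ?_
    rw [coe_tsum_ofReal fun i => sub_nonneg.2 (hhm i q)]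
    simp only [Finset.sum_range_sub (fun i => h i q), h0, sub_zero]
    have hgt : ∀ k, ((g (k, q) : ℝ) : EReal) ≤ t q := fun k => by
      rw [hsup]; exact le_iSup (fun n => ((g (n, q) : ℝ) : EReal)) k
    have hHt : ∀ n, Real.toEReal (H n q) ≤ (t q : EReal) := fun n => by
      induction n with
      | zero => rw [hH0]; exact EReal.coe_ennreal_nonneg _
      | succ n ih =>
        rw [hHs, EReal.coe_strictMono.monotone.map_max]
        exact max_le ih (hgt n)
    refine le_antisymm ?_ (iSup_le fun n => (EReal.coe_le_coe_iff.2 (min_le_right _ _)).trans (hHt n))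
    rw [hsup]
    refine iSup_le fun k => ?_
    -- The stage must be large enough both for the truncation not to bite and for the running
    -- maximum to include `g (k, q)`.
    obtain ⟨n, hn⟩ := exists_nat_ge (g (k, q))
    refine le_trans (EReal.coe_le_coe_iff.2 ?_) 
      (le_iSup (fun n => Real.toEReal (h n q)) (max n (k + 1)))
    refine le_min (hn.trans (by exact_mod_cast le_max_left _ _)) ?_
    have : H (k + 1) q ≤ H (max n (k + 1)) q :=
      monotone_nat_of_le_succ (f := fun n => H n q) (fun n => hmono n q)
        (le_max_right n (k + 1))
    exact (le_max_right _ _).trans this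

section
variable {A Z : Type*} [BasicMetric A] [EffectiveMetric A] [BasicMetric Z] [MeasurableSpace Z]
  [EffectiveMeasurable Z]

theorem lintegral_tsum_ofReal {μ : Measure Z} [IsFiniteMeasure μ] {u : ℕ → Z → ℝ}
    (hm : ∀ i, Measurable (u i)) (h0 : ∀ i z, 0 ≤ u i z) (hb : ∀ i, ∃ K, ∀ z, u i z ≤ K) :
    ∫⁻ z, ∑' i, ENNReal.ofReal (u i z) ∂μ = ∑' i, ENNReal.ofReal (∫ z, u i z ∂μ) := by
  rw [lintegral_tsum fun i => (hm i).ennreal_ofReal.aemeasurable]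
  congr 1
  ext1 i
  obtain ⟨K, hK⟩ := hb i
  rw [ofReal_integral_eq_lintegral_ofReal _ (ae_of_all _ (h0 i))]
  refine Integrable.of_bound (hm i).aestronglyMeasurable K (ae_of_all _ fun z => ?_)
  rw [Real.norm_of_nonneg (h0 i z)]
  exact hK z

theorem CMap.measurable_family {τ : ℕ → A × FiniteMeasure Z × Z → ℝ}
    (hτ : CMap fun p : ℕ × A × FiniteMeasure Z × Z => τ p.1 p.2) (i : ℕ) (a : A)
    (μ : FiniteMeasure Z) : Measurable fun z => τ i (a, μ, z) :=
  CMap.measurable_section (A := ℕ × A × FiniteMeasure Z)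
    (f := fun p => τ p.1.1 (p.1.2.1, p.1.2.2, p.2))
    (hτ.comp (g := fun p : (ℕ × A × FiniteMeasure Z) × Z => (p.1.1, p.1.2.1, p.1.2.2, p.2))
    (by fun_prop)) (i, a, μ)

theorem isUniformSchnorrTest_tsum {τ : ℕ → A × FiniteMeasure Z × Z → ℝ}
    (hτ : CMap fun p : ℕ × A × FiniteMeasure Z × Z => τ p.1 p.2) (h0 : ∀ i q, 0 ≤ τ i q)
    (hb : ∀ i a μ, ∃ K, ∀ z, τ i (a, μ, z) ≤ K)
    (hs : ∀ a (μ : FiniteMeasure Z), Summable fun i => ∫ z, τ i (a, μ, z) ∂(μ : Measure Z))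
    (hc : CMap fun p : A × FiniteMeasure Z => ∑' i, ∫ z, τ i (p.1, p.2, z) ∂(p.2 : Measure Z)) :
    IsUniformSchnorrTest fun q => ∑' i, ENNReal.ofReal (τ i q) := by
  have hm : ∀ i a μ, Measurable fun z => τ i (a, μ, z) := hτ.measurable_family
  have e : ∀ a (μ : FiniteMeasure Z), ∫⁻ z, ∑' i, ENNReal.ofReal (τ i (a, μ, z)) ∂(μ : Measure Z) =
      ENNReal.ofReal (∑' i, ∫ z, τ i (a, μ, z) ∂(μ : Measure Z)) := fun a μ => by
    rw [lintegral_tsum_ofReal (fun i => hm i a μ) (fun i z => h0 i _) (fun i => hb i a μ),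
      ENNReal.ofReal_tsum_of_nonneg (fun i => integral_nonneg fun z => h0 i _) (hs a μ)]
  refine ⟨⟨fun p => ∑ i ∈ Finset.range p.1, τ i p.2, ?_, fun q => coe_tsum_ofReal fun i => h0 i q⟩,
    fun a μ => ?_, ?_⟩
  · refine isComputableMap_iff.2 (CMap.sum (f := fun i (p : ℕ × A × FiniteMeasure Z × Z) => τ i p.2)
      ?_ (by fun_prop))
    exact hτ.comp (g := fun p : ℕ × ℕ × A × FiniteMeasure Z × Z => (p.1, p.2.2)) (by fun_prop)
  · rw [e]; exact ENNReal.ofReal_lt_top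
  · refine isComputableMap_iff.2 (hc.of_eq fun p => ?_)
    rw [e, ENNReal.toReal_ofReal (tsum_nonneg fun i => integral_nonneg fun z => h0 i _)]

theorem IsUniformSchnorrTest.exists_sum {t : A × FiniteMeasure Z × Z → ℝ≥0∞}
    (ht : IsUniformSchnorrTest t) :
    ∃ τ : ℕ → A × FiniteMeasure Z × Z → ℝ,
      (CMap fun p : ℕ × A × FiniteMeasure Z × Z => τ p.1 p.2) ∧ (∀ i q, 0 ≤ τ i q) ∧
      (∀ i q, τ i q ≤ i + 1) ∧ (∀ q, t q = ∑' i, ENNReal.ofReal (τ i q)) ∧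
      ∀ a (μ : FiniteMeasure Z), HasSum (fun i => ∫ z, τ i (a, μ, z) ∂(μ : Measure Z))
        (∫⁻ z, t (a, μ, z) ∂(μ : Measure Z)).toReal := by
  obtain ⟨τ, hτ, h0, hb, hsum⟩ := ht.lowerSemicomputable.exists_sum
  refine ⟨τ, hτ, h0, hb, hsum, fun a μ => ?_⟩
  have hm : ∀ i, Measurable fun z => τ i (a, μ, z) := fun i => hτ.measurable_family i a μ
  have h1 := ht.lintegral_lt_top a μ
  simp only [hsum] at h1 ⊢
  rw [lintegral_tsum_ofReal hm (fun i z => h0 i _) fun i => ⟨_, fun z => hb i _⟩] at h1 ⊢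
  have h2 := ENNReal.hasSum_toReal h1.ne
  simpa only [ENNReal.toReal_ofReal (integral_nonneg fun z => h0 _ (a, μ, z)),
    ENNReal.tsum_toReal_eq fun i => ENNReal.ofReal_ne_top] using h2

end

/-! ### Transformations of integral tests -/

theorem hasSum_integral_of_nonneg {Z : Type*} [MeasurableSpace Z] {μ : Measure Z} {F : ℕ → Z → ℝ}
    {f : Z → ℝ} (hF : ∀ i, Measurable (F i)) (h0 : ∀ i z, 0 ≤ F i z)
    (hs : ∀ z, HasSum (fun i => F i z) (f z)) (hf : Integrable f μ) :
    HasSum (fun i => ∫ z, F i z ∂μ) (∫ z, f z ∂μ) := by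
  refine hasSum_integral_of_dominated_convergence F (fun i => (hF i).aestronglyMeasurable)
    (fun i => ae_of_all _ fun z => by rw [Real.norm_of_nonneg (h0 i z)])
    (ae_of_all _ fun z => (hs z).summable) ?_ (ae_of_all _ hs)
  simpa only [(hs _).tsum_eq] using hf

theorem IsLowerSemicomputable.comp {P Q : Type*} [BasicMetric P] [EffectiveMetric P] [BasicMetric Q]
    [EffectiveMetric Q] {t : Q → ℝ≥0∞} (ht : IsLowerSemicomputable t) {f : P → Q} (hf : CMap f) :
    IsLowerSemicomputable fun p => t (f p) := by
  obtain ⟨g, hg, h⟩ := ht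
  exact ⟨fun p => g (p.1, f p.2), isComputableMap_iff.2
    (hg.cmap.comp (g := fun p : ℕ × P => (p.1, f p.2)) (by fun_prop)), fun p => h _⟩

section
variable {A A' Z W : Type*} [BasicMetric A] [EffectiveMetric A] [BasicMetric A'] [EffectiveMetric A']
  [BasicMetric Z] [MeasurableSpace Z] [EffectiveMeasurable Z]
  [BasicMetric W] [MeasurableSpace W] [EffectiveMeasurable W]

theorem IsUniformSchnorrTest.measurable_section {t : A × FiniteMeasure Z × Z → ℝ≥0∞}
    (ht : IsUniformSchnorrTest t) (a : A) (μ : FiniteMeasure Z) : Measurable fun z => t (a, μ, z) := by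
  obtain ⟨τ, hτ, -, -, hsum, -⟩ := ht.exists_sum
  simp only [hsum]
  exact Measurable.tsum fun i => (hτ.measurable_family i a μ).ennreal_ofReal

/-- By change of variables the integral is that of `t` at the transported parameters. The new oracle
`α` may depend on the measure, which lets a marginal become an oracle. -/
theorem IsUniformSchnorrTest.comap {t : A × FiniteMeasure W × W → ℝ≥0∞} (ht : IsUniformSchnorrTest t)
    {α : A' × FiniteMeasure Z → A} (hα : CMap α) {φ : Z → W} (hφ : CMap φ) (hm : Measurable φ) :
    IsUniformSchnorrTest fun q : A' × FiniteMeasure Z × Z =>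
      t (α (q.1, q.2.1), q.2.1.map φ, φ q.2.2) := by
  have e : ∀ a (μ : FiniteMeasure Z), ∫⁻ z, t (α (a, μ), μ.map φ, φ z) ∂(μ : Measure Z) =
      ∫⁻ w, t (α (a, μ), μ.map φ, w) ∂(μ.map φ : Measure W) := fun a μ => by
    rw [FiniteMeasure.toMeasure_map, lintegral_map (ht.measurable_section _ _) hm]
  have h1 := ht.computable_integral.cmap
  refine ⟨ht.lowerSemicomputable.comp (f := fun q : A' × FiniteMeasure Z × Z =>
    (α (q.1, q.2.1), q.2.1.map φ, φ q.2.2)) ?_, fun a μ => ?_, ?_⟩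
  · have := hφ.finiteMeasureMap hm (μ := fun q : A' × FiniteMeasure Z × Z => q.2.1) (by fun_prop)
    fun_prop
  · rw [e]; exact ht.lintegral_lt_top _ _
  · simp only [e]
    refine isComputableMap_iff.2 (h1.comp (g := fun p : A' × FiniteMeasure Z =>
      (α (p.1, p.2), p.2.map φ)) ?_)
    have := hφ.finiteMeasureMap hm (μ := fun q : A' × FiniteMeasure Z => q.2) (by fun_prop)
    fun_prop

theorem mem_schnorrRandomRel_map {φ : Z → W} (hφ : CMap φ) (hm : Measurable φ)
    {α : A' × FiniteMeasure Z → A} (hα : CMap α) {a : A'} {μ : FiniteMeasure Z} {z : Z}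
    (hz : z ∈ schnorrRandomRel a μ) : φ z ∈ schnorrRandomRel (α (a, μ)) (μ.map φ) :=
  fun _ ht => hz _ (ht.comap hα hφ hm)

/-- The weights that turn a convergent series into a series with controlled tails. -/
def tailWeight (J : ℝ) (m : ℕ → ℝ) (i : ℕ) : ℝ := (√(tailBound J m i))⁻¹

theorem tailWeight_nonneg (J : ℝ) (m : ℕ → ℝ) (i : ℕ) : 0 ≤ tailWeight J m i := by
  unfold tailWeight; positivity

theorem CMap.tailWeight {J : A → ℝ} (hJ : CMap J) {m : ℕ → A → ℝ}
    (hm : CMap fun p : ℕ × A => m p.1 p.2) (hm0 : ∀ i a, 0 ≤ m i a)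
    (hs : ∀ a, HasSum (fun i => m i a) (J a)) :
    CMap fun p : ℕ × A => tailWeight (J p.2) (fun i => m i p.2) p.1 :=
  CMap.inv (CMap.sqrt (CMap.tailBound hJ hm)) fun p =>
    Real.sqrt_pos.2 (tailBound_pos (hs p.2) (fun i => hm0 i p.2) _)

/-- A computable series of functions whose integrals have a computable sum converges at each random
point even with the weights of the series of the integrals. -/
theorem exists_sum_tailWeight_le_of_mem_schnorrRandomRel {S : ℕ → A × FiniteMeasure Z × Z → ℝ}
    (hS : CMap fun p : ℕ × A × FiniteMeasure Z × Z => S p.1 p.2) (hS0 : ∀ i q, 0 ≤ S i q)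
    (hb : ∀ i a μ, ∃ K, ∀ z, S i (a, μ, z) ≤ K) {m : ℕ → A × FiniteMeasure Z → ℝ}
    (hm : CMap fun p : ℕ × A × FiniteMeasure Z => m p.1 p.2)
    (hmS : ∀ i a (μ : FiniteMeasure Z), ∫ z, S i (a, μ, z) ∂(μ : Measure Z) = m i (a, μ))
    {J : A × FiniteMeasure Z → ℝ} (hJ : CMap J) (hs : ∀ p, HasSum (fun i => m i p) (J p))
    {a : A} {μ : FiniteMeasure Z} {z : Z} (hz : z ∈ schnorrRandomRel a μ) :
    ∃ C : ℕ, ∀ n, ∑ i ∈ Finset.range n, tailWeight (J (a, μ)) (fun i => m i (a, μ)) i *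
      S i (a, μ, z) ≤ C := by
  let v : ℕ → A × FiniteMeasure Z → ℝ := fun i p => tailWeight (J p) (fun i => m i p) i
  have hm0 : ∀ i p, 0 ≤ m i p := fun i p => by
    rw [← hmS i p.1 p.2]; exact integral_nonneg fun z => hS0 _ _
  have hv : CMap fun p : ℕ × A × FiniteMeasure Z => v p.1 p.2 := CMap.tailWeight hJ hm hm0 hs
  have hv0 : ∀ i p, 0 ≤ v i p := fun i p => tailWeight_nonneg _ _ _
  have hR : CMap fun p : ℕ × A × FiniteMeasure Z => tailBound (J p.2) (fun i => m i p.2) p.1 :=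
    CMap.tailBound hJ hm
  have htail : ∀ p n N, n ≤ N → ∑ i ∈ Finset.Ico n N, v i p * m i p ≤
      2 * √(tailBound (J p) (fun i => m i p) n) := fun p n N h =>
    sum_div_sqrt_tailBound_le (hs p) (fun i => hm0 i p) h
  have hint : ∀ i a (μ : FiniteMeasure Z), ∫ z, v i (a, μ) * S i (a, μ, z) ∂(μ : Measure Z) =
      v i (a, μ) * m i (a, μ) := fun i a μ => by
    rw [integral_const_mul, hmS]
  have htest : IsUniformSchnorrTest fun q : A × FiniteMeasure Z × Z =>
      ∑' i, ENNReal.ofReal (v i (q.1, q.2.1) * S i q) := by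
    refine isUniformSchnorrTest_tsum (τ := fun i q => v i (q.1, q.2.1) * S i q) ?_
      (fun i q => mul_nonneg (hv0 _ _) (hS0 _ _)) (fun i a μ => ?_) (fun a μ => ?_) ?_
    · exact (hv.comp (g := fun p : ℕ × A × FiniteMeasure Z × Z => (p.1, p.2.1, p.2.2.1))
        (by fun_prop)).mul hS
    · obtain ⟨K, hK⟩ := hb i a μ
      exact ⟨v i (a, μ) * K, fun z => mul_le_mul_of_nonneg_left (hK z) (hv0 _ _)⟩
    · simp only [hint]
      exact summable_of_tail_le (fun i => mul_nonneg (hv0 i _) (hm0 i _)) (htail _)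
    · simp only [hint]
      refine CMap.tsum (u := fun i p => v i p * m i p)
        (e := fun n p => 2 * √(tailBound (J p) (fun i => m i p) n)) (hv.mul hm)
        (fun i p => mul_nonneg (hv0 i p) (hm0 i p)) (by fun_prop) (fun p => ?_) htail
      simpa using (tendsto_sqrt_tailBound (hs p)).const_mul 2
  have hfin := hz _ htest
  dsimp only at hfin
  -- Only the existence of a bound at this one point matters; `C` need not depend computably on
  -- anything.
  obtain ⟨C, hC⟩ := exists_nat_ge (∑' i, ENNReal.ofReal (v i (a, μ) * S i (a, μ, z))).toReal
  refine ⟨C, fun n => le_trans ?_ hC⟩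
  have h1 : ∀ i, 0 ≤ v i (a, μ) * S i (a, μ, z) := fun i => mul_nonneg (hv0 _ _) (hS0 _ _)
  have h2 := ENNReal.toReal_mono hfin.ne (ENNReal.sum_le_tsum (Finset.range n))
  rwa [← ENNReal.ofReal_sum_of_nonneg fun i _ => h1 i,
    ENNReal.toReal_ofReal (Finset.sum_nonneg fun i _ => h1 i)] at h2

/-- A computable series of functions converges at each random point at which the integrals of
its terms, although not uniformly controlled, have bounded weighted partial sums. -/
theorem tsum_lt_top_of_mem_schnorrRandomRel {σ : ℕ → A × FiniteMeasure Z × Z → ℝ}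
    (hσ : CMap fun p : ℕ × A × FiniteMeasure Z × Z => σ p.1 p.2) (h0 : ∀ i q, 0 ≤ σ i q)
    (hb : ∀ i q, σ i q ≤ i + 1) {m : ℕ → A × FiniteMeasure Z → ℝ}
    (hm : CMap fun p : ℕ × A × FiniteMeasure Z => m p.1 p.2) (hm0 : ∀ i p, 0 ≤ m i p)
    {J : A × FiniteMeasure Z → ℝ} (hJ : CMap J) (hs : ∀ p, HasSum (fun i => m i p) (J p))
    {a : A} {μ : FiniteMeasure Z} {z : Z} (hz : z ∈ schnorrRandomRel a μ) {C : ℕ}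
    (hC : ∀ n, ∑ i ∈ Finset.range n, tailWeight (J (a, μ)) (fun i => m i (a, μ)) i *
      ∫ z, σ i (a, μ, z) ∂(μ : Measure Z) ≤ C) :
    ∑' i, ENNReal.ofReal (σ i (a, μ, z)) < ∞ := by
  let S : ℕ → A × FiniteMeasure Z → ℝ := fun i p => ∫ z, σ i (p.1, p.2, z) ∂(p.2 : Measure Z)
  let v : ℕ → A × FiniteMeasure Z → ℝ := fun i p => tailWeight (J p) (fun i => m i p) i
  -- `C` is a fixed number, whereas weights and integrals vary with the parameters; the factor is
  -- therefore computable and tames the series at all parameters.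
  let θ : ℕ → A × FiniteMeasure Z → ℝ := fun i p => cutoff C (fun i => v i p) (fun i => S i p) i
  have hS : CMap fun p : ℕ × A × FiniteMeasure Z => S p.1 p.2 :=
    CMap.integral (f := fun (p : ℕ × A × FiniteMeasure Z) z => σ p.1 (p.2.1, p.2.2, z))
      (K := fun p => p.1 + 1)
      (hσ.comp (g := fun p : (ℕ × A × FiniteMeasure Z) × Z => (p.1.1, p.1.2.1, p.1.2.2, p.2))
        (by fun_prop)) (by fun_prop)
      (fun p z => by rw [abs_of_nonneg (h0 _ _)]; exact hb _ _) (by fun_prop)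
  have hS0 : ∀ i p, 0 ≤ S i p := fun i p => integral_nonneg fun z => h0 _ _
  have hv : CMap fun p : ℕ × A × FiniteMeasure Z => v p.1 p.2 := CMap.tailWeight hJ hm hm0 hs
  have hθ : CMap fun p : ℕ × A × FiniteMeasure Z => θ p.1 p.2 := CMap.cutoff hv hS C
  have hR : CMap fun p : ℕ × A × FiniteMeasure Z => tailBound (J p.2) (fun i => m i p.2) p.1 :=
    CMap.tailBound hJ hm
  have htail : ∀ p n N, n ≤ N → ∑ i ∈ Finset.Ico n N, θ i p * S i p ≤
      √(tailBound (J p) (fun i => m i p) n) * (C + 1) := fun p n N _ =>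
    sum_cutoff_le (hs p) (fun i => hm0 i p) (fun i => hS0 i p) C n N
  have hθS0 : ∀ i p, 0 ≤ θ i p * S i p := fun i p => mul_nonneg (cutoff_nonneg _ _ _ _) (hS0 i p)
  have hint : ∀ i a (μ : FiniteMeasure Z), ∫ z, θ i (a, μ) * σ i (a, μ, z) ∂(μ : Measure Z) =
      θ i (a, μ) * S i (a, μ) := fun i a μ => integral_const_mul _ _
  have htest : IsUniformSchnorrTest fun q : A × FiniteMeasure Z × Z =>
      ∑' i, ENNReal.ofReal (θ i (q.1, q.2.1) * σ i q) := by
    refine isUniformSchnorrTest_tsum (τ := fun i q => θ i (q.1, q.2.1) * σ i q) ?_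
      (fun i q => mul_nonneg (cutoff_nonneg _ _ _ _) (h0 i q)) (fun i a μ => ⟨i + 1, fun z => ?_⟩)
      (fun a μ => ?_) ?_
    · have := hθ.comp (g := fun p : ℕ × A × FiniteMeasure Z × Z => (p.1, p.2.1, p.2.2.1))
        (by fun_prop)
      exact this.mul hσ
    · have := cutoff_le_one C (fun i => v i (a, μ)) (fun i => S i (a, μ)) i
      exact (mul_le_of_le_one_left (h0 _ _) this).trans (hb _ _)
    · simp only [hint]
      exact summable_of_tail_le (fun i => hθS0 i (a, μ)) (htail (a, μ))
    · simp only [hint]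
      refine CMap.tsum (u := fun i p => θ i p * S i p)
        (e := fun n p => √(tailBound (J p) (fun i => m i p) n) * (C + 1)) (hθ.mul hS) hθS0
        (by fun_prop) (fun p => ?_) htail
      simpa using (tendsto_sqrt_tailBound (hs p)).mul_const ((C : ℝ) + 1)
  have h1 := hz _ htest
  -- At the given parameters the weighted sums never exceed `C`, so the test just built coincides
  -- with the original series.
  have h2 : ∀ i, θ i (a, μ) = 1 := fun i => cutoff_eq_one (hC (i + 1))
  simpa only [h2, one_mul] using h1

end

/-! ### Randomness with respect to product measures -/

section
variable {X Y : Type*} [BasicMetric X] [MeasurableSpace X] [EffectiveMeasurable X]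
  [BasicMetric Y] [MeasurableSpace Y] [EffectiveMeasurable Y]

omit [BasicMetric X] [EffectiveMeasurable X] [BasicMetric Y] [EffectiveMeasurable Y] in
theorem toFiniteMeasure_prod (μ : ProbabilityMeasure X) (ν : ProbabilityMeasure Y) :
    (μ.prod ν).toFiniteMeasure = μ.toFiniteMeasure.prod ν.toFiniteMeasure := rfl

theorem map_fst_toFiniteMeasure_prod (μ : ProbabilityMeasure X) (ν : ProbabilityMeasure Y) :
    (μ.prod ν).toFiniteMeasure.map Prod.fst = μ.toFiniteMeasure := by
  rw [toFiniteMeasure_prod, FiniteMeasure.map_fst_prod]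
  simp

theorem map_snd_toFiniteMeasure_prod (μ : ProbabilityMeasure X) (ν : ProbabilityMeasure Y) :
    (μ.prod ν).toFiniteMeasure.map Prod.snd = ν.toFiniteMeasure := by
  rw [toFiniteMeasure_prod, FiniteMeasure.map_snd_prod]
  simp

theorem map_swap_toFiniteMeasure_prod (μ : ProbabilityMeasure X) (ν : ProbabilityMeasure Y) :
    (μ.prod ν).toFiniteMeasure.map Prod.swap = (ν.prod μ).toFiniteMeasure := by
  rw [toFiniteMeasure_prod, FiniteMeasure.prod_swap]
  rfl

theorem swap_mem_schnorrRandom_prod {μ : ProbabilityMeasure X} {ν : ProbabilityMeasure Y} {x : X}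
    {y : Y} (h : (x, y) ∈ schnorrRandom (μ.prod ν).toFiniteMeasure) :
    (y, x) ∈ schnorrRandom (ν.prod μ).toFiniteMeasure := by
  have := mem_schnorrRandomRel_map (φ := fun p : X × Y => (p.2, p.1)) (by fun_prop)
    measurable_swap (α := fun p => p.1) (by fun_prop) h
  rw [← map_swap_toFiniteMeasure_prod]
  exact this

/-- Push forward along the first projection, with the second marginal as the oracle; `toProbability`
supplies an oracle even when the measure on the product has mass other than `1`. -/
theorem fst_mem_schnorrRandomRel {μ : ProbabilityMeasure X} {ν : ProbabilityMeasure Y} {x : X}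
    {y : Y} (h : (x, y) ∈ schnorrRandom (μ.prod ν).toFiniteMeasure) :
    x ∈ schnorrRandomRel ν μ.toFiniteMeasure := by
  have hα : CMap fun p : Unit × FiniteMeasure (X × Y) => toProbability (p.2.map Prod.snd) := by
    have := CMap.finiteMeasureMap (φ := fun p : X × Y => p.2) (by fun_prop) measurable_snd
      (μ := fun p : Unit × FiniteMeasure (X × Y) => p.2) (by fun_prop)
    exact this.toProbability
  have := mem_schnorrRandomRel_map (φ := fun p : X × Y => p.1) (by fun_prop)
    measurable_fst hα h
  dsimp only at this
  rw [map_snd_toFiniteMeasure_prod, toProbability_toFiniteMeasure] at this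
  rw [← map_fst_toFiniteMeasure_prod μ ν]
  exact this

theorem integral_prod_of_bounded {μ : FiniteMeasure X} {ν : FiniteMeasure Y} {f : X × Y → ℝ}
    (hf : Measurable f) (h0 : ∀ p, 0 ≤ f p) {K : ℝ} (hK : ∀ p, f p ≤ K) :
    ∫ p, f p ∂(μ.prod ν : Measure (X × Y)) =
      ∫ x, ∫ y, f (x, y) ∂(ν : Measure Y) ∂(μ : Measure X) := by
  rw [FiniteMeasure.toMeasure_prod]
  refine integral_prod _ (Integrable.of_bound hf.aestronglyMeasurable K (ae_of_all _ fun p => ?_))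
  rw [Real.norm_of_nonneg (h0 p)]
  exact hK p

/-- The section of a product test at `x` has finite but possibly noncomputable integral. Randomness
of `x` bounds the weighted series of section integrals, and this bound is what the cutoff for `y`
requires. -/
theorem mem_schnorrRandom_prod {μ : ProbabilityMeasure X} {ν : ProbabilityMeasure Y} {x : X} {y : Y}
    (hx : x ∈ schnorrRandomRel ν μ.toFiniteMeasure)
    (hy : y ∈ schnorrRandomRel (μ, x) ν.toFiniteMeasure) :
    (x, y) ∈ schnorrRandom (μ.prod ν).toFiniteMeasure := by
  intro t ht
  obtain ⟨τ, hτ, h0, hb, hsum, hI⟩ := ht.exists_sum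
  have habs : ∀ i q, |τ i q| ≤ i + 1 := fun i q => by rw [abs_of_nonneg (h0 _ _)]; exact hb _ _
  let J : FiniteMeasure X × FiniteMeasure Y → ℝ := fun p =>
    (∫⁻ q, t ((), p.1.prod p.2, q) ∂(p.1.prod p.2 : Measure (X × Y))).toReal
  let m : ℕ → FiniteMeasure X × FiniteMeasure Y → ℝ := fun i p =>
    ∫ q, τ i ((), p.1.prod p.2, q) ∂(p.1.prod p.2 : Measure (X × Y))
  let S : ℕ → (FiniteMeasure X × FiniteMeasure Y) × X → ℝ := fun i p =>
    ∫ y, τ i ((), p.1.1.prod p.1.2, (p.2, y)) ∂(p.1.2 : Measure Y)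
  have hJ : CMap J := ht.computable_integral.cmap.comp
    (g := fun p : FiniteMeasure X × FiniteMeasure Y => ((), p.1.prod p.2)) (by fun_prop)
  have hm : CMap fun p : ℕ × FiniteMeasure X × FiniteMeasure Y => m p.1 p.2 :=
    CMap.integral (f := fun (p : ℕ × FiniteMeasure X × FiniteMeasure Y) q =>
        τ p.1 ((), p.2.1.prod p.2.2, q)) (K := fun p => p.1 + 1)
      (hτ.comp (g := fun p : (ℕ × FiniteMeasure X × FiniteMeasure Y) × X × Y =>
        (p.1.1, (), p.1.2.1.prod p.1.2.2, p.2)) (by fun_prop)) (by fun_prop)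
      (fun p z => habs _ _) (by fun_prop)
  have hS : CMap fun p : ℕ × (FiniteMeasure X × FiniteMeasure Y) × X => S p.1 p.2 :=
    CMap.integral (f := fun (p : ℕ × (FiniteMeasure X × FiniteMeasure Y) × X) y =>
        τ p.1 ((), p.2.1.1.prod p.2.1.2, (p.2.2, y))) (K := fun p => p.1 + 1)
      (hτ.comp (g := fun p : (ℕ × (FiniteMeasure X × FiniteMeasure Y) × X) × Y =>
        (p.1.1, (), p.1.2.1.1.prod p.1.2.1.2, (p.1.2.2, p.2))) (by fun_prop)) (by fun_prop)
      (fun p z => habs _ _) (by fun_prop)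
  have hm0 : ∀ i p, 0 ≤ m i p := fun i p => integral_nonneg fun q => h0 _ _
  have hS0 : ∀ i p, 0 ≤ S i p := fun i p => integral_nonneg fun q => h0 _ _
  have hs : ∀ p, HasSum (fun i => m i p) (J p) := fun p => hI () _
  have hmS : ∀ i p, ∫ x, S i (p, x) ∂(p.1 : Measure X) = m i p := fun i p =>
    (integral_prod_of_bounded (μ := p.1) (ν := p.2) (hτ.measurable_family i () (p.1.prod p.2))
      (fun _ => h0 _ _) fun _ => hb _ _).symm
  have hSb : ∀ i p, S i p ≤ (i + 1) * (p.1.2 : Measure Y).real Set.univ := fun i p =>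
    (le_abs_self _).trans (norm_integral_le_of_norm_le_const (C := (i : ℝ) + 1)
      (f := fun y => τ i ((), p.1.1.prod p.1.2, (p.2, y))) (ae_of_all _ fun y => habs i _))
  -- Randomness of `x` with oracle `ν`: the section integrals `S i` have the integrals `m i` by
  -- Fubini's theorem, with computable sum `J`.
  obtain ⟨C, hC⟩ := exists_sum_tailWeight_le_of_mem_schnorrRandomRel
    (S := fun i (q : ProbabilityMeasure Y × FiniteMeasure X × X) =>
      S i ((q.2.1, q.1.toFiniteMeasure), q.2.2))
    (hS.comp (g := fun p : ℕ × ProbabilityMeasure Y × FiniteMeasure X × X =>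
      (p.1, (p.2.2.1, p.2.1.toFiniteMeasure), p.2.2.2)) (by fun_prop)) (fun i q => hS0 _ _)
    (fun i ρ κ => ⟨(i + 1) * (ρ.toFiniteMeasure : Measure Y).real Set.univ, fun z =>
      hSb i ((κ, ρ.toFiniteMeasure), z)⟩)
    (m := fun i p => m i (p.2, p.1.toFiniteMeasure))
    (hm.comp (g := fun p : ℕ × ProbabilityMeasure Y × FiniteMeasure X =>
      (p.1, p.2.2, p.2.1.toFiniteMeasure)) (by fun_prop))
    (fun i ρ κ => hmS i (κ, ρ.toFiniteMeasure)) (J := fun p => J (p.2, p.1.toFiniteMeasure))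
    (hJ.comp (g := fun p : ProbabilityMeasure Y × FiniteMeasure X =>
      (p.2, p.1.toFiniteMeasure)) (by fun_prop)) (fun p => hs _) hx
  -- Randomness of `y` with oracle `(μ, x)`; the weights are those of the previous step, so the
  -- bound `hC` is the required hypothesis.
  have key := tsum_lt_top_of_mem_schnorrRandomRel
    (σ := fun i (q : (ProbabilityMeasure X × X) × FiniteMeasure Y × Y) =>
      τ i ((), q.1.1.toFiniteMeasure.prod q.2.1, (q.1.2, q.2.2)))
    (hτ.comp (g := fun p : ℕ × (ProbabilityMeasure X × X) × FiniteMeasure Y × Y =>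
      (p.1, (), p.2.1.1.toFiniteMeasure.prod p.2.2.1, (p.2.1.2, p.2.2.2))) (by fun_prop))
    (fun i q => h0 _ _) (fun i q => hb _ _)
    (m := fun i p => m i (p.1.1.toFiniteMeasure, p.2))
    (hm.comp (g := fun p : ℕ × (ProbabilityMeasure X × X) × FiniteMeasure Y =>
      (p.1, p.2.1.1.toFiniteMeasure, p.2.2)) (by fun_prop)) (fun i p => hm0 _ _)
    (J := fun p => J (p.1.1.toFiniteMeasure, p.2))
    (hJ.comp (g := fun p : (ProbabilityMeasure X × X) × FiniteMeasure Y =>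
      (p.1.1.toFiniteMeasure, p.2)) (by fun_prop)) (fun p => hs _) hy (C := C) hC
  rw [hsum]
  exact key

/-- The integral `I` of a test for `y` may fail to be integrable in `x`, so the test is divided by
`1 + I`. The weights come from the marginals, and the cutoff deals with measures that are not
products of their marginals. -/
theorem snd_mem_schnorrRandomRel {μ : ProbabilityMeasure X} {ν : ProbabilityMeasure Y} {x : X}
    {y : Y} (h : (x, y) ∈ schnorrRandom (μ.prod ν).toFiniteMeasure) :
    y ∈ schnorrRandomRel (μ, x) ν.toFiniteMeasure := by
  intro t ht
  obtain ⟨τ, hτ, h0, hb, hsum, hI⟩ := ht.exists_sum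
  have habs : ∀ i q, |τ i q| ≤ i + 1 := fun i q => by rw [abs_of_nonneg (h0 _ _)]; exact hb _ _
  let I : (ProbabilityMeasure X × X) × FiniteMeasure Y → ℝ := fun p =>
    (∫⁻ z, t (p.1, p.2, z) ∂(p.2 : Measure Y)).toReal
  have hI0 : ∀ p, 0 ≤ I p := fun p => ENNReal.toReal_nonneg
  have hI1 : ∀ p, 0 < 1 + I p := fun p => by linarith [hI0 p]
  have hIc : CMap I := ht.computable_integral.cmap
  let par : FiniteMeasure (X × Y) × X → (ProbabilityMeasure X × X) × FiniteMeasure Y := fun p =>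
    ((toProbability (p.1.map Prod.fst), p.2), p.1.map Prod.snd)
  have hfst : CMap fun κ : FiniteMeasure (X × Y) => κ.map Prod.fst :=
    CMap.finiteMeasureMap (φ := fun p : X × Y => p.1) (by fun_prop) measurable_fst (by fun_prop)
  have hsnd : CMap fun κ : FiniteMeasure (X × Y) => κ.map Prod.snd :=
    CMap.finiteMeasureMap (φ := fun p : X × Y => p.2) (by fun_prop) measurable_snd (by fun_prop)
  have hpar : CMap par := by
    have h1 := hfst.comp (g := fun p : FiniteMeasure (X × Y) × X => p.1) (by fun_prop)
    have h2 := hsnd.comp (g := fun p : FiniteMeasure (X × Y) × X => p.1) (by fun_prop)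
    exact (h1.toProbability.pair CMap.snd_aux).pair h2
  let r : FiniteMeasure (X × Y) × X → ℝ := fun p => I (par p) / (1 + I (par p))
  have hr : CMap r := CMap.div (by fun_prop) (by fun_prop) fun p => hI1 _
  have hr0 : ∀ p, 0 ≤ r p := fun p => div_nonneg (hI0 _) (hI1 _).le
  have hr1 : ∀ p, r p ≤ 1 := fun p => (div_le_one (hI1 _)).2 (by linarith [hI0 (par p)])
  let s : ℕ → FiniteMeasure (X × Y) × X → ℝ := fun i p =>
    (∫ z, τ i ((par p).1, (par p).2, z) ∂((par p).2 : Measure Y)) / (1 + I (par p))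
  have hs : CMap fun p : ℕ × FiniteMeasure (X × Y) × X => s p.1 p.2 := by
    refine CMap.div (CMap.integral (f := fun (p : ℕ × FiniteMeasure (X × Y) × X) z =>
        τ p.1 ((par p.2).1, (par p.2).2, z)) (K := fun p => p.1 + 1) ?_ (by fun_prop)
        (fun p z => habs _ _) (by fun_prop)) (by fun_prop) fun p => hI1 _
    exact hτ.comp (g := fun p : (ℕ × FiniteMeasure (X × Y) × X) × Y =>
      (p.1.1, (par p.1.2).1, (par p.1.2).2, p.2)) (by fun_prop)
  have hs0 : ∀ i p, 0 ≤ s i p := fun i p => div_nonneg (integral_nonneg fun z => h0 _ _) (hI1 _).le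
  have hsr : ∀ p, HasSum (fun i => s i p) (r p) := fun p => (hI (par p).1 (par p).2).div_const _
  have hs1 : ∀ i p, s i p ≤ 1 := fun i p =>
    (le_hasSum (hsr p) i fun j _ => hs0 j p).trans (hr1 p)
  have hrm : ∀ κ, Measurable fun x => r (κ, x) := fun κ => hr.measurable_section κ
  have hsm : ∀ i κ, Measurable fun x => s i (κ, x) := fun i κ =>
    CMap.measurable_section (A := ℕ × FiniteMeasure (X × Y)) (f := fun p => s p.1.1 (p.1.2, p.2))
      (hs.comp (g := fun p : (ℕ × FiniteMeasure (X × Y)) × X => (p.1.1, p.1.2, p.2)) (by fun_prop))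
      (i, κ)
  -- `J` and `m` use only the marginals, so they are computable and satisfy `∑ m i = J` for every
  -- measure on the product space.
  let J : Unit × FiniteMeasure (X × Y) → ℝ := fun p =>
    ∫ x, r (p.2, x) ∂(p.2.map Prod.fst : Measure X)
  let m : ℕ → Unit × FiniteMeasure (X × Y) → ℝ := fun i p =>
    ∫ x, s i (p.2, x) ∂(p.2.map Prod.fst : Measure X)
  have hJ : CMap J := by
    have := hfst.comp (g := fun p : Unit × FiniteMeasure (X × Y) => p.2) (by fun_prop)
    exact CMap.integral (f := fun (p : Unit × FiniteMeasure (X × Y)) x => r (p.2, x))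
      (K := fun _ => 1) (by fun_prop) (by fun_prop)
      (fun p x => by rw [abs_of_nonneg (hr0 _)]; exact hr1 _) this
  have hm : CMap fun p : ℕ × Unit × FiniteMeasure (X × Y) => m p.1 p.2 := by
    have := hfst.comp (g := fun p : ℕ × Unit × FiniteMeasure (X × Y) => p.2.2) (by fun_prop)
    refine CMap.integral (f := fun (p : ℕ × Unit × FiniteMeasure (X × Y)) x => s p.1 (p.2.2, x))
      (K := fun _ => 1) ?_ (by fun_prop)
      (fun p x => by rw [abs_of_nonneg (hs0 _ _)]; exact hs1 _ _) this
    exact hs.comp (g := fun p : (ℕ × Unit × FiniteMeasure (X × Y)) × X => (p.1.1, p.1.2.2, p.2))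
      (by fun_prop)
  have hm0 : ∀ i p, 0 ≤ m i p := fun i p => integral_nonneg fun x => hs0 _ _
  have hmJ : ∀ p, HasSum (fun i => m i p) (J p) := fun p => by
    refine hasSum_integral_of_nonneg (fun i => hsm i p.2) (fun i x => hs0 _ _) (fun x => hsr _)
      (Integrable.of_bound (hrm p.2).aestronglyMeasurable 1 (ae_of_all _ fun x => ?_))
    rw [Real.norm_of_nonneg (hr0 _)]
    exact hr1 _
  let σ : ℕ → Unit × FiniteMeasure (X × Y) × X × Y → ℝ := fun i q =>
    τ i ((par (q.2.1, q.2.2.1)).1, (par (q.2.1, q.2.2.1)).2, q.2.2.2) / (1 + I (par (q.2.1, q.2.2.1)))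
  have hσ : CMap fun p : ℕ × Unit × FiniteMeasure (X × Y) × X × Y => σ p.1 p.2 := by
    refine CMap.div ?_ (by fun_prop) fun p => hI1 _
    exact hτ.comp (g := fun p : ℕ × Unit × FiniteMeasure (X × Y) × X × Y =>
      (p.1, (par (p.2.2.1, p.2.2.2.1)).1, (par (p.2.2.1, p.2.2.2.1)).2, p.2.2.2.2)) (by fun_prop)
  have hσ0 : ∀ i q, 0 ≤ σ i q := fun i q => div_nonneg (h0 _ _) (hI1 _).le
  have hσ1 : ∀ i q, σ i q ≤ i + 1 := fun i q =>
    (div_le_self (h0 _ _) (by linarith [hI0 (par (q.2.1, q.2.2.1))])).trans (hb _ _)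
  have hpar0 : ∀ x, par ((μ.prod ν).toFiniteMeasure, x) = ((μ, x), ν.toFiniteMeasure) := fun x => by
    simp only [par, map_fst_toFiniteMeasure_prod, map_snd_toFiniteMeasure_prod,
      toProbability_toFiniteMeasure]
  -- Only at a product measure does Fubini's theorem identify the integral of `σ i` with the
  -- expression `m i` in the marginals.
  have hσm : ∀ i, ∫ q, σ i ((), (μ.prod ν).toFiniteMeasure, q)
      ∂((μ.prod ν).toFiniteMeasure : Measure (X × Y)) = m i ((), (μ.prod ν).toFiniteMeasure) := by
    intro i
    have h1 := integral_prod_of_bounded (μ := μ.toFiniteMeasure) (ν := ν.toFiniteMeasure)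
      (hσ.measurable_family i () (μ.prod ν).toFiniteMeasure) (fun _ => hσ0 _ _) fun _ => hσ1 _ _
    refine Eq.trans h1 ?_
    simp only [m, map_fst_toFiniteMeasure_prod, s, σ, hpar0, integral_div]
  -- Here the weighted sums are bounded by the telescoping estimate from `0`, with no appeal to
  -- randomness.
  obtain ⟨C, hC⟩ := exists_nat_ge (2 * √(tailBound (J ((), (μ.prod ν).toFiniteMeasure))
    (fun i => m i ((), (μ.prod ν).toFiniteMeasure)) 0))
  have key := tsum_lt_top_of_mem_schnorrRandomRel hσ hσ0 hσ1 hm hm0 hJ hmJ h (C := C) (fun n => by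
    simp only [hσm]
    rw [Finset.range_eq_Ico]
    exact (sum_div_sqrt_tailBound_le (hmJ _) (fun i => hm0 i _) n.zero_le).trans hC)
  rw [hsum]
  -- Undo the normalization; `1 + I` is a finite factor at the given point.
  have e : ∀ i, ENNReal.ofReal (τ i ((μ, x), ν.toFiniteMeasure, y)) =
      ENNReal.ofReal (σ i ((), (μ.prod ν).toFiniteMeasure, (x, y))) *
        ENNReal.ofReal (1 + I ((μ, x), ν.toFiniteMeasure)) := fun i => by
    rw [← ENNReal.ofReal_mul (hσ0 _ _)]
    simp only [σ, hpar0]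
    rw [div_mul_cancel₀ _ (hI1 _).ne']
  simp only [e, ENNReal.tsum_mul_right]
  exact ENNReal.mul_lt_top key ENNReal.ofReal_lt_top

theorem mem_schnorrRandom_prod_iff {μ : ProbabilityMeasure X} {ν : ProbabilityMeasure Y} {x : X}
    {y : Y} : (x, y) ∈ schnorrRandom (μ.prod ν).toFiniteMeasure ↔
      x ∈ schnorrRandomRel ν μ.toFiniteMeasure ∧
      y ∈ schnorrRandomRel (μ, x) ν.toFiniteMeasure :=
  ⟨fun h => ⟨fst_mem_schnorrRandomRel h, snd_mem_schnorrRandomRel h⟩,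
    fun h => mem_schnorrRandom_prod h.1 h.2⟩

end

end

theorem mainTheorem2 {X Y : Type*}
    [ComputableMetricSpace X] [MeasurableSpace X] [BorelSpace X]
    [ComputableMetricSpace Y] [MeasurableSpace Y] [BorelSpace Y]
    (μ : ProbabilityMeasure X) (ν : ProbabilityMeasure Y) (x : X) (y : Y) :
    ((x, y) ∈ schnorrRandom (μ.prod ν).toFiniteMeasure ↔
      x ∈ schnorrRandomRel ν μ.toFiniteMeasure ∧
      y ∈ schnorrRandomRel (μ, x) ν.toFiniteMeasure) ∧
    ((x ∈ schnorrRandomRel ν μ.toFiniteMeasure ∧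
      y ∈ schnorrRandomRel (μ, x) ν.toFiniteMeasure) ↔
      (y ∈ schnorrRandomRel μ ν.toFiniteMeasure ∧
      x ∈ schnorrRandomRel (ν, y) μ.toFiniteMeasure)) := by
  refine ⟨mem_schnorrRandom_prod_iff, ?_⟩
  -- Both sides become randomness of the pair, in the two orders of the factors.
  rw [← mem_schnorrRandom_prod_iff, ← mem_schnorrRandom_prod_iff]
  exact ⟨swap_mem_schnorrRandom_prod, swap_mem_schnorrRandom_prod⟩
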